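/- All graphs are finite and simple; $n$, $m$ and $\alpha$ denote the number of vertices, the number of edges and the arboricity of the graph (the least number of edge-disjoint spanning forests into which it can be decomposed). For a graph $G$ and a vertex $v$, $N(v)$ is the set of neighbours of $v$. The vertex $v$ dominates $w$ when $N(w)\subseteq N(v)$, and $\mathrm{Dom}(v)$ is the set of the vertices that dominate $v$ (so $v\in \mathrm{Dom}(v)$). $G$ is $C_4$-dominated when every cycle of length four contains two distinct vertices one of which dominates the other. A biclique is a pair $\{X,Y\}$ of nonempty independent sets with all the edges between $X$ and $Y$; it is maximal when $X\cup Y$ is not properly contained in the vertex set of another biclique. **(a) Enumeration.** There is an algorithm that, given a $C_4$-dominated triangle-free graph by its adjacency lists (in any order), lists all its maximal bicliques without duplicates in $O(n^2+\alpha m+1)$ time, and indeed in $O(n+\alpha m+o+1)$ time, with $O(n+\alpha m+1)$ space, where $o$ is the size of the output, that is, the sum of the numbers of vertices of the maximal bicliques. If the graph has no isolated vertices, the bounds are $O(\alpha m+o+1)$ time and $O(\alpha m+1)$ space. The machine is a random access machine with unit-cost instructions and words of $O(\log (n+2))$ bits; space is counted in words and does not include the write-only output. **(b) Repeated vertices.**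 Let $G$ be a $C_4$-dominated triangle-free graph in which no two distinct vertices have the same neighbourhood, with a total order $<$ of its vertices such that $v<w$ implies $|N(v)|\le |N(w)|$. Let $B(v)=\{N(v),\mathrm{Dom}(v)\cup\{v\}\}$, and say that $v$ is repeated if $|\mathrm{Dom}(v)|=|N(w)|$ and $|N(v)|=|\mathrm{Dom}(w)|$ for some $w\in N(v)$ with $w>v$. Then $v$ is repeated if and only if $B(v)=B(w)$ for some $w>v$. If moreover $G$ has no isolated vertices, then $v\mapsto B(v)$ is a bijection from the non-repeated vertices onto the maximal bicliques of $G$. **(c) Domination digraph.** Let $G$ and $<$ be as in (b), and let $G$ have no isolated vertices. For $w<v$ let $L(v,w)=\{x<v \mid x\in N(v)\cap N(w)\}$, and let $\mathcal S$ be the set of the pairs $(v,w)$ with $w<v$ and $L(v,w)\neq\emptyset$; such a pair is safe if $v$ dominates $w$, and unsafe otherwise. The digraph $U(G)$ has an edge $a\to b$ when $a<b$ are consecutive elements of $L(v,w)$ for some unsafe $(v,w)\in\mathcal S$; $S(G)$ is $U(G)$ together with the edges $w\to v$ for the safe $(v,w)\in\mathcal S$. A vertex $w$ is degenerated when it has no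 out-neighbour in $U(G)$ and all its neighbours are greater than $w$. The dominator set of $w$ is empty if $w=\max L(a,b)$ for some $(a,b)\in\mathcal S$, and otherwise it is $N(z)\setminus\{w\}$ with $z=\min N(w)$. The digraph $D(G)$ is $S(G)$ together with the edges $w\to v$ for every degenerated $w$ and every $v$ in the dominator set of $w$. Then $v$ dominates $w$ if and only if $D(G)$ has a (possibly trivial) path from $w$ to $v$, and $D(G)$ has at most $2m$ edges more than $S(G)$. -/

import Mathlib

namespace BicliqueEnum

section Graphs

variable {V : Type*}

/-- `v` dominates `w` when `N(w) ⊆ N(v)`. In particular every vertex dominates itself. -/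
def Dominates (G : SimpleGraph V) (v w : V) : Prop :=
  G.neighborSet w ⊆ G.neighborSet v

/-- The set of the vertices that dominate `v`. -/
def Dom (G : SimpleGraph V) (v : V) : Set V := {u | Dominates G u v}

def DomComparable (G : SimpleGraph V) (v w : V) : Prop :=
  Dominates G v w ∨ Dominates G w v

/-- Every cycle `a b c d` of length four contains two dom-comparable vertices. (Adjacent vertices
are never dom-comparable, so only the two opposite pairs matter.) -/
def C4Dominated (G : SimpleGraph V) : Prop :=
  ∀ a b c d : V, a ≠ c → b ≠ d → G.Adj a b → G.Adj b c → G.Adj c d → G.Adj d a →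
    DomComparable G a c ∨ DomComparable G b d

/-- No two distinct vertices have the same neighbourhood. -/
def TwinFree (G : SimpleGraph V) : Prop :=
  ∀ v w : V, G.neighborSet v = G.neighborSet w → v = w

def NoIsolated (G : SimpleGraph V) : Prop := ∀ v : V, ∃ w : V, G.Adj v w

/-- `X` and `Y` are the two sides of a biclique: nonempty independent sets with all the edges
between them (hence disjoint). -/
def IsBiclique (G : SimpleGraph V) (X Y : Set V) : Prop :=
  X.Nonempty ∧ Y.Nonempty ∧ (∀ x ∈ X, ∀ x' ∈ X, ¬ G.Adj x x') ∧
    (∀ y ∈ Y, ∀ y' ∈ Y, ¬ G.Adj y y') ∧ ∀ x ∈ X, ∀ y ∈ Y, G.Adj x y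

/-- A biclique whose vertex set is not properly contained in the vertex set of a biclique. -/
def IsMaximalBiclique (G : SimpleGraph V) (X Y : Set V) : Prop :=
  IsBiclique G X Y ∧
    ∀ X' Y' : Set V, IsBiclique G X' Y' → X ∪ Y ⊆ X' ∪ Y' → X' ∪ Y' = X ∪ Y

/-- The maximal bicliques, each one as the unordered pair of its sides. -/
def maximalBicliques (G : SimpleGraph V) : Set (Sym2 (Set V)) :=
  {B | ∃ X Y : Set V, B = s(X, Y) ∧ IsMaximalBiclique G X Y}

/-- The least number of edge-disjoint spanning forests into which `G` can be decomposed. -/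
noncomputable def arboricity (G : SimpleGraph V) : ℕ :=
  sInf {k : ℕ | ∃ F : Fin k → SimpleGraph V, (∀ i, (F i).IsAcyclic) ∧
    (∀ i j, i ≠ j → Disjoint (F i) (F j)) ∧ ∀ v w, G.Adj v w ↔ ∃ i, (F i).Adj v w}

/-- `B(v) = {N(v), Dom(v) ∪ {v}}`. -/
def bicliqueOf (G : SimpleGraph V) (v : V) : Sym2 (Set V) :=
  s(G.neighborSet v, insert v (Dom G v))

end Graphs

section Ordered

variable {V : Type*} [LinearOrder V]

/-- The linear order of the vertices is a degree ordering. -/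
def DegreeOrdered (G : SimpleGraph V) : Prop :=
  ∀ v w : V, v < w → (G.neighborSet v).ncard ≤ (G.neighborSet w).ncard

/-- `v` is repeated: `|Dom(v)| = |N(w)|` and `|N(v)| = |Dom(w)|` for some neighbour `w > v`. -/
def Repeated (G : SimpleGraph V) (v : V) : Prop :=
  ∃ w : V, G.Adj v w ∧ v < w ∧ (Dom G v).ncard = (G.neighborSet w).ncard ∧
    (G.neighborSet v).ncard = (Dom G w).ncard

/-- `L(v, w)`: the common neighbours of `v` and `w` that are smaller than `v`. -/
def leastCommon (G : SimpleGraph V) (v w : V) : Set V :=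
  {x | G.Adj v x ∧ G.Adj w x ∧ x < v}

/-- The squares family has a triple with high vertex `v` and low vertex `w`. -/
def IsTriple (G : SimpleGraph V) (v w : V) : Prop :=
  w < v ∧ (leastCommon G v w).Nonempty

/-- The unsafe domination digraph: `a → b` when `a` and `b` are consecutive in the set `L(v, w)` of
some triple such that `v` does not dominate `w`. -/
def unsafeDigraph (G : SimpleGraph V) (a b : V) : Prop :=
  ∃ v w : V, IsTriple G v w ∧ ¬ Dominates G v w ∧
    a ∈ leastCommon G v w ∧ b ∈ leastCommon G v w ∧ a < b ∧
    ∀ c ∈ leastCommon G v w, ¬ (a < c ∧ c < b)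

/-- The squares domination digraph: the unsafe domination digraph together with the edges `w → v`
of the triples such that `v` dominates `w`. -/
def squaresDigraph (G : SimpleGraph V) (a b : V) : Prop :=
  unsafeDigraph G a b ∨ (IsTriple G b a ∧ Dominates G b a)

/-- `w` has no out-neighbour in the unsafe domination digraph and no neighbour smaller than it. -/
def Degenerated (G : SimpleGraph V) (w : V) : Prop :=
  (∀ x : V, ¬ unsafeDigraph G w x) ∧ ∀ x : V, G.Adj w x → w < x

/-- The dominator set of `w`: it is empty when `w` is the greatest element of the set `L(a, b)` of
some triple, and otherwise it is `N(z) \ {w}`, where `z` is the least neighbour of `w`. -/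
def dominatorSet (G : SimpleGraph V) (w : V) : Set V :=
  {v | (∀ a b : V, IsTriple G a b → ¬ IsGreatest (leastCommon G a b) w) ∧ v ≠ w ∧
    ∃ z : V, IsLeast (G.neighborSet w) z ∧ G.Adj z v}

/-- The domination digraph: the squares domination digraph together with the edges from every
degenerated vertex to the members of its dominator set. -/
def dominationDigraph (G : SimpleGraph V) (a b : V) : Prop :=
  squaresDigraph G a b ∨ (Degenerated G a ∧ b ∈ dominatorSet G a)

/-- The number of edges of a digraph. -/
noncomputable def edgeCount (D : V → V → Prop) : ℕ := {p : V × V | D p.1 p.2}.ncard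

end Ordered

/-! A random access machine with programs in structured form: finitely many registers (those that
the program mentions), a memory of words that is addressed by registers, addition and truncated
subtraction, and a write-only output stream. Every instruction and every test takes one step. -/

section Machine

/-- Symbols of the output stream: vertices, a mark between the two sides of a biclique, and a mark
at the end of a biclique. -/
inductive Sym where
  | vertex (v : ℕ)
  | bar
  | close

structure State where
  reg : ℕ → ℕ
  mem : ℕ → ℕ
  out : List Sym

inductive Instr where
  | const (r k : ℕ)
  | copy (r a : ℕ)
  | add (r a b : ℕ)
  | sub (r a b : ℕ)
  | load (r a : ℕ)
  | store (a b : ℕ)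
  | emitVertex (a : ℕ)
  | emitBar
  | emitClose

inductive Test where
  | eq (a b : ℕ)
  | lt (a b : ℕ)

inductive Program where
  | skip
  | instr (i : Instr)
  | seq (p q : Program)
  | ite (b : Test) (p q : Program)
  | loop (b : Test) (p : Program)

def Test.Holds (σ : State) : Test → Prop
  | .eq a b => σ.reg a = σ.reg b
  | .lt a b => σ.reg a < σ.reg b

/-- Write `x` to the register `r`, provided that it fits in a word. -/
def State.setReg (W : ℕ) (σ : State) (r x : ℕ) : Option State :=
  if x ≤ W then some { σ with reg := Function.update σ.reg r x } else none

/-- The effect of an instruction on a machine with memory cells `0, …, S - 1` and words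
`0, …, W`; it is `none` when the instruction needs another cell or a greater word. -/
def Instr.exec (S W : ℕ) (σ : State) : Instr → Option State
  | .const r k => σ.setReg W r k
  | .copy r a => σ.setReg W r (σ.reg a)
  | .add r a b => σ.setReg W r (σ.reg a + σ.reg b)
  | .sub r a b => σ.setReg W r (σ.reg a - σ.reg b)
  | .load r a => if σ.reg a < S then σ.setReg W r (σ.mem (σ.reg a)) else none
  | .store a b =>
      if σ.reg a < S then some { σ with mem := Function.update σ.mem (σ.reg a) (σ.reg b) } else none
  | .emitVertex a => some { σ with out := σ.out ++ [Sym.vertex (σ.reg a)] }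
  | .emitBar => some { σ with out := σ.out ++ [Sym.bar] }
  | .emitClose => some { σ with out := σ.out ++ [Sym.close] }

/-- `Run S W p σ t τ`: on a machine with `S` memory cells and words at most `W`, the program `p`
started in the state `σ` halts in the state `τ` after `t` steps. -/
inductive Run (S W : ℕ) : Program → State → ℕ → State → Prop
  | skip (σ : State) : Run S W .skip σ 1 σ
  | instr (i : Instr) (σ τ : State) (h : i.exec S W σ = some τ) : Run S W (.instr i) σ 1 τ
  | seq (p q : Program) (σ τ ρ : State) (t u : ℕ) (hp : Run S W p σ t τ) (hq : Run S W q τ u ρ) :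
      Run S W (.seq p q) σ (t + u) ρ
  | iteTrue (b : Test) (p q : Program) (σ τ : State) (t : ℕ) (hb : b.Holds σ)
      (hp : Run S W p σ t τ) : Run S W (.ite b p q) σ (t + 1) τ
  | iteFalse (b : Test) (p q : Program) (σ τ : State) (t : ℕ) (hb : ¬ b.Holds σ)
      (hq : Run S W q σ t τ) : Run S W (.ite b p q) σ (t + 1) τ
  | loopEnd (b : Test) (p : Program) (σ : State) (hb : ¬ b.Holds σ) :
      Run S W (.loop b p) σ 1 σ
  | loopStep (b : Test) (p : Program) (σ τ ρ : State) (t u : ℕ) (hb : b.Holds σ)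
      (hp : Run S W p σ t τ) (hl : Run S W (.loop b p) τ u ρ) :
      Run S W (.loop b p) σ (t + u + 1) ρ

/-- `adj` lists the neighbours of every vertex, in any order and without repetitions. -/
def IsAdjacencyLists {n : ℕ} (G : SimpleGraph (Fin n)) (adj : Fin n → List (Fin n)) : Prop :=
  ∀ v, (adj v).Nodup ∧ ∀ w, w ∈ adj v ↔ G.Adj v w

/-- The input: the number of vertices, the lengths of the adjacency lists, and the adjacency lists,
one after the other. -/
def inputWords {n : ℕ} (adj : Fin n → List (Fin n)) : List ℕ :=
  n :: (List.ofFn fun v => (adj v).length) ++ ((List.ofFn adj).flatten.map Fin.val)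

/-- The input is in the first memory cells; all other cells and all registers contain `0`. -/
def startState {n : ℕ} (adj : Fin n → List (Fin n)) : State where
  reg := fun _ => 0
  mem := fun i => (inputWords adj).getD i 0
  out := []

/-- A pair of lists of vertices as it is written to the output stream. -/
def writeBiclique {n : ℕ} (b : List (Fin n) × List (Fin n)) : List Sym :=
  b.1.map (fun v => Sym.vertex v) ++ [Sym.bar] ++ b.2.map (fun v => Sym.vertex v) ++ [Sym.close]

def sidesOf {n : ℕ} (b : List (Fin n) × List (Fin n)) : Sym2 (Set (Fin n)) :=
  s({v | v ∈ b.1}, {v | v ∈ b.2})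

/-- `bs` lists every maximal biclique of `G` exactly once, and the vertices of each of its sides
exactly once. -/
def ListsMaximalBicliques {n : ℕ} (G : SimpleGraph (Fin n))
    (bs : List (List (Fin n) × List (Fin n))) : Prop :=
  (∀ b ∈ bs, b.1.Nodup ∧ b.2.Nodup) ∧ (bs.map sidesOf).Nodup ∧
    ∀ B, B ∈ bs.map sidesOf ↔ B ∈ maximalBicliques G

/-- The total number of vertices in the listed bicliques. -/
def listingSize {n : ℕ} (bs : List (List (Fin n) × List (Fin n))) : ℕ :=
  (bs.map fun b => b.1.length + b.2.length).sum

end Machine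

end BicliqueEnum

/-! Bicliques. In a cycle of length four one opposite pair is comparable under domination. So if one
side of a biclique contains two incomparable vertices, any two vertices of the other side are
comparable. Every maximal biclique therefore has a side that is a chain. A vertex `x` of least
degree in that side is dominated by the whole side, and maximality makes the biclique equal to
`{N(x), Dom(x)}` (`mem_maximalBicliques_iff`). Without twins, two vertices can share their biclique
only with the sides exchanged; since `Dom(v) ⊆ N(w)` for adjacent `v` and `w`, sizes then decide
equality (`repeated_iff`).

Domination digraph. If `v` and `w` are incomparable, their common neighbours are pairwise
comparable, so the edges of `U(G)` are dominations. A domination of `w` by `v` is a safe edge when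
`w` has a neighbour below `v`; it is a path of unsafe edges when two neighbours of `w` are
incomparable; otherwise `w` is degenerated and has a direct edge to `v` (`path_of_dominates`). The
direct edges inject into the oriented edges of `G`.

Algorithm. Vertices are ranked by degree and processed from the greatest rank down. The round of `v`
looks at the paths `v - u - w` with `u` below `v`, and works on those with `w` below `v` too. The
total is a sum over the edges of the smaller degree of an end, at most `2 α m` because in each of
`α` forests a vertex pays for at most one edge (`sum_low_degree_le`). Whether `v` dominates `w` is
decided in constant time (`testCode_spec`). If two incomparable neighbours of `w` are recorded,
adjacency of `v` to both suffices. If none are, the neighbours of `w` above `v` dominate `u`, hence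
are adjacent to `v`, and it remains to count the common neighbours below `v`.

When `v` dominates `w`, it is put in front of a list of `w`. Otherwise the common neighbours of `v`
and `w` below `v` form a chain and are linked consecutively: all further greater dominators of `u`
dominate the next element `y`. So the dominators of `u` are `u` followed by the list of `y`, and
lists share tails instead of being copied (`LinkInv.step`, `tailCode_spec`). The search is thus
independent of the output size; only the final pass pays for the output, and it uses no new memory.

The lists may be incomplete for vertices that lie below all their neighbours when these form a
chain. If such a vertex is not isolated, its biclique is that of its least neighbour. These vertices
are skipped, as are vertices with a twin of smaller rank and vertices whose biclique occurs again at
a greater neighbour. The remaining vertices represent each maximal biclique exactly once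
(`selected_injective`, `exists_selected`).

Machine. The algorithm is written in a small language with arrays that compiles with constant
overhead (`ArrCmd.run_compile`). Values grow only through successor operations, so a bound on the
time of the search also bounds the memory and the words (`eval_bounded`). -/

namespace BicliqueEnum

/-! ### A language with arrays, and its compilation to the machine -/

section ArrayLanguage

/-- Expressions of the array language: variables, constants, input words, array entries. -/
inductive ArrExpr where
  | var (x : ℕ)
  | lit (k : ℕ)
  | inp (e : ArrExpr)
  | arr (f : ℕ) (e : ArrExpr)
  | succ (e : ArrExpr)
  | sub (e e' : ArrExpr)

/-- Commands of the array language. The loop `forr x e c` runs `c` for `x = 0, …, e - 1`. -/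
inductive ArrCmd where
  | skip
  | assign (x : ℕ) (e : ArrExpr)
  | store (f : ℕ) (e e' : ArrExpr)
  | seq (c c' : ArrCmd)
  | ifEq (e e' : ArrExpr) (c c' : ArrCmd)
  | forr (x : ℕ) (e : ArrExpr) (c : ArrCmd)
  | emitVertex (e : ArrExpr)
  | emitBar
  | emitClose

@[ext] structure ArrState where
  reg : ℕ → ℕ
  arr : ℕ → ℕ → ℕ
  inp : ℕ → ℕ
  out : List Sym

namespace ArrState

def setReg (s : ArrState) (x k : ℕ) : ArrState :=
  { s with reg := Function.update s.reg x k }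

def setArr (s : ArrState) (f i k : ℕ) : ArrState :=
  { s with arr := Function.update s.arr f (Function.update (s.arr f) i k) }

def emit (s : ArrState) (a : Sym) : ArrState := { s with out := s.out ++ [a] }

/-- All values in the state are at most `B`. -/
structure Bounded (s : ArrState) (B : ℕ) : Prop where
  reg : ∀ x, s.reg x ≤ B
  arr : ∀ f i, s.arr f i ≤ B
  inp : ∀ i, s.inp i ≤ B

@[simp] lemma setReg_arr (s : ArrState) (x k : ℕ) : (s.setReg x k).arr = s.arr := rfl
@[simp] lemma setReg_inp (s : ArrState) (x k : ℕ) : (s.setReg x k).inp = s.inp := rfl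
@[simp] lemma setReg_out (s : ArrState) (x k : ℕ) : (s.setReg x k).out = s.out := rfl
@[simp] lemma setArr_reg (s : ArrState) (f i k : ℕ) : (s.setArr f i k).reg = s.reg := rfl
@[simp] lemma setArr_inp (s : ArrState) (f i k : ℕ) : (s.setArr f i k).inp = s.inp := rfl
@[simp] lemma setArr_out (s : ArrState) (f i k : ℕ) : (s.setArr f i k).out = s.out := rfl
@[simp] lemma emit_reg (s : ArrState) (a : Sym) : (s.emit a).reg = s.reg := rfl
@[simp] lemma emit_arr (s : ArrState) (a : Sym) : (s.emit a).arr = s.arr := rfl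
@[simp] lemma emit_inp (s : ArrState) (a : Sym) : (s.emit a).inp = s.inp := rfl
@[simp] lemma emit_out (s : ArrState) (a : Sym) : (s.emit a).out = s.out ++ [a] := rfl

lemma setReg_reg (s : ArrState) (x k y : ℕ) :
    (s.setReg x k).reg y = if y = x then k else s.reg y := by
  simp [setReg, Function.update_apply]

lemma setArr_arr (s : ArrState) (f i k g : ℕ) :
    (s.setArr f i k).arr g = if g = f then Function.update (s.arr f) i k else s.arr g := by
  simp [setArr, Function.update_apply]

lemma Bounded.mono {s : ArrState} {B B' : ℕ} (h : s.Bounded B) (hB : B ≤ B') : s.Bounded B' :=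
  ⟨fun x => (h.reg x).trans hB, fun f i => (h.arr f i).trans hB, fun i => (h.inp i).trans hB⟩

lemma Bounded.setReg {s : ArrState} {B x k : ℕ} (h : s.Bounded B) (hk : k ≤ B) :
    (s.setReg x k).Bounded B := by
  refine ⟨fun y => ?_, h.arr, h.inp⟩
  rw [setReg_reg]; split_ifs
  exacts [hk, h.reg y]

lemma Bounded.setArr {s : ArrState} {B f i k : ℕ} (h : s.Bounded B) (hk : k ≤ B) :
    (s.setArr f i k).Bounded B := by
  refine ⟨h.reg, fun g j => ?_, h.inp⟩
  rw [setArr_arr]; split_ifs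
  · rw [Function.update_apply]; split_ifs
    exacts [hk, h.arr f j]
  · exact h.arr g j

end ArrState

namespace ArrExpr

def val (s : ArrState) : ArrExpr → ℕ
  | var x => s.reg x
  | lit k => k
  | inp e => s.inp (e.val s)
  | arr f e => s.arr f (e.val s)
  | succ e => e.val s + 1
  | sub e e' => e.val s - e'.val s

def size : ArrExpr → ℕ
  | var _ => 1
  | lit _ => 1
  | inp e => e.size + 1
  | arr _ e => e.size + 1
  | succ e => e.size + 1
  | sub e e' => e.size + e'.size + 1

/-- The number of successor operations in an expression. -/
def succs : ArrExpr → ℕ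
  | var _ => 0
  | lit _ => 0
  | inp e => e.succs
  | arr _ e => e.succs
  | succ e => e.succs + 1
  | sub e e' => e.succs + e'.succs

/-- Constants are at most `b`, and the array numbers are less than `32`. -/
def Fits (b : ℕ) : ArrExpr → Prop
  | var _ => True
  | lit k => k ≤ b
  | inp e => e.Fits b
  | arr f e => f < 32 ∧ e.Fits b
  | succ e => e.Fits b
  | sub e e' => e.Fits b ∧ e'.Fits b

instance decidableFits (b : ℕ) : (e : ArrExpr) → Decidable (e.Fits b)
  | var _ => isTrue trivial
  | lit k => inferInstanceAs (Decidable (k ≤ b))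
  | inp e => decidableFits b e
  | arr _ e => @instDecidableAnd _ _ _ (decidableFits b e)
  | succ e => decidableFits b e
  | sub e e' => @instDecidableAnd _ _ (decidableFits b e) (decidableFits b e')

lemma succs_le_size (e : ArrExpr) : e.succs ≤ e.size := by
  induction e <;> simp only [succs, size] <;> omega

/-- Variables, array entries and input words are bounded by `B`, and subtraction does not increase a
value, so only a successor can exceed the bound, by one each time. -/
lemma val_le {s : ArrState} {B b : ℕ} (hs : s.Bounded B) (hb : b ≤ B) {e : ArrExpr}
    (he : e.Fits b) : e.val s ≤ B + e.succs := by
  induction e with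
  | var x => exact hs.reg x
  | lit k => exact (show k ≤ b from he).trans hb
  | inp e ih => exact (hs.inp _).trans (Nat.le_add_right _ _)
  | arr f e ih => exact (hs.arr _ _).trans (Nat.le_add_right _ _)
  | succ e ih => exact Nat.succ_le_succ (ih he)
  | sub e e' ih ih' => have := ih he.1; simp only [val, succs]; omega

end ArrExpr

namespace ArrCmd

/-- The state after `k` iterations of a loop with body `f`. -/
def iter (f : ArrState → ArrState) (x : ℕ) (s : ArrState) : ℕ → ArrState
  | 0 => s
  | k + 1 => f ((iter f x s k).setReg x k)

def eval : ArrCmd → ArrState → ArrState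
  | skip, s => s
  | assign x e, s => s.setReg x (e.val s)
  | store f e e', s => s.setArr f (e.val s) (e'.val s)
  | seq c c', s => c'.eval (c.eval s)
  | ifEq e e' c c', s => if e.val s = e'.val s then c.eval s else c'.eval s
  | forr x e c, s => iter c.eval x s (e.val s)
  | emitVertex e, s => s.emit (.vertex (e.val s))
  | emitBar, s => s.emit .bar
  | emitClose, s => s.emit .close

def cost : ArrCmd → ArrState → ℕ
  | skip, _ => 1
  | assign _ e, _ => e.size + 1
  | store _ e e', _ => e.size + e'.size + 1
  | seq c c', s => c.cost s + c'.cost (c.eval s)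
  | ifEq e e' c c', s =>
      e.size + e'.size + 1 + if e.val s = e'.val s then c.cost s else c'.cost s
  | forr x e c, s =>
      e.size + 1 + ∑ k ∈ Finset.range (e.val s), (1 + c.cost ((iter c.eval x s k).setReg x k))
  | emitVertex e, _ => e.size + 1
  | emitBar, _ => 1
  | emitClose, _ => 1

/-- The number of successor operations that are carried out. -/
def inc : ArrCmd → ArrState → ℕ
  | skip, _ => 0
  | assign _ e, _ => e.succs
  | store _ e e', _ => e.succs + e'.succs
  | seq c c', s => c.inc s + c'.inc (c.eval s)
  | ifEq e e' c c', s =>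
      e.succs + e'.succs + if e.val s = e'.val s then c.inc s else c'.inc s
  | forr x e c, s =>
      e.succs + ∑ k ∈ Finset.range (e.val s), c.inc ((iter c.eval x s k).setReg x k)
  | emitVertex e, _ => e.succs
  | emitBar, _ => 0
  | emitClose, _ => 0

/-- There is no successor operation in the command. -/
def NoSucc : ArrCmd → Prop
  | skip => True
  | assign _ e => e.succs = 0
  | store _ e e' => e.succs = 0 ∧ e'.succs = 0
  | seq c c' => c.NoSucc ∧ c'.NoSucc
  | ifEq e e' c c' => e.succs = 0 ∧ e'.succs = 0 ∧ c.NoSucc ∧ c'.NoSucc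
  | forr _ e c => e.succs = 0 ∧ c.NoSucc
  | emitVertex e => e.succs = 0
  | emitBar => True
  | emitClose => True

def Fits (b : ℕ) : ArrCmd → Prop
  | skip => True
  | assign _ e => e.Fits b
  | store f e e' => f < 32 ∧ e.Fits b ∧ e'.Fits b
  | seq c c' => c.Fits b ∧ c'.Fits b
  | ifEq e e' c c' => e.Fits b ∧ e'.Fits b ∧ c.Fits b ∧ c'.Fits b
  | forr _ e c => e.Fits b ∧ c.Fits b
  | emitVertex e => e.Fits b
  | emitBar => True
  | emitClose => True

/-- Turns a bound on the time into a bound on the values that occur, hence on the memory. -/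
lemma inc_le_cost (c : ArrCmd) (s : ArrState) : c.inc s ≤ c.cost s := by
  induction c generalizing s with
  | skip => exact Nat.zero_le _
  | assign x e => have := e.succs_le_size; simp only [inc, cost]; omega
  | store f e e' =>
    have := e.succs_le_size; have := e'.succs_le_size; simp only [inc, cost]; omega
  | seq c c' ih ih' => exact Nat.add_le_add (ih s) (ih' _)
  | ifEq e e' c c' ih ih' =>
    have := e.succs_le_size; have := e'.succs_le_size; have := ih s; have := ih' s
    simp only [inc, cost]; split_ifs <;> omega
  | forr x e c ih =>
    have := e.succs_le_size
    simp only [inc, cost]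
    refine Nat.add_le_add (by omega) (Finset.sum_le_sum fun k _ => (ih _).trans (by omega))
  | emitVertex e => have := e.succs_le_size; simp only [inc, cost]; omega
  | emitBar => exact Nat.zero_le _
  | emitClose => exact Nat.zero_le _

lemma inc_eq_zero {c : ArrCmd} (h : c.NoSucc) (s : ArrState) : c.inc s = 0 := by
  induction c generalizing s with
  | skip => rfl
  | assign x e => exact h
  | store f e e' => simp only [inc, h.1, h.2]
  | seq c c' ih ih' => simp only [inc, ih h.1, ih' h.2]
  | ifEq e e' c c' ih ih' => simp [inc, h.1, h.2.1, ih h.2.2.1, ih' h.2.2.2]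
  | forr x e c ih => simp [inc, h.1, ih h.2]
  | emitVertex e => exact h
  | emitBar => rfl
  | emitClose => rfl

@[simp] lemma eval_inp (c : ArrCmd) (s : ArrState) : (c.eval s).inp = s.inp := by
  induction c generalizing s with
  | seq c c' ih ih' => simp only [eval, ih', ih]
  | ifEq e e' c c' ih ih' => simp only [eval]; split_ifs <;> simp [ih, ih']
  | forr x e c ih =>
    simp only [eval]
    generalize e.val s = n
    induction n with
    | zero => rfl
    | succ n ihn => simp [iter, ih, ihn]
  | _ => rfl

/-- Array indices are values, so this bound on the growth of values is what limits the addresses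
that a command can reach. -/
lemma eval_bounded {b : ℕ} {c : ArrCmd} (hc : c.Fits b) {s : ArrState} {B : ℕ} (hb : b ≤ B)
    (hs : s.Bounded B) : (c.eval s).Bounded (B + c.inc s) := by
  induction c generalizing s B with
  | skip => exact hs
  | assign x e => exact (hs.mono (Nat.le_add_right _ _)).setReg (ArrExpr.val_le hs hb hc)
  | store f e e' =>
    refine (hs.mono (Nat.le_add_right _ _)).setArr ((ArrExpr.val_le hs hb hc.2.2).trans ?_)
    simp only [inc]; omega
  | seq c c' ih ih' =>
    have := ih' hc.2 (hb.trans (Nat.le_add_right _ _)) (ih hc.1 hb hs)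
    rwa [Nat.add_assoc] at this
  | ifEq e e' c c' ih ih' =>
    simp only [eval, inc]
    split_ifs
    · exact (ih hc.2.2.1 hb hs).mono (by omega)
    · exact (ih' hc.2.2.2 hb hs).mono (by omega)
  | forr x e c ih =>
    simp only [eval, inc]
    have hN := ArrExpr.val_le hs hb hc.1
    have key : ∀ k ≤ e.val s, (iter c.eval x s k).Bounded
        (B + (e.succs + ∑ j ∈ Finset.range k, c.inc ((iter c.eval x s j).setReg x j))) := by
      intro k hk
      induction k with
      | zero => exact hs.mono (Nat.le_add_right _ _)
      | succ k ihk =>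
        rw [Finset.sum_range_succ]
        -- The counter `k` is below the value of `e`, which is at most `B + e.succs`; writing it
        -- needs no further allowance.
        refine (ih hc.2 ?_ ((ihk (by omega)).setReg (k := k) ?_)).mono (by omega)
        · omega
        · omega
    exact key _ le_rfl
  | emitVertex e => exact ⟨fun x => (hs.reg x).trans (by simp), fun f i => (hs.arr f i).trans
      (by simp), fun i => (hs.inp i).trans (by simp)⟩
  | emitBar => exact ⟨hs.reg, hs.arr, hs.inp⟩
  | emitClose => exact ⟨hs.reg, hs.arr, hs.inp⟩

lemma iter_bounded {b : ℕ} {c : ArrCmd} (hc : c.Fits b) {s : ArrState} {B : ℕ} (hb : b ≤ B)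
    (hs : s.Bounded B) (x N : ℕ) (hN : N ≤ B + 1) :
    (iter c.eval x s N).Bounded
      (B + ∑ j ∈ Finset.range N, c.inc ((iter c.eval x s j).setReg x j)) := by
  induction N with
  | zero => simpa [iter] using hs
  | succ k ihk =>
    rw [Finset.sum_range_succ, ← Nat.add_assoc]
    refine eval_bounded hc (by omega) ((ihk (by omega)).setReg (k := k) (by omega))

end ArrCmd

/-! Compilation. Register `0` holds the address `E` behind the input and register `1` the number
`1`; the variables have the even registers from `4` on, and the odd registers from `5` on hold
intermediate results and loop counters. Entry `i` of array `f` is at the address `E + 32 i + f`. -/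

def varReg (x : ℕ) : ℕ := 4 + 2 * x
def tmpReg (d : ℕ) : ℕ := 5 + 2 * d

/-- Replace the index in register `r` by the address of that entry of array `f`. -/
def addressCode (f r : ℕ) : Program :=
  .seq (.instr (.add r r r)) <| .seq (.instr (.add r r r)) <| .seq (.instr (.add r r r)) <|
  .seq (.instr (.add r r r)) <| .seq (.instr (.add r r r)) <| .seq (.instr (.add r r 0)) <|
  .seq (.instr (.const 2 f)) (.instr (.add r r 2))

def ArrExpr.compile (d : ℕ) : ArrExpr → Program
  | var x => .instr (.copy (tmpReg d) (varReg x))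
  | lit k => .instr (.const (tmpReg d) k)
  | inp e => .seq (e.compile d) <| .ite (.lt (tmpReg d) 0) (.instr (.load (tmpReg d) (tmpReg d)))
      (.instr (.const (tmpReg d) 0))
  | arr f e => .seq (e.compile d) <| .seq (addressCode f (tmpReg d)) <|
      .instr (.load (tmpReg d) (tmpReg d))
  | succ e => .seq (e.compile d) (.instr (.add (tmpReg d) (tmpReg d) 1))
  | sub e e' => .seq (e.compile d) <| .seq (e'.compile (d + 1)) <|
      .instr (.sub (tmpReg d) (tmpReg d) (tmpReg (d + 1)))

def ArrCmd.compile (d : ℕ) : ArrCmd → Program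
  | skip => .skip
  | assign x e => .seq (e.compile d) (.instr (.copy (varReg x) (tmpReg d)))
  | store f e e' => .seq (e.compile d) <| .seq (e'.compile (d + 1)) <|
      .seq (addressCode f (tmpReg d)) (.instr (.store (tmpReg d) (tmpReg (d + 1))))
  | seq c c' => .seq (c.compile d) (c'.compile d)
  | ifEq e e' c c' => .seq (e.compile d) <| .seq (e'.compile (d + 1)) <|
      .ite (.eq (tmpReg d) (tmpReg (d + 1))) (c.compile d) (c'.compile d)
  | forr x e c => .seq (.instr (.const (tmpReg d) 0)) <| .seq (e.compile (d + 1)) <|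
      .loop (.lt (tmpReg d) (tmpReg (d + 1))) <|
        .seq (.instr (.copy (varReg x) (tmpReg d))) <| .seq (c.compile (d + 2)) <|
          .instr (.add (tmpReg d) (tmpReg d) 1)
  | emitVertex e => .seq (e.compile d) (.instr (.emitVertex (tmpReg d)))
  | emitBar => .instr .emitBar
  | emitClose => .instr .emitClose

/-- The machine state `σ` represents the state `s` of the array language. -/
structure Represents (E : ℕ) (s : ArrState) (σ : State) : Prop where
  base : σ.reg 0 = E
  one : σ.reg 1 = 1
  reg : ∀ x, σ.reg (varReg x) = s.reg x
  inp : ∀ i < E, σ.mem i = s.inp i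
  inp_zero : ∀ i, E ≤ i → s.inp i = 0
  arr : ∀ f < 32, ∀ i, σ.mem (E + 32 * i + f) = s.arr f i
  out : σ.out = s.out

/-- The two states agree, except for the scratch registers that are available at depth `d`. -/
structure AgreesUpTo (d : ℕ) (σ τ : State) : Prop where
  reg : ∀ r, r ≠ 2 → (∀ d', d ≤ d' → r ≠ tmpReg d') → τ.reg r = σ.reg r
  mem : τ.mem = σ.mem
  out : τ.out = σ.out

lemma AgreesUpTo.represents {d E : ℕ} {s : ArrState} {σ τ : State} (h : AgreesUpTo d σ τ)
    (hσ : Represents E s σ) : Represents E s τ where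
  base := by rw [h.reg 0 (by omega) (by intro d'; simp only [tmpReg]; omega), hσ.base]
  one := by rw [h.reg 1 (by omega) (by intro d'; simp only [tmpReg]; omega), hσ.one]
  reg x := by
    rw [h.reg _ (by simp only [varReg]; omega)
      (by intro d'; simp only [tmpReg, varReg]; omega), hσ.reg]
  inp := by rw [h.mem]; exact hσ.inp
  inp_zero := hσ.inp_zero
  arr := by rw [h.mem]; exact hσ.arr
  out := by rw [h.out, hσ.out]

lemma AgreesUpTo.tmp {d : ℕ} {σ τ : State} (h : AgreesUpTo d σ τ) {d' : ℕ} (hd : d' < d) :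
    τ.reg (tmpReg d') = σ.reg (tmpReg d') :=
  h.reg _ (by simp only [tmpReg]; omega) (by intro d''; simp only [tmpReg]; omega)

lemma AgreesUpTo.trans {d d' : ℕ} {σ τ ρ : State} (h : AgreesUpTo d σ τ) (h' : AgreesUpTo d' τ ρ)
    (hd : d ≤ d') : AgreesUpTo d σ ρ where
  reg r hr hr' := by rw [h'.reg r hr fun e he => hr' e (hd.trans he), h.reg r hr hr']
  mem := by rw [h'.mem, h.mem]
  out := by rw [h'.out, h.out]

lemma Run.setReg {S W r x : ℕ} {i : Instr} {σ : State} (h : i.exec S W σ = σ.setReg W r x)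
    (hx : x ≤ W) : Run S W (.instr i) σ 1 { σ with reg := Function.update σ.reg r x } :=
  Run.instr _ _ _ (by rw [h, State.setReg, if_pos hx])

lemma agreesUpTo_setReg (σ : State) (d x : ℕ) :
    AgreesUpTo d σ { σ with reg := Function.update σ.reg (tmpReg d) x } where
  reg r hr hr' := by simp [Function.update_of_ne (hr' d le_rfl)]
  mem := rfl
  out := rfl

/-- The run of the address computation. -/
lemma run_addressCode {S W E f d i : ℕ} {σ : State} (hf : f < 32) (hE : σ.reg 0 = E)
    (hi : σ.reg (tmpReg d) = i) (hW : E + 32 * i + 32 ≤ W) :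
    ∃ τ, Run S W (addressCode f (tmpReg d)) σ 8 τ ∧ τ.reg (tmpReg d) = E + 32 * i + f ∧
      AgreesUpTo d σ τ ∧ ∀ d', d' ≠ d → τ.reg (tmpReg d') = σ.reg (tmpReg d') := by
  have h0 : (0 : ℕ) ≠ tmpReg d := by simp only [tmpReg]; omega
  have h2 : (2 : ℕ) ≠ tmpReg d := by simp only [tmpReg]; omega
  have hE' : (0 : ℕ) ≠ 2 := by omega
  -- Five doublings multiply the index by `32`; then the base `E` and, through register `2`, the
  -- array number are added.
  refine ⟨_, Run.seq _ _ _ _ _ 1 7 (.setReg rfl ?_) (.seq _ _ _ _ _ 1 6 (.setReg rfl ?_)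
      (.seq _ _ _ _ _ 1 5 (.setReg rfl ?_) (.seq _ _ _ _ _ 1 4 (.setReg rfl ?_)
      (.seq _ _ _ _ _ 1 3 (.setReg rfl ?_) (.seq _ _ _ _ _ 1 2 (.setReg rfl ?_)
      (.seq _ _ _ _ _ 1 1 (.setReg rfl ?_) (.setReg rfl ?_))))))), ?_, ⟨fun r hr hr' => ?_, rfl, rfl⟩,
      fun d' hd' => ?_⟩
  case refine_9 => simp [h2.symm, h0, hE, hi]; omega
  case refine_10 =>
    have := hr' d le_rfl
    simp [Function.update_apply, this, hr]
  case refine_11 =>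
    have h : tmpReg d' ≠ tmpReg d := by simp only [tmpReg]; omega
    have h' : tmpReg d' ≠ 2 := by simp only [tmpReg]; omega
    simp [Function.update_apply, h, h']
  all_goals try simp [h2.symm, h0, hE, hi]
  all_goals omega

/-- All indices are at most `M`, so `E + 32 M + 32` cells have room for the entries of all `32`
arrays. Code compiled at depth `d` writes only scratch registers from depth `d` on, so a second
operand compiled at depth `d + 1` preserves the first. The factor `10` covers an array access: eight
steps for the address and one for the load. -/
lemma ArrExpr.run_compile {S W E M B b : ℕ} (hS : E + 32 * M + 32 ≤ S) (hSW : S ≤ W)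
    {s : ArrState} (hs : s.Bounded B) (hb : b ≤ B) (e : ArrExpr) (he : e.Fits b)
    (hM : B + e.succs ≤ M) (d : ℕ) {σ : State} (hσ : Represents E s σ) :
    ∃ t τ, Run S W (e.compile d) σ t τ ∧ τ.reg (tmpReg d) = e.val s ∧ AgreesUpTo d σ τ ∧
      t ≤ 10 * e.size := by
  induction e generalizing d σ with
  | var x =>
    refine ⟨1, _, .setReg rfl ?_, by simp [hσ.reg, val], agreesUpTo_setReg _ _ _, by simp [size]⟩
    rw [hσ.reg]; have := hs.reg x; omega
  | lit k =>
    refine ⟨1, _, .setReg rfl ?_, by simp [val], agreesUpTo_setReg _ _ _, by simp [size]⟩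
    have : k ≤ b := he
    omega
  | inp e ih =>
    simp only [succs] at hM
    obtain ⟨t, τ, hr, hv, ha, ht⟩ := ih he hM d hσ
    have hτ := ha.represents hσ
    -- Behind the input the language reads `0`, whereas the machine cell there belongs to an array;
    -- the test in the compiled code separates the two cases.
    by_cases h : e.val s < E
    · refine ⟨t + (1 + 1), _, .seq _ _ _ _ _ _ _ hr (.iteTrue _ _ _ _ _ _ ?_ (.setReg (r := tmpReg d)
        (x := s.inp (e.val s)) ?_ ?_)), by simp [val], ha.trans (agreesUpTo_setReg _ _ _) le_rfl, ?_⟩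
      · simpa [Test.Holds, hv, hτ.base] using h
      · simp only [Instr.exec, hv, hτ.inp _ h, if_pos (show e.val s < S by omega)]
      · have := hs.inp (e.val s); omega
      · simp only [size]; omega
    · refine ⟨t + (1 + 1), _, .seq _ _ _ _ _ _ _ hr (.iteFalse _ _ _ _ _ _ ?_ (.setReg rfl ?_)),
        by simp [val, hσ.inp_zero _ (not_lt.mp h)],
        ha.trans (agreesUpTo_setReg _ _ _) le_rfl, ?_⟩
      · simpa [Test.Holds, hv, hτ.base] using h
      · omega
      · simp only [size]; omega
  | arr f e ih =>
    simp only [succs] at hM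
    obtain ⟨t, τ, hr, hv, ha, ht⟩ := ih he.2 hM d hσ
    have hτ := ha.represents hσ
    have hle := val_le hs hb he.2
    obtain ⟨ρ, hr', hv', ha', -⟩ := run_addressCode (S := S) (W := W) (d := d) he.1 hτ.base hv
      (by omega)
    have hρ := ha'.represents hτ
    have hf := he.1
    refine ⟨t + (8 + 1), _, .seq _ _ _ _ _ _ _ hr (.seq _ _ _ _ _ _ _ hr'
      (.setReg (r := tmpReg d) (x := s.arr f (e.val s)) ?_ ?_)), by simp [val],
      (ha.trans ha' le_rfl).trans (agreesUpTo_setReg _ _ _) le_rfl, ?_⟩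
    · simp only [Instr.exec, hv', hρ.arr f he.1]
      rw [if_pos (by omega)]
    · have := hs.arr f (e.val s); omega
    · simp only [size]; omega
  | succ e ih =>
    simp only [succs] at hM
    obtain ⟨t, τ, hr, hv, ha, ht⟩ := ih he (by omega) d hσ
    have hτ := ha.represents hσ
    have hle := val_le (e := e) hs hb he
    refine ⟨t + 1, _, .seq _ _ _ _ _ _ _ hr (.setReg rfl ?_), by simp [val, hv, hτ.one],
      ha.trans (agreesUpTo_setReg _ _ _) le_rfl, ?_⟩
    · rw [hv, hτ.one]; omega
    · simp only [size]; omega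
  | sub e e' ih ih' =>
    simp only [succs] at hM
    obtain ⟨t, τ, hr, hv, ha, ht⟩ := ih he.1 (by omega) d hσ
    have hτ := ha.represents hσ
    obtain ⟨t', ρ, hr', hv', ha', ht'⟩ := ih' he.2 (by omega) (d + 1) hτ
    have hle := val_le hs hb he.1
    have hd := ha'.tmp (Nat.lt_succ_self d)
    refine ⟨t + (t' + 1), _, .seq _ _ _ _ _ _ _ hr (.seq _ _ _ _ _ _ _ hr' (.setReg rfl ?_)),
      by simp [val, hd, hv, hv'],
      (ha.trans ha' (Nat.le_succ d)).trans (agreesUpTo_setReg _ _ _) le_rfl, ?_⟩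
    · rw [hd, hv, hv']; omega
    · simp only [size]; omega

end ArrayLanguage

/-! ### Correctness of the compiled commands -/

section Compilation

variable {S W E M b : ℕ}

lemma Represents.setVar {s : ArrState} {σ : State} (h : Represents E s σ) (x k : ℕ) :
    Represents E (s.setReg x k) { σ with reg := Function.update σ.reg (varReg x) k } where
  base := by simp only [varReg]; rw [Function.update_of_ne (by omega)]; exact h.base
  one := by simp only [varReg]; rw [Function.update_of_ne (by omega)]; exact h.one
  reg y := by
    simp only [ArrState.setReg_reg, Function.update_apply, ← h.reg, varReg]
    exact if_congr (by omega) rfl rfl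
  inp := h.inp
  inp_zero := h.inp_zero
  arr := h.arr
  out := h.out

lemma Represents.setEntry {s : ArrState} {σ : State} (h : Represents E s σ) {f : ℕ} (hf : f < 32)
    (i k : ℕ) : Represents E (s.setArr f i k)
      { σ with mem := Function.update σ.mem (E + 32 * i + f) k } where
  base := h.base
  one := h.one
  reg := h.reg
  inp j hj := by
    simp only [ArrState.setArr_inp]
    rw [Function.update_of_ne (by omega)]; exact h.inp j hj
  inp_zero := h.inp_zero
  arr g hg j := by
    simp only [ArrState.setArr_arr, Function.update_apply]
    by_cases hgf : g = f
    · subst hgf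
      by_cases hij : j = i
      · simp [hij]
      · rw [if_neg (by omega), h.arr g hg]; simp [hij]
    · rw [if_neg (by omega), h.arr g hg]; simp [hgf]
  out := h.out

lemma tmpReg_ne_varReg (d x : ℕ) : tmpReg d ≠ varReg x := by
  simp only [tmpReg, varReg]; omega

/-- The array language is implemented by the machine with constant overhead. -/
lemma ArrCmd.run_compile (hS : E + 32 * M + 32 ≤ S) (hSW : S ≤ W) (c : ArrCmd) (hc : c.Fits b)
    {s : ArrState} {B : ℕ} (hb : b ≤ B) (hs : s.Bounded B) (hM : B + c.inc s ≤ M) (d : ℕ)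
    {σ : State} (hσ : Represents E s σ) :
    ∃ t τ, Run S W (c.compile d) σ t τ ∧ Represents E (c.eval s) τ ∧
      (∀ d' < d, τ.reg (tmpReg d') = σ.reg (tmpReg d')) ∧ t ≤ 20 * c.cost s := by
  induction c generalizing s B d σ with
  | skip => exact ⟨1, σ, .skip σ, hσ, fun _ _ => rfl, by simp [cost]⟩
  | assign x e =>
    simp only [inc] at hM
    obtain ⟨t, τ, hr, hv, ha, ht⟩ := e.run_compile hS hSW hs hb hc hM d hσ
    refine ⟨t + 1, _, .seq _ _ _ _ _ _ _ hr (.setReg rfl ?_), ?_, fun d' hd' => ?_, ?_⟩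
    · have := ArrExpr.val_le hs hb hc; omega
    · rw [hv]; exact (ha.represents hσ).setVar x _
    · simp only [Function.update_of_ne (tmpReg_ne_varReg d' x)]; exact ha.tmp hd'
    · simp only [cost]; omega
  | store f e e' =>
    simp only [inc] at hM
    obtain ⟨hf, he, he'⟩ := hc
    obtain ⟨t, τ, hr, hv, ha, ht⟩ := e.run_compile hS hSW hs hb he (by omega) d hσ
    have hτ := ha.represents hσ
    obtain ⟨t', ρ, hr', hv', ha', ht'⟩ := e'.run_compile hS hSW hs hb he' (by omega) (d + 1) hτ
    have hρ := ha'.represents hτ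
    have hle := ArrExpr.val_le hs hb he
    obtain ⟨π, hr'', hv'', ha'', hd''⟩ := run_addressCode (S := S) (W := W) (d := d) (i := e.val s)
      hf hρ.base ((ha'.tmp (Nat.lt_succ_self d)).trans hv) (by omega)
    have hπ := ha''.represents hρ
    refine ⟨t + (t' + (8 + 1)), ⟨π.reg, Function.update π.mem (E + 32 * e.val s + f) (e'.val s),
      π.out⟩, .seq _ _ _ _ _ _ _ hr (.seq _ _ _ _ _ _ _ hr' (.seq _ _ _ _ _ _ _ hr''
      (.instr _ _ _ ?_))), hπ.setEntry hf _ _, fun d' hd' => ?_, ?_⟩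
    · simp only [Instr.exec, hv'', hd'' (d + 1) (by omega), hv']
      rw [if_pos (by omega)]
    · show π.reg _ = _
      rw [hd'' d' (by omega), ha'.tmp (by omega), ha.tmp hd']
    · simp only [cost]; omega
  | seq c c' ih ih' =>
    simp only [inc] at hM
    obtain ⟨t, τ, hr, hτ, hd, ht⟩ := ih hc.1 hb hs (by omega) d hσ
    obtain ⟨t', ρ, hr', hρ, hd', ht'⟩ := ih' hc.2 (hb.trans (Nat.le_add_right _ _))
      (eval_bounded hc.1 hb hs) (by omega) d hτ
    refine ⟨t + t', ρ, .seq _ _ _ _ _ _ _ hr hr', hρ, fun e he => ?_, ?_⟩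
    · rw [hd' e he, hd e he]
    · simp only [cost]; omega
  | ifEq e e' c c' ih ih' =>
    obtain ⟨he, he', hc, hc'⟩ := hc
    simp only [inc] at hM
    obtain ⟨t, τ, hr, hv, ha, ht⟩ := e.run_compile hS hSW hs hb he (by omega) d hσ
    have hτ := ha.represents hσ
    obtain ⟨t', ρ, hr', hv', ha', ht'⟩ := e'.run_compile hS hSW hs hb he' (by omega) (d + 1) hτ
    have hρ := ha'.represents hτ
    have hvd : ρ.reg (tmpReg d) = e.val s := (ha'.tmp (Nat.lt_succ_self d)).trans hv
    have hkeep : ∀ d' < d, ρ.reg (tmpReg d') = σ.reg (tmpReg d') := fun d' hd' => by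
      rw [ha'.tmp (by omega), ha.tmp hd']
    by_cases h : e.val s = e'.val s
    · rw [if_pos h] at hM
      obtain ⟨u, π, hr'', hπ, hd, hu⟩ := ih hc hb hs (by omega) d hρ
      refine ⟨t + (t' + (u + 1)), π, .seq _ _ _ _ _ _ _ hr (.seq _ _ _ _ _ _ _ hr'
        (.iteTrue _ _ _ _ _ _ (by simp only [Test.Holds]; rw [hvd, hv', h]) hr'')), ?_,
        fun d' hd' => (hd d' hd').trans (hkeep d' hd'), ?_⟩
      · simpa only [eval, if_pos h] using hπ
      · simp only [cost, if_pos h]; omega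
    · rw [if_neg h] at hM
      obtain ⟨u, π, hr'', hπ, hd, hu⟩ := ih' hc' hb hs (by omega) d hρ
      refine ⟨t + (t' + (u + 1)), π, .seq _ _ _ _ _ _ _ hr (.seq _ _ _ _ _ _ _ hr'
        (.iteFalse _ _ _ _ _ _ (by simp only [Test.Holds]; rwa [hvd, hv']) hr'')), ?_,
        fun d' hd' => (hd d' hd').trans (hkeep d' hd'), ?_⟩
      · simpa only [eval, if_neg h] using hπ
      · simp only [cost, if_neg h]; omega
  | forr x e c ih =>
    simp only [inc] at hM
    obtain ⟨he, hc⟩ := hc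
    set N := e.val s with hN
    have hNB : N ≤ B + e.succs := ArrExpr.val_le hs hb he
    set st := iter c.eval x s with hst
    have hs' : s.Bounded (B + e.succs) := hs.mono (Nat.le_add_right _ _)
    have hbound : ∀ k ≤ N, (st k).Bounded
        (B + e.succs + ∑ j ∈ Finset.range k, c.inc ((st j).setReg x j)) := fun k hk =>
      iter_bounded hc (by omega) hs' x k (by omega)
    -- Induction on the number `j` of remaining iterations. Counter and bound are in the scratch
    -- registers of depths `d` and `d + 1`, out of reach of the body, which is compiled at depth `d
    -- + 2`.
    have hloop : ∀ j k, k + j = N → ∀ σ : State, Represents E (st k) σ →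
        σ.reg (tmpReg d) = k → σ.reg (tmpReg (d + 1)) = N →
        ∃ t τ, Run S W (.loop (.lt (tmpReg d) (tmpReg (d + 1))) <|
          .seq (.instr (.copy (varReg x) (tmpReg d))) <| .seq (c.compile (d + 2)) <|
            .instr (.add (tmpReg d) (tmpReg d) 1)) σ t τ ∧ Represents E (st N) τ ∧
          (∀ d' < d, τ.reg (tmpReg d') = σ.reg (tmpReg d')) ∧
          t ≤ 1 + 20 * ∑ i ∈ Finset.Ico k N, (1 + c.cost ((st i).setReg x i)) := by
      intro j
      induction j with
      | zero =>
        intro k hk σ hσ hv hv'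
        obtain rfl : k = N := by omega
        exact ⟨1, σ, .loopEnd _ _ _ (by simp only [Test.Holds]; omega), hσ, fun _ _ => rfl,
          by simp⟩
      | succ j ihj =>
        intro k hk σ hσ hv hv'
        have hkN : k < N := by omega
        have hσ' := hσ.setVar x k
        have hsum : ∑ i ∈ Finset.range k, c.inc ((st i).setReg x i) + c.inc ((st k).setReg x k) ≤
            ∑ i ∈ Finset.range N, c.inc ((st i).setReg x i) := by
          rw [← Finset.sum_range_succ]
          exact Finset.sum_le_sum_of_subset (Finset.range_mono hkN)
        obtain ⟨t, τ, hr, hτ, hd, ht⟩ := ih hc (by omega)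
          ((hbound k hkN.le).setReg (x := x) (k := k) (by omega)) (by omega) (d + 2) hσ'
        have hk1 : τ.reg (tmpReg d) = k := by
          rw [hd d (by omega)]
          simp only [Function.update_of_ne (tmpReg_ne_varReg _ x)]; exact hv
        have hk2 : τ.reg (tmpReg (d + 1)) = N := by
          rw [hd (d + 1) (by omega)]
          simp only [Function.update_of_ne (tmpReg_ne_varReg _ x)]; exact hv'
        obtain ⟨u, ρ, hr', hρ, hd', hu⟩ := ihj (k + 1) (by omega)
          { τ with reg := Function.update τ.reg (tmpReg d) (k + 1) }
          ((agreesUpTo_setReg τ d (k + 1)).represents hτ) (by simp)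
          (by
            have : tmpReg (d + 1) ≠ tmpReg d := by simp only [tmpReg]; omega
            simp [Function.update_of_ne this, hk2])
        refine ⟨(1 + (t + 1)) + u + 1, ρ, .loopStep _ _ _ _ _ _ _ ?_
          (.seq _ _ _ _ _ _ _ (.setReg (r := varReg x) (x := k) ?_ (by omega))
            (.seq _ _ _ _ _ _ _ hr (.setReg (r := tmpReg d) (x := k + 1) ?_ (by omega)))) hr',
          hρ, ?_, ?_⟩
        · simp only [Test.Holds]; omega
        · simp only [Instr.exec, hv]
        · simp only [Instr.exec, hk1, hτ.one]
        · intro d' hd''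
          have h : tmpReg d' ≠ tmpReg d := by simp only [tmpReg]; omega
          rw [hd' d' hd'']
          simp only [Function.update_of_ne h]
          rw [hd d' (by omega)]
          simp only [Function.update_of_ne (tmpReg_ne_varReg _ x)]
        · rw [Finset.sum_eq_sum_Ico_succ_bot hkN]
          omega
    have hσ0 := (agreesUpTo_setReg σ d 0)
    obtain ⟨t, τ, hr, hv, ha, ht⟩ := e.run_compile hS hSW hs hb he (by omega) (d + 1)
      (hσ0.represents hσ)
    obtain ⟨u, ρ, hr', hρ, hd', hu⟩ := hloop N 0 (by omega) τ
      (ha.represents (hσ0.represents hσ)) ((ha.tmp (Nat.lt_succ_self d)).trans (by simp)) hv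
    refine ⟨1 + (t + u), ρ, .seq _ _ _ _ _ _ _ (.setReg rfl (Nat.zero_le _))
      (.seq _ _ _ _ _ _ _ hr hr'), hρ, fun d' hd => ?_, ?_⟩
    · rw [hd' d' hd, ha.tmp (by omega), hσ0.tmp hd]
    · rw [← Finset.range_eq_Ico] at hu
      change _ ≤ 20 * (e.size + 1 + ∑ i ∈ Finset.range N, (1 + c.cost ((st i).setReg x i)))
      omega
  | emitVertex e =>
    simp only [inc] at hM
    obtain ⟨t, τ, hr, hv, ha, ht⟩ := e.run_compile hS hSW hs hb hc hM d hσ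
    have hτ := ha.represents hσ
    refine ⟨t + 1, { τ with out := τ.out ++ [.vertex (e.val s)] }, .seq _ _ _ _ _ _ _ hr
      (.instr _ _ _ (by simp only [Instr.exec, hv])),
      ⟨hτ.base, hτ.one, hτ.reg, hτ.inp, hτ.inp_zero, hτ.arr, ?_⟩, fun d' hd' => ha.tmp hd', ?_⟩
    · simp [eval, hτ.out]
    · simp only [cost]; omega
  | emitBar =>
    exact ⟨1, { σ with out := σ.out ++ [.bar] }, .instr _ _ _ rfl,
      ⟨hσ.base, hσ.one, hσ.reg, hσ.inp, hσ.inp_zero, hσ.arr, by simp [eval, hσ.out]⟩,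
      fun _ _ => rfl, by simp [cost]⟩
  | emitClose =>
    exact ⟨1, { σ with out := σ.out ++ [.close] }, .instr _ _ _ rfl,
      ⟨hσ.base, hσ.one, hσ.reg, hσ.inp, hσ.inp_zero, hσ.arr, by simp [eval, hσ.out]⟩,
      fun _ _ => rfl, by simp [cost]⟩

end Compilation

/-! ### The layout of the input and complete runs of the machine -/

section Prologue

variable {n : ℕ} (adj : Fin n → List (Fin n))

lemma inputWords_length :
    (inputWords adj).length = n + 1 + ∑ v, (adj v).length := by
  simp [inputWords, List.sum_ofFn, Function.comp_def]; omega

lemma inputWords_zero : (inputWords adj).getD 0 0 = n := by simp [inputWords]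

lemma inputWords_length_entry (v : Fin n) :
    (inputWords adj).getD (v + 1) 0 = (adj v).length := by
  simp [inputWords, List.getD_eq_getElem?_getD, List.getElem?_append]

lemma flatten_ofFn_getElem? {α : Type*} {k : ℕ} (f : Fin k → List α) (v : Fin k) (j : ℕ)
    (hj : j < (f v).length) :
    (List.ofFn f).flatten[(∑ u : Fin k with u < v, (f u).length) + j]? = some (f v)[j] := by
  induction k with
  | zero => exact v.elim0
  | succ k ih =>
    rw [List.ofFn_succ, List.flatten_cons, Finset.sum_filter, Fin.sum_univ_succ]
    refine Fin.cases (fun hj => ?_) (fun v hj => ?_) v hj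
    · simp [List.getElem?_append_left hj]
    · have := ih (fun i => f i.succ) v hj
      rw [Finset.sum_filter] at this
      simp only [Fin.succ_pos, if_true, Fin.succ_lt_succ_iff, Nat.add_assoc]
      rw [List.getElem?_append_right (Nat.le_add_right _ _), Nat.add_sub_cancel_left, this]

lemma inputWords_neighbour (v : Fin n) (j : ℕ) (hj : j < (adj v).length) :
    (inputWords adj).getD (n + 1 + (∑ u : Fin n with u < v, (adj u).length) + j) 0 =
      ((adj v)[j] : ℕ) := by
  have := flatten_ofFn_getElem? adj v j hj
  rw [inputWords, List.getD_eq_getElem?_getD, List.getElem?_append_right (by simp; omega)]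
  simp only [List.length_cons, List.length_ofFn, List.getElem?_map]
  rw [show n + 1 + (∑ u : Fin n with u < v, (adj u).length) + j - (n + 1) =
    (∑ u : Fin n with u < v, (adj u).length) + j by omega, this]
  simp

lemma inputWords_le (hadj : ∀ v, (adj v).Nodup) (i : ℕ) : (inputWords adj).getD i 0 ≤ n := by
  rw [List.getD_eq_getElem?_getD]
  rcases h : (inputWords adj)[i]? with _ | x
  · simp
  · have hx := List.mem_of_getElem? h
    simp only [inputWords, List.cons_append, List.mem_cons, List.mem_append, List.mem_ofFn,
      List.mem_map] at hx
    simp only [Option.getD_some]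
    rcases hx with rfl | ⟨v, rfl⟩ | ⟨y, -, rfl⟩
    · rfl
    · simpa using (hadj v).length_le_card
    · exact y.2.le

/-- The code that computes the length of the input and stores it in register `0`. -/
def baseCode : Program :=
  .seq (.instr (.const 1 1)) <| .seq (.instr (.load 3 0)) <| .seq (.instr (.add 0 3 1)) <|
  .loop (.lt 5 3) <| .seq (.instr (.add 5 5 1)) <| .seq (.instr (.load 7 5)) <|
    .instr (.add 0 0 7)

/-- The state of the array language at the start. -/
def initialState : ArrState where
  reg _ := 0
  arr _ _ := 0
  inp i := (inputWords adj).getD i 0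
  out := []

/-- Only the registers `0`, `1`, `3`, `5`, `7` are written. Variables occupy the even registers from
`4` on, so they are still `0`, and the memory is untouched. -/
lemma run_baseCode {S W : ℕ} (hS : (inputWords adj).length ≤ S) (hSW : S ≤ W) :
    ∃ t τ, Run S W baseCode (startState adj) t τ ∧
      Represents (inputWords adj).length (initialState adj) τ ∧ t ≤ 4 * n + 4 := by
  have hlen := inputWords_length adj
  have hloop : ∀ j k, k + j = n → ∀ σ : State, σ.reg 1 = 1 → σ.reg 3 = n → σ.reg 5 = k →
      (∀ i, σ.mem i = (inputWords adj).getD i 0) → σ.out = [] →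
      (∀ x, σ.reg (varReg x) = 0) →
      σ.reg 0 + ∑ v : Fin n with k ≤ v.val, (adj v).length = (inputWords adj).length →
      ∃ τ, Run S W (.loop (.lt 5 3) <| .seq (.instr (.add 5 5 1)) <|
        .seq (.instr (.load 7 5)) <| .instr (.add 0 0 7)) σ (4 * j + 1) τ ∧
        Represents (inputWords adj).length (initialState adj) τ := by
    intro j
    induction j with
    | zero =>
      intro k hk σ h1 h3 h5 hm ho hv h0
      refine ⟨σ, .loopEnd _ _ _ (by simp only [Test.Holds]; omega), ?_, h1, hv, fun i _ => hm i,
        fun i hi => ?_, fun f _ i => ?_, ho⟩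
      · rw [← h0, Finset.sum_eq_zero, Nat.add_zero]
        intro v hv
        have := (Finset.mem_filter.mp hv).2
        omega
      · simp [initialState, List.getD_eq_getElem?_getD, List.getElem?_eq_none hi]
      · rw [hm, List.getD_eq_getElem?_getD, List.getElem?_eq_none (by omega)]; rfl
    | succ j ihj =>
      intro k hk σ h1 h3 h5 hm ho hv h0
      have hsum : ∑ v : Fin n with k ≤ v.val, (adj v).length = (adj ⟨k, by omega⟩).length +
          ∑ v : Fin n with k + 1 ≤ v.val, (adj v).length := by
        rw [← Finset.sum_insert (f := fun v => (adj v).length) (a := ⟨k, by omega⟩)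
          (s := Finset.univ.filter fun v : Fin n => k + 1 ≤ (v : ℕ)) (by simp)]
        congr 1
        ext v
        simp only [Finset.mem_filter, Finset.mem_univ, true_and, Finset.mem_insert, Fin.ext_iff]
        omega
      have hentry := inputWords_length_entry adj ⟨k, by omega⟩
      simp only at hentry
      obtain ⟨τ, hr, hτ⟩ := ihj (k + 1) (by omega)
        ⟨Function.update (Function.update (Function.update σ.reg 5 (k + 1)) 7
          (adj ⟨k, by omega⟩).length) 0 (σ.reg 0 + (adj ⟨k, by omega⟩).length), σ.mem, σ.out⟩
        (by simpa [Function.update_apply] using h1) (by simpa [Function.update_apply] using h3)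
        (by simp) hm ho
        (by
          intro x
          have h : varReg x ≠ 0 ∧ varReg x ≠ 7 ∧ varReg x ≠ 5 := by simp only [varReg]; omega
          simpa [Function.update_apply, h] using hv x)
        (by simp only [Function.update_self]; omega)
      refine ⟨τ, ?_, hτ⟩
      have hrun := Run.loopStep (S := S) (W := W) (.lt 5 3) _ σ _ τ (1 + (1 + 1)) (4 * j + 1)
        (by simp only [Test.Holds]; omega)
        (.seq (.instr (.add 5 5 1)) _ _ _ _ _ _
          (.setReg (r := 5) (x := k + 1) (by simp only [Instr.exec, h1, h5]) (by omega))
        (.seq (.instr (.load 7 5)) (.instr (.add 0 0 7)) _ _ _ _ _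
          (.setReg (r := 7) (x := (adj ⟨k, by omega⟩).length) ?_ (by omega))
          (.setReg (r := 0) (x := σ.reg 0 + (adj ⟨k, by omega⟩).length) ?_ (by omega)))) hr
      · convert hrun using 1; omega
      · simp only [Instr.exec, Function.update_self, hm, hentry]
        rw [if_pos (by omega)]
      · simp [Instr.exec]
  obtain ⟨τ, hr, hτ⟩ := hloop n 0 (by omega)
    ⟨Function.update (Function.update (Function.update (fun _ => 0) 1 1) 3 n) 0 (n + 1),
      (startState adj).mem, []⟩ (by simp) (by simp)
    (by simp) (fun _ => rfl) rfl
    (by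
      intro x
      have h : varReg x ≠ 0 ∧ varReg x ≠ 1 ∧ varReg x ≠ 3 := by simp only [varReg]; omega
      simp [h]) (by simp [hlen])
  refine ⟨1 + (1 + (1 + (4 * n + 1))), τ, .seq _ _ _ _ _ _ _ (.setReg (r := 1) (x := 1) rfl ?_)
    (.seq _ _ _ _ _ _ _ (.setReg (r := 3) (x := n) ?_ ?_)
    (.seq _ _ _ _ _ _ _ (.setReg (r := 0) (x := n + 1) ?_ ?_) hr)), hτ, by omega⟩
  · omega
  · have h0 := inputWords_zero adj
    rw [List.getD_eq_getElem?_getD] at h0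
    have : 0 < S := by omega
    simp [Instr.exec, startState, this, h0]
  · omega
  · simp [Instr.exec, startState]
  · omega

/-- Running commands of the array language. The second command must not compute new values, so that
only the cost of the first one enters the space bound. -/
lemma run_commands (hadj : ∀ v, (adj v).Nodup) {b W S : ℕ} {c c' : ArrCmd} (hc : c.Fits b)
    (hc' : c'.Fits b) (hn : c'.NoSucc)
    (hS : S = (inputWords adj).length + 32 * (b + n + c.cost (initialState adj)) + 32)
    (hSW : S ≤ W) :
    ∃ t τ, Run S W (.seq baseCode (.seq (c.compile 0) (c'.compile 0))) (startState adj) t τ ∧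
      τ.out = (c'.eval (c.eval (initialState adj))).out ∧
      t ≤ 4 * n + 4 + 20 * (c.cost (initialState adj) +
        c'.cost (c.eval (initialState adj))) := by
  obtain ⟨t, τ, hr, hτ, ht⟩ := run_baseCode adj (S := S) (W := W) (by omega) hSW
  have hs : (initialState adj).Bounded (b + n) := ⟨fun _ => Nat.zero_le _, fun _ _ => Nat.zero_le _,
    fun i => (inputWords_le adj hadj i).trans (Nat.le_add_left _ _)⟩
  have hinc := c.inc_le_cost (initialState adj)
  obtain ⟨t', τ', hr', hτ', -, ht'⟩ := c.run_compile hS.ge hSW hc (Nat.le_add_right b n) hs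
    (by omega) 0 hτ
  obtain ⟨t'', τ'', hr'', hτ'', -, ht''⟩ := c'.run_compile hS.ge hSW hc' (by omega)
    (c.eval_bounded hc (Nat.le_add_right b n) hs) (by rw [c'.inc_eq_zero hn]; omega) 0 hτ'
  exact ⟨t + (t' + t''), τ'', .seq _ _ _ _ _ _ _ hr (.seq _ _ _ _ _ _ _ hr' hr''), hτ''.out,
    by omega⟩

end Prologue

/-! ### Bicliques and domination -/

section Bicliques

variable {V : Type*} {G : SimpleGraph V}

lemma Dominates.refl (G : SimpleGraph V) (v : V) : Dominates G v v := subset_rfl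

lemma Dominates.trans {u v w : V} (h : Dominates G u v) (h' : Dominates G v w) :
    Dominates G u w := Set.Subset.trans h' h

lemma Dominates.adj {v w x : V} (h : Dominates G v w) (hx : G.Adj w x) : G.Adj v x := h hx

lemma insert_Dom (v : V) : insert v (Dom G v) = Dom G v :=
  Set.insert_eq_of_mem (Dominates.refl G v)

lemma bicliqueOf_eq (v : V) : bicliqueOf G v = s(G.neighborSet v, Dom G v) := by
  rw [bicliqueOf, insert_Dom]

lemma not_adj_of_cliqueFree (h : G.CliqueFree 3) {a b c : V} (hab : G.Adj a b) (hac : G.Adj a c) :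
    ¬ G.Adj b c := fun hbc => by
  classical
  exact h {a, b, c} (SimpleGraph.is3Clique_triple_iff.mpr ⟨hab, hac, hbc⟩)

/-- With this inclusion an equality between sides of two bicliques becomes an equality of
cardinalities, which an algorithm can test. -/
lemma Dom_subset {v w : V} (h : G.Adj v w) : Dom G v ⊆ G.neighborSet w :=
  fun _ hu => (Dominates.adj hu h).symm

lemma Dom_congr {v w : V} (h : G.neighborSet v = G.neighborSet w) : Dom G v = Dom G w := by
  simp only [Dom, Dominates, h]

lemma Dominates.neighborSet_eq {v w : V} (h : Dominates G v w)
    (hc : (G.neighborSet v).ncard ≤ (G.neighborSet w).ncard)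
    (hf : (G.neighborSet v).Finite := by exact Set.toFinite _) :
    G.neighborSet w = G.neighborSet v :=
  Set.eq_of_subset_of_ncard_le h hc hf

lemma isBiclique_of_nonempty (h3 : G.CliqueFree 3) {v : V} (hv : (G.neighborSet v).Nonempty) :
    IsBiclique G (G.neighborSet v) (Dom G v) := by
  refine ⟨hv, ⟨v, Dominates.refl G v⟩, fun x hx x' hx' => not_adj_of_cliqueFree h3 hx hx',
    fun y hy y' hy' => ?_, fun x hx y hy => (Dominates.adj hy hx).symm⟩
  obtain ⟨z, hz⟩ := hv
  exact not_adj_of_cliqueFree h3 (Dominates.adj hy hz).symm (Dominates.adj hy' hz).symm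

/-- In a larger biclique let `v` lie in `Y`. No neighbour of `v` lies in `Y`, so `N(v) ⊆ X`; then
`X` consists of neighbours of `v`, and each vertex of `Y` is adjacent to all of `N(v)`, that is, it
dominates `v`. -/
lemma isMaximalBiclique_of_nonempty (h3 : G.CliqueFree 3) {v : V}
    (hv : (G.neighborSet v).Nonempty) : IsMaximalBiclique G (G.neighborSet v) (Dom G v) := by
  refine ⟨isBiclique_of_nonempty h3 hv, fun X Y hXY hsub => ?_⟩
  have key : ∀ X Y : Set V, IsBiclique G X Y → G.neighborSet v ∪ Dom G v ⊆ X ∪ Y → v ∈ Y →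
      X ∪ Y ⊆ G.neighborSet v ∪ Dom G v := by
    rintro X Y ⟨-, -, -, hY, hE⟩ hsub hvY
    have hX : G.neighborSet v ⊆ X := fun x hx =>
      (hsub (Or.inl hx)).resolve_right fun hxY => hY v hvY x hxY hx
    rintro u (hu | hu)
    · exact Or.inl (hE u hu v hvY).symm
    · exact Or.inr fun x hx => (hE x (hX hx) u hu).symm
  refine subset_antisymm ?_ hsub
  rcases hsub (Or.inr (Dominates.refl G v)) with hv' | hv'
  · rw [Set.union_comm X Y]
    obtain ⟨h1, h2, h3, h4, h5⟩ := hXY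
    exact key Y X ⟨h2, h1, h4, h3, fun y hy x hx => (h5 x hx y hy).symm⟩
      (by rwa [Set.union_comm Y X]) hv'
  · exact key X Y hXY hsub hv'

/-- A vertex `x` of least degree in the chain `X` is dominated by all of `X`: a vertex of `X` that
`x` dominates has at least its degree, hence the same neighbourhood. So the biclique of `x` contains
the given one, and maximality gives equality. -/
lemma eq_of_chain [Finite V] (h3 : G.CliqueFree 3) {X Y : Set V} (h : IsMaximalBiclique G X Y)
    (hX : ∀ x ∈ X, ∀ x' ∈ X, DomComparable G x x') :
    ∃ v, (G.neighborSet v).Nonempty ∧ Y = G.neighborSet v ∧ X = Dom G v := by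
  obtain ⟨⟨hXn, hYn, hXi, hYi, hE⟩, hmax⟩ := h
  obtain ⟨x, hx, hmin⟩ := Set.exists_min_image X (fun x => (G.neighborSet x).ncard)
    (Set.toFinite X) hXn
  have hdom : X ⊆ Dom G x := fun x' hx' => by
    rcases hX x hx x' hx' with h | h
    · exact (Dominates.neighborSet_eq h (hmin x' hx')).ge
    · exact h
  have hYx : Y ⊆ G.neighborSet x := fun y hy => hE x hx y hy
  have hne : (G.neighborSet x).Nonempty := hYn.mono hYx
  have heq := hmax _ _ (isBiclique_of_nonempty h3 hne)
    (Set.union_subset (hdom.trans Set.subset_union_right) (hYx.trans Set.subset_union_left))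
  refine ⟨x, hne, subset_antisymm hYx fun y hy => ?_, subset_antisymm hdom fun u hu => ?_⟩
  · exact (heq.subset (Or.inl hy)).resolve_left fun h => hXi x hx y h hy
  · exact (heq.subset (Or.inr hu)).resolve_right fun h =>
      G.loopless.irrefl u (Dominates.adj hu (hE x hx u h))

/-- The maximal bicliques of a `C₄`-dominated triangle-free graph are those of its vertices. -/
theorem mem_maximalBicliques_iff [Finite V] (h3 : G.CliqueFree 3) (h4 : C4Dominated G)
    {B : Sym2 (Set V)} :
    B ∈ maximalBicliques G ↔ ∃ v, (G.neighborSet v).Nonempty ∧ bicliqueOf G v = B := by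
  constructor
  · rintro ⟨X, Y, rfl, h⟩
    by_cases hX : ∀ x ∈ X, ∀ x' ∈ X, DomComparable G x x'
    · obtain ⟨v, hv, rfl, rfl⟩ := eq_of_chain h3 h hX
      exact ⟨v, hv, by rw [bicliqueOf_eq, Sym2.eq_swap]⟩
    · obtain ⟨⟨hXn, hYn, hXi, hYi, hE⟩, hmax⟩ := h
      push Not at hX
      obtain ⟨x, hx, x', hx', hxx⟩ := hX
      -- Two vertices of `Y` form a cycle of length four with the incomparable `x` and `x'`, so that
      -- they must be the comparable pair.
      have hY : ∀ y ∈ Y, ∀ y' ∈ Y, DomComparable G y y' := fun y hy y' hy' => by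
        by_cases hyy : y = y'
        · exact hyy ▸ Or.inl (Dominates.refl G y)
        · refine (h4 x y x' y' ?_ hyy (hE x hx y hy) (hE x' hx' y hy).symm (hE x' hx' y' hy')
            (hE x hx y' hy').symm).resolve_left hxx
          rintro rfl
          exact hxx (Or.inl (Dominates.refl G x))
      obtain ⟨v, hv, rfl, rfl⟩ := eq_of_chain (X := Y) (Y := X) h3
        ⟨⟨hYn, hXn, hYi, hXi, fun y hy x hx => (hE x hx y hy).symm⟩, fun X' Y' hb hs => by
          rw [Set.union_comm Y X]; exact hmax X' Y' hb (by rwa [Set.union_comm Y X] at hs)⟩ hY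
      exact ⟨v, hv, bicliqueOf_eq v⟩
  · rintro ⟨v, hv, rfl⟩
    exact ⟨_, _, bicliqueOf_eq v, isMaximalBiclique_of_nonempty h3 hv⟩

lemma bicliqueOf_eq_iff {v w : V} : bicliqueOf G v = bicliqueOf G w ↔
    G.neighborSet v = G.neighborSet w ∨ G.neighborSet v = Dom G w ∧ Dom G v = G.neighborSet w := by
  rw [bicliqueOf_eq, bicliqueOf_eq, Sym2.eq_iff]
  constructor
  · rintro (h | h)
    exacts [Or.inl h.1, Or.inr h]
  · rintro (h | h)
    exacts [Or.inl ⟨h, Dom_congr h⟩, Or.inr h]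

/-- In a cycle of length four with an incomparable pair the other pair is comparable. -/
lemma C4Dominated.comparable (h4 : C4Dominated G) {x y v w : V} (hxy : ¬ DomComparable G x y)
    (hvx : G.Adj v x) (hvy : G.Adj v y) (hwx : G.Adj w x) (hwy : G.Adj w y) :
    DomComparable G v w := by
  by_cases h : v = w
  · exact h ▸ Or.inl (Dominates.refl G v)
  · refine (h4 v x w y h ?_ hvx hwx.symm hwy hvy.symm).resolve_right hxy
    rintro rfl
    exact hxy (Or.inl (Dominates.refl G x))

lemma ncard_adj_pairs [Finite V] (G : SimpleGraph V) :
    {p : V × V | G.Adj p.1 p.2}.ncard = 2 * G.edgeSet.ncard := by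
  classical
  have := Fintype.ofFinite V
  rw [← SimpleGraph.coe_edgeFinset, Set.ncard_coe_finset, ← G.dart_card_eq_twice_card_edges,
    ← Nat.card_coe_set_eq, ← Nat.card_eq_fintype_card]
  exact Nat.card_congr ⟨fun p => ⟨p.1, p.2⟩, fun d => ⟨d.toProd, d.adj⟩, fun _ => rfl,
    fun _ => rfl⟩

end Bicliques

/-! ### Repeated vertices and the domination digraph -/

section Digraph

variable {V : Type*} [Finite V] [LinearOrder V] {G : SimpleGraph V}

/-- Without twins, equal bicliques of different vertices have their sides exchanged. Conversely
`Dom_subset` holds in both directions along the edge `v w`, and the equal sizes turn both inclusions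
into equalities. -/
lemma repeated_iff (ht : TwinFree G) (v : V) :
    (∃ w, v < w ∧ bicliqueOf G v = bicliqueOf G w) ↔ Repeated G v := by
  constructor
  · rintro ⟨w, hvw, h⟩
    rcases bicliqueOf_eq_iff.mp h with h | ⟨h, h'⟩
    · exact absurd (ht v w h) hvw.ne
    · refine ⟨w, ?_, hvw, by rw [h'], by rw [h]⟩
      have : w ∈ G.neighborSet v := h ▸ Dominates.refl G w
      exact this
  · rintro ⟨w, hadj, hvw, h, h'⟩
    exact ⟨w, hvw, bicliqueOf_eq_iff.mpr (Or.inr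
      ⟨(Set.eq_of_subset_of_ncard_le (Dom_subset hadj.symm) h'.le).symm,
        Set.eq_of_subset_of_ncard_le (Dom_subset hadj) h.ge⟩)⟩

/-- The representative of a maximal biclique is the greatest vertex that has it. -/
lemma bijOn_bicliqueOf (h3 : G.CliqueFree 3) (h4 : C4Dominated G) (ht : TwinFree G)
    (hi : NoIsolated G) :
    Set.BijOn (bicliqueOf G) {v | ¬ Repeated G v} (maximalBicliques G) := by
  refine ⟨fun v _ => (mem_maximalBicliques_iff h3 h4).mpr ⟨v, hi v, rfl⟩, fun v hv w hw h => ?_,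
    fun B hB => ?_⟩
  · rcases lt_trichotomy v w with hlt | heq | hlt
    · exact absurd ((repeated_iff ht v).mp ⟨w, hlt, h⟩) hv
    · exact heq
    · exact absurd ((repeated_iff ht w).mp ⟨v, hlt, h.symm⟩) hw
  · obtain ⟨v, -, hv⟩ := (mem_maximalBicliques_iff h3 h4).mp hB
    obtain ⟨w, hw, hmax⟩ := Set.exists_max_image {w | bicliqueOf G w = B} id (Set.toFinite _)
      ⟨v, hv⟩
    refine ⟨w, fun hrep => ?_, hw⟩
    obtain ⟨u, hu, huw⟩ := (repeated_iff ht w).mpr hrep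
    exact not_lt.mpr (hmax u (huw.symm.trans hw)) hu

/-- A dominator has at least the degree of the dominated vertex, so a smaller one would have an
equal neighbourhood, which twin-freeness excludes. -/
lemma dominates_of_comparable (ht : TwinFree G) (ho : DegreeOrdered G) {v w : V} (h : w < v)
    (hc : DomComparable G v w) : Dominates G v w := by
  rcases hc with hc | hc
  · exact hc
  · exact absurd (ht _ _ (hc.neighborSet_eq (ho _ _ h))) h.ne'

lemma lt_of_dominates (ht : TwinFree G) (ho : DegreeOrdered G) {v w : V} (h : Dominates G v w)
    (hne : v ≠ w) : w < v := by
  by_contra hlt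
  have hlt : v < w := lt_of_le_of_ne (not_lt.mp hlt) hne
  exact hne (ht _ _ (h.neighborSet_eq (ho _ _ hlt)).symm)

/-- The vertices `v` and `w` are incomparable and form a cycle of length four with their common
neighbours `a` and `b`, so `a` and `b` are comparable. -/
lemma dominates_of_unsafe (h4 : C4Dominated G) (ht : TwinFree G) (ho : DegreeOrdered G) {a b : V}
    (h : unsafeDigraph G a b) : Dominates G b a := by
  obtain ⟨v, w, ⟨hwv, -⟩, hns, ha, hb, hab, -⟩ := h
  exact dominates_of_comparable ht ho hab (h4.comparable
    (fun hc => hns (dominates_of_comparable ht ho hwv hc)) hb.1.symm hb.2.1.symm ha.1.symm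
    ha.2.1.symm)

/-- Between two elements of a set `L(v, w)` there is a path of edges to the next element. -/
lemma unsafe_path {v w : V} (hns : IsTriple G v w) (hd : ¬ Dominates G v w) {a b : V}
    (ha : a ∈ leastCommon G v w) (hb : b ∈ leastCommon G v w) (hab : a ≤ b) :
    Relation.ReflTransGen (unsafeDigraph G) a b := by
  induction b using (Finite.to_wellFoundedLT (α := V)).wf.induction with
  | _ b ih =>
    rcases hab.eq_or_lt with rfl | hab
    · exact .refl
    · obtain ⟨c, ⟨hc, hac, hcb⟩, hmax⟩ := Set.exists_max_image
        {c | c ∈ leastCommon G v w ∧ a ≤ c ∧ c < b} id (Set.toFinite _) ⟨a, ha, le_rfl, hab⟩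
      refine (ih c hcb hc hac).tail ⟨v, w, hns, hd, hc, hb, hcb, fun d hd' hlt => ?_⟩
      exact not_lt.mpr (hmax d ⟨hd', hac.trans hlt.1.le, hlt.2⟩) hlt.1

/-- For an edge from a degenerated `w`, suppose some neighbour `y` of `w` were not adjacent to `v`.
The least neighbour `z` of `w` is adjacent to `v`, so `z < y`, and `w` lies in `L(y, z)`. -/
lemma dominates_of_digraph (h4 : C4Dominated G) (ht : TwinFree G) (ho : DegreeOrdered G)
    {w v : V} (h : dominationDigraph G w v) : Dominates G v w := by
  rcases h with (h | h) | ⟨⟨hout, hnb⟩, hmax, -, z, hz, hzv⟩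
  · exact dominates_of_unsafe h4 ht ho h
  · exact h.2
  · intro y hy
    by_contra hyv
    have hzy : z < y := lt_of_le_of_ne (hz.2 hy) (by rintro rfl; exact hyv hzv.symm)
    have hwL : w ∈ leastCommon G y z :=
      ⟨SimpleGraph.Adj.symm hy, SimpleGraph.Adj.symm hz.1, hnb y hy⟩
    have htr : IsTriple G y z := ⟨hzy, w, hwL⟩
    have hnm := hmax y z htr
    -- Since `w` is not greatest in `L(y, z)`, it has a successor there. In the safe case `y`
    -- inherits the neighbour `v` of `z`; in the unsafe case `w` would have an out-neighbour in
    -- `U(G)`.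
    obtain ⟨c, hc, hwc⟩ : ∃ c ∈ leastCommon G y z, w < c := by
      by_contra hcon
      push Not at hcon
      exact hnm ⟨hwL, hcon⟩
    by_cases hsafe : Dominates G y z
    · exact hyv (hsafe hzv).symm
    · have hpath := unsafe_path htr hsafe hwL hc hwc.le
      rcases Relation.ReflTransGen.cases_head hpath with h | ⟨d, hd, -⟩
      · exact hwc.ne h
      · exact hout d hd

/-- A neighbour of `w` below `v` gives a safe edge. Otherwise all neighbours of `w` lie above `v`.
If two of them, `y < x`, are incomparable, both `w` and `v` lie in the unsafe `L(x, y)`, and a path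
runs through it. If none are, `w` is degenerated, and every `L(a, b)` that contains `w` contains the
greater `v`, so that the dominator set of `w` is not empty. -/
lemma path_of_dominates (ht : TwinFree G) (ho : DegreeOrdered G)
    (hi : NoIsolated G) {v w : V} (h : Dominates G v w) :
    Relation.ReflTransGen (dominationDigraph G) w v := by
  by_cases hne : v = w
  · exact hne ▸ .refl
  have hwv := lt_of_dominates ht ho h hne
  by_cases hlow : ∃ x, G.Adj w x ∧ x < v
  · obtain ⟨x, hwx, hxv⟩ := hlow
    exact .single (Or.inl (Or.inr ⟨⟨hwv, x, h.adj hwx, hwx, hxv⟩, h⟩))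
  have hhigh : ∀ x, G.Adj w x → v < x := fun x hx => lt_of_le_of_ne
    (not_lt.mp fun hlt => hlow ⟨x, hx, hlt⟩) (h.adj hx).ne
  by_cases hinc : ∃ x y, G.Adj w x ∧ G.Adj w y ∧ y < x ∧ ¬ Dominates G x y
  · obtain ⟨x, y, hx, hy, hyx, hd⟩ := hinc
    have hwL : w ∈ leastCommon G x y := ⟨hx.symm, hy.symm, hwv.trans (hhigh x hx)⟩
    exact Relation.ReflTransGen.mono (fun a b hab => Or.inl (Or.inl hab)) _ _ (unsafe_path
      ⟨hyx, w, hwL⟩ hd hwL ⟨(h.adj hx).symm, (h.adj hy).symm, hhigh x hx⟩ hwv.le)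
  · obtain ⟨z, hz, hmin⟩ := Set.exists_min_image (G.neighborSet w) id (Set.toFinite _) (hi w)
    refine .single (Or.inr ⟨⟨?_, fun x hx => hwv.trans (hhigh x hx)⟩, ?_, hne, z, ⟨hz, hmin⟩,
      (h.adj hz).symm⟩)
    · rintro x ⟨a, b, ⟨hba, -⟩, hd, ⟨haw, hbw, -⟩, -⟩
      exact hinc ⟨a, b, haw.symm, hbw.symm, hba, hd⟩
    · rintro a b - ⟨⟨haw, hbw, -⟩, hub⟩
      exact not_lt.mpr (hub ⟨(h.adj haw.symm).symm, (h.adj hbw.symm).symm, hhigh a haw.symm⟩) hwv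

lemma dominates_iff_path (h4 : C4Dominated G) (ht : TwinFree G)
    (ho : DegreeOrdered G) (hi : NoIsolated G) (v w : V) :
    Dominates G v w ↔ Relation.ReflTransGen (dominationDigraph G) w v := by
  refine ⟨path_of_dominates ht ho hi, fun h => ?_⟩
  induction h with
  | refl => exact Dominates.refl G w
  | tail _ h ih => exact (dominates_of_digraph h4 ht ho h).trans ih

/-- An edge `w → v` from a degenerated `w` with least neighbour `z` is charged to the oriented edge
from `z` to `v`. If `w` and `w'` are charged to the same one, each lies in the dominator set of the
other, so they dominate each other and are equal. -/
lemma edgeCount_dominationDigraph_le (h4 : C4Dominated G) (ht : TwinFree G)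
    (ho : DegreeOrdered G) :
    edgeCount (dominationDigraph G) ≤ edgeCount (squaresDigraph G) + 2 * G.edgeSet.ncard := by
  refine (Set.ncard_union_le {p : V × V | squaresDigraph G p.1 p.2}
    {p | Degenerated G p.1 ∧ p.2 ∈ dominatorSet G p.1}).trans (Nat.add_le_add_left ?_ _)
  rw [← ncard_adj_pairs]
  -- A total choice of `z` is convenient for the injection; its value `p.1` outside of the relation
  -- does not matter.
  have hz : ∀ p : V × V, ∃ z, p.2 ∈ dominatorSet G p.1 →
      IsLeast (G.neighborSet p.1) z ∧ G.Adj z p.2 := fun p => by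
    by_cases h : p.2 ∈ dominatorSet G p.1
    · obtain ⟨-, -, z, hz⟩ := h
      exact ⟨z, fun _ => hz⟩
    · exact ⟨p.1, fun h' => absurd h' h⟩
  choose z hz using hz
  refine Set.ncard_le_ncard_of_injOn (fun p => (z p, p.2)) (fun p hp => (hz p hp.2).2) ?_
    (Set.toFinite _)
  rintro ⟨w, v⟩ ⟨hw, hv⟩ ⟨w', v'⟩ ⟨hw', hv'⟩ h
  obtain ⟨hzz, rfl⟩ : z (w, v) = z (w', v') ∧ v = v' := Prod.ext_iff.mp h
  by_contra hne
  have hne : w ≠ w' := fun h => hne (by rw [h])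
  have h1 := (hz _ hv).1
  have h2 := (hz _ hv').1
  rw [← hzz] at h2
  have hd : Dominates G w' w := dominates_of_digraph h4 ht ho
    (Or.inr ⟨hw, hv.1, hne.symm, _, h1, SimpleGraph.Adj.symm h2.1⟩)
  have hd' : Dominates G w w' := dominates_of_digraph h4 ht ho
    (Or.inr ⟨hw', hv'.1, hne, _, h2, SimpleGraph.Adj.symm h1.1⟩)
  exact hne (ht _ _ (subset_antisymm hd hd'))

end Digraph

/-! ### Arboricity -/

section Arboricity

variable {V : Type*}

/-- The edges of a forest can be assigned to their lower ends. -/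
lemma exists_parent {F : SimpleGraph V} (h : F.IsAcyclic) :
    ∃ f : V → V, ∀ a b, F.Adj a b → f a = b ∨ f b = a := by
  classical
  -- Every tree is rooted at the representative of its component, and the parent of a vertex is the
  -- second vertex on the path to the root.
  have hp : ∀ a : V, ∃ p : F.Walk a (F.connectedComponentMk a).out, p.IsPath := fun a => by
    have hr : F.Reachable a (F.connectedComponentMk a).out :=
      SimpleGraph.ConnectedComponent.exact (Quot.out_eq _).symm
    obtain ⟨p⟩ := hr
    exact ⟨p.toPath, p.toPath.2⟩
  choose p hp using hp
  refine ⟨fun a => (p a).snd, fun a b hab => ?_⟩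
  have hroot : F.connectedComponentMk b = F.connectedComponentMk a :=
    SimpleGraph.ConnectedComponent.sound hab.symm.reachable
  -- The roots of `a` and `b` agree only through `hroot`, so the path of `b` is transported before
  -- the two paths are compared.
  obtain ⟨q, hq, hsnd⟩ : ∃ q : F.Walk b (F.connectedComponentMk a).out, q.IsPath ∧
      q.snd = (p b).snd := by
    have := hp b
    generalize p b = r at this
    revert r
    rw [hroot]
    exact fun r hr => ⟨r, hr, rfl⟩
  simp only [← hsnd]
  by_cases ha : a ∈ q.support
  · exact Or.inr (h.eq_snd_of_adj_start hq hab.symm ha).symm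
  · left
    have := (h.subsingleton_path _ _).elim ⟨p a, hp a⟩ ⟨.cons hab q, hq.cons ha⟩
    have h' : p a = .cons hab q := congrArg Subtype.val this
    simp [h']

lemma isAcyclic_edge (v w : V) : (SimpleGraph.fromEdgeSet {s(v, w)}).IsAcyclic := by
  have h : (⊥ ⊔ SimpleGraph.edge v w).IsAcyclic := SimpleGraph.isAcyclic_sup_fromEdgeSet_iff.mpr
    ⟨SimpleGraph.isAcyclic_bot, fun h => Or.inl (SimpleGraph.reachable_bot.mp h)⟩
  rwa [bot_sup_eq] at h

lemma sum_degree_eq [Fintype V] (G : SimpleGraph V) :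
    ∑ v, (G.neighborSet v).ncard = 2 * G.edgeSet.ncard := by
  classical
  rw [← SimpleGraph.coe_edgeFinset, Set.ncard_coe_finset, ← G.sum_degrees_eq_twice_card_edges]
  refine Finset.sum_congr rfl fun v _ => ?_
  rw [← SimpleGraph.card_neighborSet_eq_degree, ← Nat.card_eq_fintype_card, Nat.card_coe_set_eq]

variable [Finite V]

/-- The infimum is attained, because a forest for every single edge shows that the set is nonempty.
Disjointness of the forests is dropped, since the counting works without it. -/
lemma arboricity_spec (G : SimpleGraph V) :
    ∃ F : Fin (arboricity G) → SimpleGraph V, (∀ i, (F i).IsAcyclic) ∧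
      ∀ v w, G.Adj v w ↔ ∃ i, (F i).Adj v w := by
  have hne : {k : ℕ | ∃ F : Fin k → SimpleGraph V, (∀ i, (F i).IsAcyclic) ∧
      (∀ i j, i ≠ j → Disjoint (F i) (F j)) ∧ ∀ v w, G.Adj v w ↔ ∃ i, (F i).Adj v w}.Nonempty := by
    have e := Finite.equivFin G.edgeSet
    refine ⟨_, fun i => .fromEdgeSet {(e.symm i).1}, fun i => ?_, fun i j hij => ?_, fun v w => ?_⟩
    · have := isAcyclic_edge (e.symm i).1.out.1 (e.symm i).1.out.2
      rwa [Sym2.mk, Quot.out_eq] at this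
    · rw [SimpleGraph.disjoint_left]
      intro v w h h'
      simp only [SimpleGraph.fromEdgeSet_adj, Set.mem_singleton_iff] at h h'
      exact hij (e.symm.injective (Subtype.ext (h.1.symm.trans h'.1)))
    · simp only [SimpleGraph.fromEdgeSet_adj, Set.mem_singleton_iff]
      refine ⟨fun h => ⟨e ⟨s(v, w), h⟩, by rw [e.symm_apply_apply], h.ne⟩, ?_⟩
      rintro ⟨i, h, -⟩
      have := (e.symm i).2
      rwa [← h] at this
  obtain ⟨F, hF, -, hG⟩ := Nat.sInf_mem hne
  exact ⟨F, hF, hG⟩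

/-- The arboricity is positive as soon as there is an edge; this lets `α m` absorb the terms that
are linear in `m`. -/
lemma ncard_edgeSet_le (G : SimpleGraph V) :
    G.edgeSet.ncard ≤ arboricity G * G.edgeSet.ncard := by
  rcases Nat.eq_zero_or_pos (arboricity G) with h | h
  · obtain ⟨F, -, hG⟩ := arboricity_spec G
    have : G.edgeSet = ∅ := by
      rw [SimpleGraph.edgeSet_eq_empty]
      ext v w
      simp only [hG, SimpleGraph.bot_adj, iff_false]
      rintro ⟨i, -⟩
      exact (h ▸ i).elim0
    simp [this]
  · exact Nat.le_mul_of_pos_left _ h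

/-- The sum over the edges of the smaller degree of an end is at most twice the arboricity times the
number of edges. -/
lemma sum_low_degree_le [Fintype V] (G : SimpleGraph V) [DecidableRel G.Adj] (rk : V → ℕ)
    (hrk : ∀ v w, rk v < rk w → (G.neighborSet v).ncard ≤ (G.neighborSet w).ncard) :
    ∑ v, ∑ u with G.Adj v u ∧ rk u < rk v, (G.neighborSet u).ncard ≤
      2 * (arboricity G * G.edgeSet.ncard) := by
  classical
  obtain ⟨F, hF, hG⟩ := arboricity_spec G
  choose f hf using fun i => exists_parent (hF i)
  set d : V → ℕ := fun v => (G.neighborSet v).ncard with hd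
  -- The edge is charged to the end whose parent is the other end. That end pays its own degree,
  -- which is at least the degree of the lower-ranked `u`.
  have hpt : ∀ v u, (if G.Adj v u ∧ rk u < rk v then d u else 0) ≤
      ∑ i, ((if f i u = v ∧ rk u < rk v then d u else 0) +
        if f i v = u ∧ rk u < rk v then d v else 0) := by
    intro v u
    split_ifs with h
    · obtain ⟨i, hi⟩ := (hG v u).mp h.1
      refine le_trans ?_ (Finset.single_le_sum (fun _ _ => Nat.zero_le _) (Finset.mem_univ i))
      rcases hf i v u hi with h' | h'
      · rw [if_pos (⟨h', h.2⟩ : f i v = u ∧ _)]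
        exact (hrk u v h.2).trans (Nat.le_add_left _ _)
      · rw [if_pos (⟨h', h.2⟩ : f i u = v ∧ _)]
        exact Nat.le_add_right _ _
    · exact Nat.zero_le _
  -- In each forest the vertex `a` pays only for the edge to its parent, and ranks select at most
  -- one of the two directions.
  have hone : ∀ i a, (if rk a < rk (f i a) then d a else 0) +
      (if rk (f i a) < rk a then d a else 0) ≤ d a := by
    intro i a
    split_ifs <;> omega
  calc ∑ v, ∑ u with G.Adj v u ∧ rk u < rk v, d u
      = ∑ v, ∑ u, if G.Adj v u ∧ rk u < rk v then d u else 0 := by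
        simp only [Finset.sum_filter]
    _ ≤ ∑ v, ∑ u, ∑ i, ((if f i u = v ∧ rk u < rk v then d u else 0) +
        if f i v = u ∧ rk u < rk v then d v else 0) :=
        Finset.sum_le_sum fun v _ => Finset.sum_le_sum fun u _ => hpt v u
    _ = ∑ i, ∑ a, ((if rk a < rk (f i a) then d a else 0) +
        if rk (f i a) < rk a then d a else 0) := by
        rw [Finset.sum_congr rfl fun v _ => Finset.sum_comm, Finset.sum_comm]
        refine Finset.sum_congr rfl fun i _ => ?_
        simp only [Finset.sum_add_distrib]
        congr 1
        · rw [Finset.sum_comm]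
          refine Finset.sum_congr rfl fun u _ => ?_
          simp only [ite_and]
          rw [Finset.sum_ite_eq]; simp
        · refine Finset.sum_congr rfl fun v _ => ?_
          simp only [ite_and]
          rw [Finset.sum_ite_eq]; simp
    _ ≤ ∑ _i : Fin (arboricity G), ∑ a, d a :=
        Finset.sum_le_sum fun i _ => Finset.sum_le_sum fun a _ => hone i a
    _ = 2 * (arboricity G * G.edgeSet.ncard) := by
        rw [hd, sum_degree_eq]; simp; ring

end Arboricity

/-! ### Reasoning about the array language -/

section Reasoning

namespace ArrExpr

@[simp] lemma size_var (x : ℕ) : (var x).size = 1 := rfl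
@[simp] lemma size_lit (k : ℕ) : (lit k).size = 1 := rfl
@[simp] lemma size_inp (e : ArrExpr) : (inp e).size = e.size + 1 := rfl
@[simp] lemma size_arr (f : ℕ) (e : ArrExpr) : (arr f e).size = e.size + 1 := rfl
@[simp] lemma size_succ (e : ArrExpr) : (succ e).size = e.size + 1 := rfl
@[simp] lemma size_sub (e e' : ArrExpr) : (sub e e').size = e.size + e'.size + 1 := rfl
@[simp] lemma val_var (s : ArrState) (x : ℕ) : (var x).val s = s.reg x := rfl
@[simp] lemma val_lit (s : ArrState) (k : ℕ) : (lit k).val s = k := rfl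
@[simp] lemma val_inp (s : ArrState) (e : ArrExpr) : (inp e).val s = s.inp (e.val s) := rfl
@[simp] lemma val_arr (s : ArrState) (f : ℕ) (e : ArrExpr) :
    (arr f e).val s = s.arr f (e.val s) := rfl
@[simp] lemma val_succ (s : ArrState) (e : ArrExpr) : (succ e).val s = e.val s + 1 := rfl
@[simp] lemma val_sub (s : ArrState) (e e' : ArrExpr) :
    (sub e e').val s = e.val s - e'.val s := rfl

end ArrExpr

namespace ArrCmd

@[simp] lemma eval_skip (s : ArrState) : skip.eval s = s := rfl
@[simp] lemma eval_assign (s : ArrState) (x : ℕ) (e : ArrExpr) :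
    (assign x e).eval s = s.setReg x (e.val s) := rfl
@[simp] lemma eval_store (s : ArrState) (f : ℕ) (e e' : ArrExpr) :
    (store f e e').eval s = s.setArr f (e.val s) (e'.val s) := rfl
@[simp] lemma eval_seq (s : ArrState) (c c' : ArrCmd) :
    (seq c c').eval s = c'.eval (c.eval s) := rfl
@[simp] lemma eval_ifEq (s : ArrState) (e e' : ArrExpr) (c c' : ArrCmd) :
    (ifEq e e' c c').eval s = if e.val s = e'.val s then c.eval s else c'.eval s := rfl
@[simp] lemma cost_skip (s : ArrState) : skip.cost s = 1 := rfl
@[simp] lemma cost_assign (s : ArrState) (x : ℕ) (e : ArrExpr) :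
    (assign x e).cost s = e.size + 1 := rfl
@[simp] lemma cost_store (s : ArrState) (f : ℕ) (e e' : ArrExpr) :
    (store f e e').cost s = e.size + e'.size + 1 := rfl
@[simp] lemma cost_seq (s : ArrState) (c c' : ArrCmd) :
    (seq c c').cost s = c.cost s + c'.cost (c.eval s) := rfl
@[simp] lemma cost_ifEq (s : ArrState) (e e' : ArrExpr) (c c' : ArrCmd) :
    (ifEq e e' c c').cost s =
      e.size + e'.size + 1 + if e.val s = e'.val s then c.cost s else c'.cost s := rfl

/-- Effects are computed as Booleans, so that the side conditions of frame arguments about concrete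
code can be decided. -/
def writesReg : ArrCmd → ℕ → Bool
  | assign x _, y => x == y
  | seq c c', y => c.writesReg y || c'.writesReg y
  | ifEq _ _ c c', y => c.writesReg y || c'.writesReg y
  | forr x _ c, y => x == y || c.writesReg y
  | _, _ => false

def writesArr : ArrCmd → ℕ → Bool
  | store f _ _, g => f == g
  | seq c c', g => c.writesArr g || c'.writesArr g
  | ifEq _ _ c c', g => c.writesArr g || c'.writesArr g
  | forr _ _ c, g => c.writesArr g
  | _, _ => false

def emits : ArrCmd → Bool
  | seq c c' => c.emits || c'.emits
  | ifEq _ _ c c' => c.emits || c'.emits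
  | forr _ _ c => c.emits
  | emitVertex _ => true
  | emitBar => true
  | emitClose => true
  | _ => false

/-- The states `s` and `s'` agree in everything that `c` cannot change. -/
structure Frame (c : ArrCmd) (s s' : ArrState) : Prop where
  reg : ∀ x, c.writesReg x = false → s'.reg x = s.reg x
  arr : ∀ f, c.writesArr f = false → s'.arr f = s.arr f
  inp : s'.inp = s.inp
  out : c.emits = false → s'.out = s.out

lemma Frame.refl (c : ArrCmd) (s : ArrState) : Frame c s s :=
  ⟨fun _ _ => rfl, fun _ _ => rfl, rfl, fun _ => rfl⟩

lemma Frame.trans {c : ArrCmd} {s s' s'' : ArrState} (h : Frame c s s') (h' : Frame c s' s'') :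
    Frame c s s'' :=
  ⟨fun x hx => (h'.reg x hx).trans (h.reg x hx), fun f hf => (h'.arr f hf).trans (h.arr f hf),
    h'.inp.trans h.inp, fun ho => (h'.out ho).trans (h.out ho)⟩

/-- A frame for a command that changes less. -/
lemma Frame.weaken {c c' : ArrCmd} {s s' : ArrState} (h : Frame c s s')
    (hr : ∀ x, c'.writesReg x = false → c.writesReg x = false)
    (ha : ∀ f, c'.writesArr f = false → c.writesArr f = false)
    (ho : c'.emits = false → c.emits = false) : Frame c' s s' :=
  ⟨fun x hx => h.reg x (hr x hx), fun f hf => h.arr f (ha f hf), h.inp, fun hx => h.out (ho hx)⟩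

lemma frame_setReg {c : ArrCmd} {s : ArrState} {x k : ℕ} (h : c.writesReg x = true) :
    Frame c s (s.setReg x k) := by
  refine ⟨fun y hy => ?_, fun _ _ => rfl, rfl, fun _ => rfl⟩
  rw [ArrState.setReg_reg, if_neg]
  rintro rfl
  simp [h] at hy

lemma frame_eval (c : ArrCmd) (s : ArrState) : Frame c s (c.eval s) := by
  induction c generalizing s with
  | skip => exact .refl _ _
  | assign x e => exact frame_setReg (by simp [writesReg])
  | store f e e' =>
    refine ⟨fun _ _ => rfl, fun g hg => ?_, rfl, fun _ => rfl⟩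
    simp only [eval, ArrState.setArr_arr]
    rw [if_neg]
    rintro rfl
    simp [writesArr] at hg
  | seq c c' ih ih' =>
    refine .trans ((ih s).weaken ?_ ?_ ?_) ((ih' (c.eval s)).weaken ?_ ?_ ?_) <;>
      simp +contextual [writesReg, writesArr, emits]
  | ifEq e e' c c' ih ih' =>
    simp only [eval]
    split_ifs
    · refine (ih s).weaken ?_ ?_ ?_ <;> simp +contextual [writesReg, writesArr, emits]
    · refine (ih' s).weaken ?_ ?_ ?_ <;> simp +contextual [writesReg, writesArr, emits]
  | forr x e c ih =>
    simp only [eval]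
    induction e.val s with
    | zero => exact .refl _ _
    | succ k ihk =>
      refine (ihk.trans (frame_setReg (k := k) (by simp [writesReg]))).trans ((ih _).weaken ?_ ?_ ?_)
        <;> simp +contextual [writesReg, writesArr, emits]
  | emitVertex e => exact ⟨fun _ _ => rfl, fun _ _ => rfl, rfl, fun h => by simp [emits] at h⟩
  | emitBar => exact ⟨fun _ _ => rfl, fun _ _ => rfl, rfl, fun h => by simp [emits] at h⟩
  | emitClose => exact ⟨fun _ _ => rfl, fun _ _ => rfl, rfl, fun h => by simp [emits] at h⟩

/-- The rule for loops, with an invariant `P` and bounds `b k` for the costs of the iterations. -/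
lemma forr_spec {x : ℕ} {e : ArrExpr} {c : ArrCmd} {s : ArrState} (P : ℕ → ArrState → Prop)
    (b : ℕ → ℕ) (h0 : P 0 s)
    (hstep : ∀ k < e.val s, ∀ s', Frame (forr x e c) s s' → P k s' →
      P (k + 1) (c.eval (s'.setReg x k)) ∧ c.cost (s'.setReg x k) ≤ b k) :
    P (e.val s) ((forr x e c).eval s) ∧
      (forr x e c).cost s ≤ e.size + 1 + ∑ k ∈ Finset.range (e.val s), (1 + b k) := by
  have key : ∀ k ≤ e.val s, P k (iter c.eval x s k) ∧
      Frame (forr x e c) s (iter c.eval x s k) := by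
    intro k hk
    induction k with
    | zero => exact ⟨h0, .refl _ _⟩
    | succ k ih =>
      obtain ⟨hP, hF⟩ := ih (by omega)
      refine ⟨(hstep k (by omega) _ hF hP).1, ?_⟩
      refine (hF.trans (frame_setReg (k := k) (by simp [writesReg]))).trans
        ((frame_eval c _).weaken ?_ ?_ ?_) <;> simp +contextual [writesReg, writesArr, emits]
  refine ⟨(key _ le_rfl).1, Nat.add_le_add_left (Finset.sum_le_sum fun k hk => ?_) _⟩
  have hk := Finset.mem_range.mp hk
  exact Nat.add_le_add_left (hstep k hk _ (key k hk.le).2 (key k hk.le).1).2 1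

end ArrCmd

/-- The linked list with `k` cells from the cell `c` on. -/
def chain (val nx : ℕ → ℕ) : ℕ → ℕ → List ℕ
  | 0, _ => []
  | k + 1, c => val c :: chain val nx k (nx c)

lemma chain_length (val nx : ℕ → ℕ) (k c : ℕ) : (chain val nx k c).length = k := by
  induction k generalizing c with
  | zero => rfl
  | succ k ih => simp [chain, ih]

lemma chain_getElem? (val nx : ℕ → ℕ) {j k : ℕ} (c : ℕ) (h : j < k) :
    (chain val nx k c)[j]? = some (val (nx^[j] c)) := by
  induction j generalizing k c with
  | zero => obtain ⟨k, rfl⟩ := Nat.exists_eq_add_one.mpr h; rfl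
  | succ j ih =>
    obtain ⟨k, rfl⟩ := Nat.exists_eq_add_one.mpr (Nat.zero_lt_of_lt h)
    simpa [chain] using ih (nx c) (by omega : j < k)

/-- Links never lead to a greater cell, so a list that starts at most at `m` does not see changes
beyond `m`. This is why allocation preserves old lists, even when they share cells. -/
lemma chain_congr {val nx val' nx' : ℕ → ℕ} {m : ℕ} (hle : ∀ c, nx c ≤ c)
    (h : ∀ c ≤ m, val' c = val c ∧ nx' c = nx c) (k : ℕ) {c : ℕ} (hc : c ≤ m) :
    chain val' nx' k c = chain val nx k c := by
  induction k generalizing c with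
  | zero => rfl
  | succ k ih =>
    simp only [chain, (h c hc).1, (h c hc).2]
    rw [ih ((hle c).trans hc)]

namespace ArrCmd

/-- Run `body` with `x` the successive entries of the linked list of `q`, where `hd`, `len`, `val`
and `nx` are the arrays of the first cells, the lengths, the entries and the next cells. -/
def each (x cur i val nx hd len q : ℕ) (body : ArrCmd) : ArrCmd :=
  .seq (.assign cur (.arr hd (.var q))) <| .forr i (.arr len (.var q)) <|
    .seq (.assign x (.arr val (.var cur))) <| .seq (.assign cur (.arr nx (.var cur))) body

/-- The invariant speaks of the part of the list that has been traversed. The body must leave the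
cursor and the cells alone, but may change heads and lengths, which are read only once, at the
start. The `7` per entry is one step of the loop, three for reading the entry and three for moving
the cursor. -/
lemma each_spec {x cur i val nx hd len q : ℕ} {body : ArrCmd} {s : ArrState} {l : List ℕ}
    (hl : chain (s.arr val) (s.arr nx) (s.arr len (s.reg q)) (s.arr hd (s.reg q)) = l)
    (hcur : (body.writesReg cur || body.writesArr val || body.writesArr nx || x == cur ||
      i == cur || q == cur) = false)
    (P : List ℕ → ArrState → Prop) (b : ℕ → ℕ)
    (hP : ∀ pre s k r, r = x ∨ r = cur ∨ r = i → P pre s → P pre (s.setReg r k)) (h0 : P [] s)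
    (hstep : ∀ pre a suf s', l = pre ++ a :: suf → Frame (each x cur i val nx hd len q body) s s' →
      P pre s' → s'.reg x = a → P (pre ++ [a]) (body.eval s') ∧ body.cost s' ≤ b a) :
    P l ((each x cur i val nx hd len q body).eval s) ∧
      (each x cur i val nx hd len q body).cost s ≤ 6 + (l.map fun a => 7 + b a).sum := by
  simp only [Bool.or_eq_false_iff, beq_eq_false_iff_ne] at hcur
  obtain ⟨⟨⟨⟨⟨hcur, hval⟩, hnx⟩, hxc⟩, hic⟩, hqc⟩ := hcur
  set s₁ := s.setReg cur (s.arr hd (s.reg q)) with hs₁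
  have hlen : l.length = s.arr len (s.reg q) := by rw [← hl, chain_length]
  have hN : (ArrExpr.arr len (.var q)).val s₁ = l.length := by
    simp [ArrExpr.val, hs₁, ArrState.setReg_reg, hqc, hlen]
  have hget : ∀ k < l.length, l[k]? = some (s.arr val ((s.arr nx)^[k] (s.arr hd (s.reg q)))) :=
    fun k hk => by rw [← hl]; exact chain_getElem? _ _ _ (by omega)
  obtain ⟨⟨h1, -⟩, h2⟩ := forr_spec (x := i) (e := .arr len (.var q))
    (c := .seq (.assign x (.arr val (.var cur))) <| .seq (.assign cur (.arr nx (.var cur))) body)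
    (s := s₁)
    (fun k s' => P (l.take k) s' ∧ s'.reg cur = (s.arr nx)^[k] (s.arr hd (s.reg q)))
    (fun k => 6 + b (l.getD k 0))
    ⟨hP _ _ _ _ (by simp) h0, by simp [hs₁, ArrState.setReg_reg]⟩ (by
      rintro k hk s' hF ⟨hPk, hc⟩
      rw [hN] at hk
      have hv : s'.arr val = s.arr val := hF.arr val (by simp [writesArr, hval])
      have hn : s'.arr nx = s.arr nx := hF.arr nx (by simp [writesArr, hnx])
      have ha := hget k hk
      set a := s.arr val ((s.arr nx)^[k] (s.arr hd (s.reg q)))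
      have hkl := List.getElem?_eq_some_iff.mp ha
      obtain ⟨_, hka⟩ := hkl
      have hF' : Frame (each x cur i val nx hd len q body) s s' :=
        .trans (frame_setReg (by simp [each, writesReg]))
          (hF.weaken (by simp +contextual [each, writesReg]) (by simp [each, writesArr])
            (by simp [each, emits]))
      set s₂ := (((s'.setReg i k).setReg x a).setReg cur ((s.arr nx)^[k + 1] (s.arr hd (s.reg q))))
        with hs₂
      have hsplit : l = l.take k ++ a :: l.drop (k + 1) := by
        rw [← hka, List.cons_getElem_drop_succ, List.take_append_drop]
      obtain ⟨h1, h2⟩ := hstep (l.take k) a (l.drop (k + 1)) s₂ hsplit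
        (((hF'.trans (frame_setReg (by simp [each, writesReg]))).trans
          (frame_setReg (by simp [each, writesReg]))).trans
          (frame_setReg (by simp [each, writesReg])))
        (hP _ _ _ _ (by simp) (hP _ _ _ _ (by simp) (hP _ _ _ _ (by simp) hPk)))
        (by simp [hs₂, ArrState.setReg_reg, hxc])
      have hs₂' : ((s'.setReg i k).setReg x ((s'.setReg i k).arr val ((s'.setReg i k).reg cur))).setReg
          cur (((s'.setReg i k).setReg x ((s'.setReg i k).arr val ((s'.setReg i k).reg cur))).arr nx
          (((s'.setReg i k).setReg x ((s'.setReg i k).arr val ((s'.setReg i k).reg cur))).reg cur))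
          = s₂ := by
        simp [hs₂, ArrState.setReg_reg, Ne.symm hic, Ne.symm hxc, hc, hv, hn,
          Function.iterate_succ_apply', a]
      refine ⟨⟨?_, ?_⟩, ?_⟩
      · simp only [eval, ArrExpr.val]
        rw [hs₂', List.take_add_one, ha]
        exact h1
      · simp only [eval, ArrExpr.val]
        rw [hs₂', (frame_eval body s₂).reg cur hcur]
        simp [hs₂, ArrState.setReg_reg]
      · simp only [cost, eval, ArrExpr.val, ArrExpr.size]
        rw [hs₂', List.getD_eq_getElem?_getD, ha, Option.getD_some]
        omega)
  rw [hN, List.take_length] at h1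
  refine ⟨h1, ?_⟩
  rw [hN] at h2
  have hsum : ∑ k ∈ Finset.range l.length, (1 + (6 + b (l.getD k 0))) =
      (l.map fun a => 7 + b a).sum := by
    rw [Finset.sum_range, ← List.sum_ofFn]
    congr 1
    refine List.ext_getElem (by simp) fun k hk hk' => ?_
    simp at hk'
    simp; omega
  rw [hsum] at h2
  simp only [each, cost, eval, ArrExpr.val, ArrExpr.size] at h2 ⊢
  rw [← hs₁]
  omega

/-- Put the value of the register `a` in front of the linked list of `q`; the cells up to the value
of the register `fc` are in use. -/
def push (val nx hd len fc q a : ℕ) : ArrCmd :=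
  .seq (.assign fc (.succ (.var fc))) <| .seq (.store val (.var fc) (.var a)) <|
  .seq (.store nx (.var fc) (.arr hd (.var q))) <| .seq (.store hd (.var q) (.var fc)) <|
    .store len (.var q) (.succ (.arr len (.var q)))

lemma push_cost (val nx hd len fc q a : ℕ) (s : ArrState) :
    (push val nx hd len fc q a).cost s = 18 := by
  simp [push, cost, ArrExpr.size]

/-- The linked lists of the arrays `hd` and `len` in the heap of the arrays `val` and `nx` are the
lists `L q`. -/
structure Lists (val nx hd len fc : ℕ) (s : ArrState) (L : ℕ → List ℕ) : Prop where
  nx_le : ∀ c, s.arr nx c ≤ c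
  hd_le : ∀ q, s.arr hd q ≤ s.reg fc
  eq : ∀ q, chain (s.arr val) (s.arr nx) (s.arr len q) (s.arr hd q) = L q

lemma Lists.length {val nx hd len fc : ℕ} {s : ArrState} {L : ℕ → List ℕ}
    (h : Lists val nx hd len fc s L) (q : ℕ) : s.arr len q = (L q).length := by
  rw [← h.eq, chain_length]

lemma Lists.congr {val nx hd len fc : ℕ} {s s' : ArrState} {L : ℕ → List ℕ}
    (h : Lists val nx hd len fc s L) (hv : s'.arr val = s.arr val) (hn : s'.arr nx = s.arr nx)
    (hh : s'.arr hd = s.arr hd) (hl : s'.arr len = s.arr len) (hf : s'.reg fc = s.reg fc) :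
    Lists val nx hd len fc s' L :=
  ⟨by rw [hn]; exact h.nx_le, by rw [hh, hf]; exact h.hd_le, by rw [hv, hn, hh, hl]; exact h.eq⟩

section Push

variable {val nx hd len fc q a : ℕ} {s : ArrState}

lemma push_reg (y : ℕ) : ((push val nx hd len fc q a).eval s).reg y =
    if y = fc then s.reg fc + 1 else s.reg y := by
  simp only [push, eval, ArrExpr.val, ArrState.setArr_reg, ArrState.setReg_reg]

lemma push_arr (hd4 : [val, nx, hd, len].Nodup) (hfc : a ≠ fc ∧ q ≠ fc) (f : ℕ) :
    ((push val nx hd len fc q a).eval s).arr f =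
      if f = val then Function.update (s.arr val) (s.reg fc + 1) (s.reg a)
      else if f = nx then Function.update (s.arr nx) (s.reg fc + 1) (s.arr hd (s.reg q))
      else if f = hd then Function.update (s.arr hd) (s.reg q) (s.reg fc + 1)
      else if f = len then Function.update (s.arr len) (s.reg q) (s.arr len (s.reg q) + 1)
      else s.arr f := by
  simp only [List.nodup_cons, List.mem_cons, List.not_mem_nil, or_false, not_or] at hd4
  obtain ⟨⟨h1, h2, h3⟩, ⟨h4, h5⟩, h6, -⟩ := hd4
  simp only [push, eval, ArrExpr.val, ArrState.setArr_reg, ArrState.setArr_arr,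
    ArrState.setReg_reg, ArrState.setReg_arr, hfc.1, hfc.2, if_false, if_true]
  split_ifs <;> simp_all [Ne.symm]

lemma push_chain (hd4 : [val, nx, hd, len].Nodup) (hfc : a ≠ fc ∧ q ≠ fc)
    (hle : ∀ c, s.arr nx c ≤ c) (k : ℕ) {c : ℕ} (hc : c ≤ s.reg fc) :
    chain (((push val nx hd len fc q a).eval s).arr val)
      (((push val nx hd len fc q a).eval s).arr nx) k c = chain (s.arr val) (s.arr nx) k c := by
  have hvn : nx ≠ val := fun h => by simp [h] at hd4
  refine chain_congr hle (fun c hc => ?_) k hc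
  rw [push_arr hd4 hfc, push_arr hd4 hfc, if_pos rfl, if_neg hvn, if_pos rfl]
  exact ⟨Function.update_of_ne (by omega) _ _, Function.update_of_ne (by omega) _ _⟩

lemma Lists.push {L : ℕ → List ℕ} (h : Lists val nx hd len fc s L)
    (hd4 : [val, nx, hd, len].Nodup) (hfc : a ≠ fc ∧ q ≠ fc) :
    Lists val nx hd len fc ((push val nx hd len fc q a).eval s)
      (Function.update L (s.reg q) (s.reg a :: L (s.reg q))) := by
  have harr := push_arr (s := s) hd4 hfc
  have hch := push_chain (s := s) hd4 hfc h.nx_le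
  have hd4' := hd4
  simp only [List.nodup_cons, List.mem_cons, List.not_mem_nil, or_false, not_or] at hd4'
  obtain ⟨⟨h1, h2, h3⟩, ⟨h4, h5⟩, h6, -⟩ := hd4'
  have hhd := harr hd
  have hlen := harr len
  have hnx := harr nx
  have hval := harr val
  rw [if_neg (Ne.symm h2), if_neg (Ne.symm h4), if_pos rfl] at hhd
  rw [if_neg (Ne.symm h3), if_neg (Ne.symm h5), if_neg (Ne.symm h6), if_pos rfl] at hlen
  rw [if_neg (Ne.symm h1), if_pos rfl] at hnx
  rw [if_pos rfl] at hval
  refine ⟨fun c => ?_, fun p => ?_, fun p => ?_⟩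
  · rw [hnx, Function.update_apply]
    split_ifs with hc
    · exact (h.hd_le _).trans (by omega)
    · exact h.nx_le c
  · rw [hhd, push_reg, if_pos rfl, Function.update_apply]
    split_ifs
    · exact le_rfl
    · exact (h.hd_le p).trans (Nat.le_succ _)
  · rw [Function.update_apply]
    by_cases hp : p = s.reg q
    · rw [if_pos hp, hhd, hlen, hp, Function.update_self, Function.update_self, chain, ← h.eq,
        hval, hnx, Function.update_self, Function.update_self, ← hval, ← hnx, hch _ (h.hd_le _)]
    · rw [if_neg hp, hhd, hlen, Function.update_of_ne hp, Function.update_of_ne hp,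
        hch _ (h.hd_le p), h.eq]

/-- The lists of other arrays in the same heap do not change. -/
lemma Lists.push_other {hd' len' : ℕ} {L : ℕ → List ℕ} (h : Lists val nx hd' len' fc s L)
    (hd4 : [val, nx, hd, len].Nodup) (hfc : a ≠ fc ∧ q ≠ fc) (hhd : ∀ q, s.arr hd q ≤ s.reg fc)
    (hne : hd' ∉ [val, nx, hd, len] ∧ len' ∉ [val, nx, hd, len]) :
    Lists val nx hd' len' fc ((ArrCmd.push val nx hd len fc q a).eval s) L := by
  have harr := push_arr (s := s) hd4 hfc
  have hch := push_chain (s := s) hd4 hfc h.nx_le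
  have hvn : nx ≠ val := fun h => by simp [h] at hd4
  simp only [List.mem_cons, List.not_mem_nil, or_false, not_or] at hne
  obtain ⟨⟨h1, h2, h3, h4⟩, h1', h2', h3', h4'⟩ := hne
  have hhd' := harr hd'
  have hlen' := harr len'
  have hnx := harr nx
  rw [if_neg h1, if_neg h2, if_neg h3, if_neg h4] at hhd'
  rw [if_neg h1', if_neg h2', if_neg h3', if_neg h4'] at hlen'
  rw [if_neg hvn, if_pos rfl] at hnx
  refine ⟨fun c => ?_, fun p => ?_, fun p => ?_⟩
  · rw [hnx, Function.update_apply]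
    split_ifs with hc
    · exact (hhd _).trans (by omega)
    · exact h.nx_le c
  · rw [hhd', push_reg, if_pos rfl]
    exact (h.hd_le p).trans (Nat.le_succ _)
  · rw [hhd', hlen', hch _ (h.hd_le p), h.eq]

end Push

end ArrCmd

end Reasoning

/-! ### The preparation of the graph -/

section Preparation

abbrev rPt : ℕ := 0
abbrev rV : ℕ := 1
abbrev rJ : ℕ := 2
abbrev rD : ℕ := 3
abbrev rR : ℕ := 4
abbrev rK : ℕ := 5
abbrev rU : ℕ := 6
abbrev rW : ℕ := 7
abbrev rTl : ℕ := 8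
abbrev rLn : ℕ := 9
abbrev rM : ℕ := 10
abbrev rOk : ℕ := 11
abbrev rF1 : ℕ := 12
abbrev rF2 : ℕ := 13
abbrev rC1 : ℕ := 14
abbrev rI1 : ℕ := 15
abbrev rC2 : ℕ := 16
abbrev rI2 : ℕ := 17

abbrev aV1 : ℕ := 0
abbrev aN1 : ℕ := 1
abbrev aV2 : ℕ := 2
abbrev aN2 : ℕ := 3
abbrev aBH : ℕ := 4
abbrev aBL : ℕ := 5
abbrev aOrd : ℕ := 6
abbrev aOff : ℕ := 7
abbrev aAH : ℕ := 8
abbrev aAL : ℕ := 9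
abbrev aDone : ℕ := 10
abbrev aBelow : ℕ := 11
abbrev aPX : ℕ := 12
abbrev aPY : ℕ := 13
abbrev aNext : ℕ := 14
abbrev aLH : ℕ := 15
abbrev aLL : ℕ := 16
abbrev aDH : ℕ := 17
abbrev aSz : ℕ := 18
abbrev aSkip : ℕ := 19
abbrev aMark : ℕ := 20
abbrev aCnt : ℕ := 21
abbrev aLast : ℕ := 22
abbrev aAdded : ℕ := 23

/-- The words `I` describe the graph with the adjacency lists `nb`. -/
structure IsInput (n : ℕ) (I : ℕ → ℕ) (nb : ℕ → List ℕ) : Prop where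
  zero : I 0 = n
  deg : ∀ v < n, I (v + 1) = (nb v).length
  entry : ∀ v < n, ∀ j (h : j < (nb v).length),
    I (n + 1 + (∑ u ∈ Finset.range v, (nb u).length) + j) = (nb v)[j]
  nodup : ∀ v, (nb v).Nodup
  symm : ∀ u v, u ∈ nb v → v ∈ nb u
  lt : ∀ u v, u ∈ nb v → u < n
  irrefl : ∀ v, v ∉ nb v

variable {n : ℕ} {I : ℕ → ℕ} {nb : ℕ → List ℕ}

/-- Buckets for the degrees `0, …, n - 1` therefore suffice. -/
lemma IsInput.length_lt (h : IsInput n I nb) {v : ℕ} (hv : v < n) : (nb v).length < n := by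
  have hsub : (nb v).toFinset ⊂ Finset.range n := by
    refine (Finset.ssubset_iff_of_subset fun u hu => ?_).mpr ⟨v, by simpa using hv, ?_⟩
    · simpa using h.lt u v (by simpa using hu)
    · simpa using h.irrefl v
  simpa [List.toFinset_card_of_nodup (h.nodup v)] using Finset.card_lt_card hsub

/-- The vertices `< k` of degree `d`, in the order in which they are in their bucket. -/
def bucket (nb : ℕ → List ℕ) (k d : ℕ) : List ℕ :=
  ((List.range k).filter fun v => (nb v).length = d).reverse

/-- The vertices, ordered by their degrees. -/
def degreeOrder (n : ℕ) (nb : ℕ → List ℕ) : List ℕ := (List.range n).flatMap (bucket nb n)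

lemma mem_bucket {k d v : ℕ} : v ∈ bucket nb k d ↔ v < k ∧ (nb v).length = d := by
  simp [bucket]

lemma mem_degreeOrder (h : IsInput n I nb) {v : ℕ} : v ∈ degreeOrder n nb ↔ v < n := by
  simp only [degreeOrder, List.mem_flatMap, List.mem_range, mem_bucket]
  exact ⟨fun ⟨_, _, hv, _⟩ => hv, fun hv => ⟨_, h.length_lt hv, hv, rfl⟩⟩

lemma nodup_degreeOrder : (degreeOrder n nb).Nodup := by
  refine List.nodup_flatMap.mpr ⟨fun d _ => List.nodup_reverse.mpr (List.nodup_range.filter _), ?_⟩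
  refine List.nodup_range.imp fun {d d'} hne v hv hv' => hne ?_
  rw [← (mem_bucket.mp hv).2, (mem_bucket.mp hv').2]

lemma length_degreeOrder (h : IsInput n I nb) : (degreeOrder n nb).length = n := by
  have : (degreeOrder n nb).Perm (List.range n) :=
    (List.perm_ext_iff_of_nodup nodup_degreeOrder List.nodup_range).mpr fun v => by
      rw [mem_degreeOrder h, List.mem_range]
  simpa using this.length_eq

lemma pairwise_degreeOrder :
    (degreeOrder n nb).Pairwise fun u v => (nb u).length ≤ (nb v).length := by
  refine List.pairwise_flatMap.mpr ⟨fun d _ => ?_, ?_⟩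
  · refine List.pairwise_of_forall_mem_list fun u hu v hv => ?_
    rw [(mem_bucket.mp hu).2, (mem_bucket.mp hv).2]
  · refine List.pairwise_lt_range.imp fun {d d'} hlt u hu v hv => ?_
    rw [(mem_bucket.mp hu).2, (mem_bucket.mp hv).2]
    exact hlt.le

open ArrCmd ArrExpr ArrState

/-- Compute the offsets of the adjacency lists in the input, and distribute the vertices to buckets
according to their degrees. -/
def bucketCode : ArrCmd :=
  .seq (.assign rPt (.succ (.inp (.lit 0)))) <| .forr rV (.inp (.lit 0)) <|
    .seq (.store aOff (.var rV) (.var rPt)) <|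
    .seq (.forr rJ (.inp (.succ (.var rV))) (.assign rPt (.succ (.var rPt)))) <|
    .seq (.assign rD (.inp (.succ (.var rV)))) <| push aV1 aN1 aBH aBL rF1 rD rV

/-- List the vertices in the order of the buckets. -/
def orderCode : ArrCmd :=
  .forr rD (.inp (.lit 0)) <| each rV rC1 rI1 aV1 aN1 aBH aBL rD <|
    .seq (.store aOrd (.var rR) (.var rV)) (.assign rR (.succ (.var rR)))

/-- Enter the vertex `rV` in the list of its neighbour at the input position `rPt`. -/
def entryCode : ArrCmd :=
  .seq (.assign rU (.inp (.var rPt))) <|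
    .seq (push aV1 aN1 aAH aAL rF1 rU rV) (.assign rPt (.succ (.var rPt)))

/-- Build adjacency lists that are ordered by decreasing degrees. -/
def adjacencyCode : ArrCmd :=
  .forr rK (.inp (.lit 0)) <| .seq (.assign rV (.arr aOrd (.var rK))) <|
    .seq (.assign rPt (.arr aOff (.var rV))) <|
    .seq (.store aBelow (.var rV) (.inp (.succ (.var rV)))) <|
    .forr rJ (.inp (.succ (.var rV))) entryCode

/-- The state `s` has the input words `I`, and all other values in it are `0`. -/
structure IsInitial (I : ℕ → ℕ) (s : ArrState) : Prop where
  inp : s.inp = I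
  reg : ∀ x, s.reg x = 0
  arr : ∀ f i, s.arr f i = 0

/-- The language has no addition, so the offset advances by ones; this costs time linear in the
degree. -/
lemma count_spec (e : ArrExpr) (s : ArrState) :
    ((forr rJ e (.assign rPt (.succ (.var rPt)))).eval s).reg rPt = s.reg rPt + e.val s ∧
    (forr rJ e (.assign rPt (.succ (.var rPt)))).cost s ≤ e.size + 1 + 4 * e.val s := by
  have := forr_spec (x := rJ) (e := e) (c := .assign rPt (.succ (.var rPt))) (s := s)
    (fun k s' => s'.reg rPt = s.reg rPt + k) (fun _ => 3) rfl (fun k _ s' _ h => by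
      simp [setReg_reg, h]; omega)
  refine ⟨this.1, this.2.trans ?_⟩
  simp; omega

lemma bucketCode_spec (h : IsInput n I nb) {s : ArrState} (hs : IsInitial I s) :
    ((∀ v < n, (bucketCode.eval s).arr aOff v =
      n + 1 + ∑ u ∈ Finset.range v, (nb u).length) ∧
      Lists aV1 aN1 aBH aBL rF1 (bucketCode.eval s) (bucket nb n)) ∧
    bucketCode.cost s ≤ 7 + ∑ v ∈ Finset.range n, (30 + 4 * (nb v).length) := by
  have hN : (ArrExpr.inp (.lit 0)).val (s.setReg rPt (n + 1)) = n := by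
    simp [hs.inp, h.zero]
  have key := forr_spec (x := rV) (e := .inp (.lit 0)) (s := s.setReg rPt (n + 1))
    (c := .seq (.store aOff (.var rV) (.var rPt)) <|
      .seq (.forr rJ (.inp (.succ (.var rV))) (.assign rPt (.succ (.var rPt)))) <|
      .seq (.assign rD (.inp (.succ (.var rV)))) <| push aV1 aN1 aBH aBL rF1 rD rV)
    (fun k s' => s'.reg rPt = n + 1 + ∑ u ∈ Finset.range k, (nb u).length ∧
      (∀ v < k, s'.arr aOff v = n + 1 + ∑ u ∈ Finset.range v, (nb u).length) ∧
      Lists aV1 aN1 aBH aBL rF1 s' (bucket nb k))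
    (fun k => 29 + 4 * (nb k).length) (by
      refine ⟨by simp [setReg_reg], by simp, fun c => ?_, fun q => ?_, fun q => ?_⟩
      · simp [hs.arr]
      · simp [hs.arr]
      · simp [hs.arr, chain, bucket])
    (by
      rintro k hk s' hF ⟨hpt, hoff, hL⟩
      rw [hN] at hk
      have hinp : s'.inp = I := hF.inp.trans hs.inp
      set s₁ := (s'.setReg rV k).setArr aOff k (s'.reg rPt) with hs₁
      set s₂ := (forr rJ (.inp (.succ (.var rV))) (.assign rPt (.succ (.var rPt)))).eval s₁ with hs₂
      have hcount := count_spec (.inp (.succ (.var rV))) s₁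
      have hdeg : (ArrExpr.inp (.succ (.var rV))).val s₁ = (nb k).length := by
        simp [hs₁, setReg_reg, hinp, h.deg k hk]
      rw [hdeg, ← hs₂] at hcount
      have hF₂ := frame_eval (forr rJ (.inp (.succ (.var rV))) (.assign rPt (.succ (.var rPt)))) s₁
      rw [← hs₂] at hF₂
      set s₃ := s₂.setReg rD (nb k).length with hs₃
      have hv : s₂.reg rV = k := by rw [hF₂.reg rV (by decide)]; simp [hs₁, setReg_reg]
      have h3 : s₂.setReg rD (s₂.inp (s₂.reg rV + 1)) = s₃ := by
        rw [hs₃, hv, hF₂.inp]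
        simp only [hs₁, setArr_inp, setReg_inp, hinp, h.deg k hk]
      have hL₃ : Lists aV1 aN1 aBH aBL rF1 s₃ (bucket nb k) := by
        refine hL.congr ?_ ?_ ?_ ?_ ?_
        · simp [hs₃, hF₂.arr aV1 (by decide), hs₁, setArr_arr]
        · simp [hs₃, hF₂.arr aN1 (by decide), hs₁, setArr_arr]
        · simp [hs₃, hF₂.arr aBH (by decide), hs₁, setArr_arr]
        · simp [hs₃, hF₂.arr aBL (by decide), hs₁, setArr_arr]
        · simp [hs₃, setReg_reg, hF₂.reg rF1 (by decide), hs₁]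
      have heval : (ArrCmd.seq (.store aOff (.var rV) (.var rPt)) <|
          .seq (.forr rJ (.inp (.succ (.var rV))) (.assign rPt (.succ (.var rPt)))) <|
          .seq (.assign rD (.inp (.succ (.var rV)))) <| push aV1 aN1 aBH aBL rF1 rD rV).eval
          (s'.setReg rV k) = (push aV1 aN1 aBH aBL rF1 rD rV).eval s₃ := by
        rw [← h3, hs₂, hs₁]
        simp [setReg_reg]
      have hd4 : [aV1, aN1, aBH, aBL].Nodup := by decide
      have hfc : rV ≠ rF1 ∧ rD ≠ rF1 := by decide
      refine ⟨?_, ?_⟩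
      · rw [heval]
        refine ⟨?_, fun v hv => ?_, ?_⟩
        · rw [push_reg, if_neg (by decide), Finset.sum_range_succ]
          simp [hs₃, setReg_reg, hcount.1, hs₁, hpt]; omega
        · have hoff₂ : s₂.arr aOff = Function.update (s'.arr aOff) k (s'.reg rPt) := by
            rw [hF₂.arr aOff (by decide)]; simp [hs₁, setArr_arr]
          rw [push_arr hd4 hfc]
          simp only [hs₃, setReg_arr, hoff₂]
          simp only [show aOff ≠ aV1 ∧ aOff ≠ aN1 ∧ aOff ≠ aBH ∧ aOff ≠ aBL by decide, if_false]
          rw [Function.update_apply]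
          split_ifs with hvk
          · rw [hvk, hpt]
          · exact hoff v (by omega)
        · have := hL₃.push (q := rD) (a := rV) hd4 hfc
          convert this using 1
          funext d
          rw [Function.update_apply]
          simp only [hs₃, setReg_reg, hv, bucket, List.range_succ, List.filter_append]
          by_cases hd : d = (nb k).length
          · simp [hd]
          · simp [hd, Ne.symm hd]
      · have hc := hcount.2
        have hp := push_cost aV1 aN1 aBH aBL rF1 rD rV
        simp only [cost_seq, cost_store, cost_assign, eval_store, eval_assign, val_var,
          size_var, size_inp, size_succ] at hc ⊢
        rw [hp, show (s'.setReg rV k).setArr aOff ((s'.setReg rV k).reg rV)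
          ((s'.setReg rV k).reg rPt) = s₁ by simp [hs₁, setReg_reg]]
        omega)
  rw [hN] at key
  have h1 : bucketCode.eval s = (forr rV (.inp (.lit 0)) (.seq (.store aOff (.var rV) (.var rPt)) <|
      .seq (.forr rJ (.inp (.succ (.var rV))) (.assign rPt (.succ (.var rPt)))) <|
      .seq (.assign rD (.inp (.succ (.var rV)))) <| push aV1 aN1 aBH aBL rF1 rD rV)).eval
      (s.setReg rPt (n + 1)) := by
    simp only [bucketCode, eval_seq, eval_assign, val_succ, val_inp, val_lit, hs.inp, h.zero]
  rw [h1]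
  refine ⟨key.1.2, ?_⟩
  have h2 := key.2
  have hsum : ∑ v ∈ Finset.range n, (1 + (29 + 4 * (nb v).length)) =
      ∑ v ∈ Finset.range n, (30 + 4 * (nb v).length) :=
    Finset.sum_congr rfl fun _ _ => by omega
  simp only [bucketCode, cost_seq, cost_assign, eval_assign, val_succ, val_inp, val_lit, hs.inp,
    h.zero, size_succ, size_inp, size_lit] at h2 ⊢
  omega

lemma orderCode_spec (h : IsInput n I nb) {s : ArrState} (hI : s.inp = I) (hr : s.reg rR = 0)
    (hL : Lists aV1 aN1 aBH aBL rF1 s (bucket nb n)) :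
    (∀ i < n, some ((orderCode.eval s).arr aOrd i) = (degreeOrder n nb)[i]?) ∧
      orderCode.cost s ≤ 3 + 20 * n := by
  have hN : (ArrExpr.inp (.lit 0)).val s = n := by simp [hI, h.zero]
  have key := forr_spec (x := rD) (e := .inp (.lit 0)) (s := s)
    (c := each rV rC1 rI1 aV1 aN1 aBH aBL rD <|
      .seq (.store aOrd (.var rR) (.var rV)) (.assign rR (.succ (.var rR))))
    (fun k s' => (List.range (s'.reg rR)).map (s'.arr aOrd) =
      (List.range k).flatMap (bucket nb n))
    (fun k => 6 + ((bucket nb n k).map fun _ => 7 + 6).sum) (by simp [hr])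
    (by
      intro k hk s' hF hP
      have := each_spec (x := rV) (cur := rC1) (i := rI1) (val := aV1) (nx := aN1) (hd := aBH)
        (len := aBL) (q := rD) (s := s'.setReg rD k) (l := bucket nb n k)
        (body := .seq (.store aOrd (.var rR) (.var rV)) (.assign rR (.succ (.var rR))))
        (by
          simp only [setReg_arr, setReg_reg, if_true, hF.arr aV1 (by decide),
            hF.arr aN1 (by decide), hF.arr aBH (by decide), hF.arr aBL (by decide)]
          exact hL.eq k) (by decide)
        (fun pre s'' => (List.range (s''.reg rR)).map (s''.arr aOrd) =
          (List.range k).flatMap (bucket nb n) ++ pre) (fun _ => 6)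
        (by
          intro pre s'' k r hr hP
          have : rR ≠ r := by rintro rfl; revert hr; decide
          simpa only [setReg_arr, setReg_reg, if_neg this] using hP)
        (by simpa [setReg_reg] using hP)
        (by
          intro pre a suf s'' hl hF' hP ha
          refine ⟨?_, by simp⟩
          simp only [eval_seq, eval_store, eval_assign, val_var, val_succ, setReg_arr, setReg_reg, if_true, setArr_reg, setArr_arr,
            List.range_succ, List.map_append, List.map_singleton, Function.update_self, ha,
            ← List.append_assoc]
          rw [← hP]
          congr 1
          refine List.map_congr_left fun i hi => Function.update_of_ne ?_ _ _
          have := List.mem_range.mp hi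
          omega)
      refine ⟨?_, this.2⟩
      rw [List.range_succ, List.flatMap_append, List.flatMap_singleton]
      exact this.1)
  rw [hN] at key
  obtain ⟨h1, h2⟩ := key
  have hlen : (orderCode.eval s).reg rR = n := by
    have := congrArg List.length h1
    rw [List.length_map, List.length_range] at this
    exact this.trans (length_degreeOrder h)
  refine ⟨fun i hi => ?_, ?_⟩
  · change List.map ((orderCode.eval s).arr aOrd) (List.range ((orderCode.eval s).reg rR)) =
      degreeOrder n nb at h1
    rw [← h1, hlen]
    simp [hi]
  · refine h2.trans ?_
    -- The buckets partition the vertices, so the nested loops take linear time altogether.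
    have hsum : ∑ k ∈ Finset.range n, (bucket nb n k).length = n := by
      conv_rhs => rw [← length_degreeOrder h, degreeOrder, List.length_flatMap]
      rw [Finset.sum_range, ← List.sum_ofFn]
      congr 1
      exact List.ext_getElem (by simp) (by simp)
    simp only [List.map_const', List.sum_replicate, smul_eq_mul, size]
    rw [show ∑ k ∈ Finset.range n, (1 + (6 + (bucket nb n k).length * (7 + 6))) = 20 * n by
      simp only [Finset.sum_add_distrib, ← Finset.sum_mul, hsum]; simp; omega]

end Preparation

/-! ### Sorting all adjacency lists in linear time -/

section Adjacency

open ArrCmd ArrExpr ArrState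

variable {n : ℕ} {I : ℕ → ℕ} {nb : ℕ → List ℕ}

/-- The neighbours of `u`, ordered by decreasing degrees. -/
def sortedNb (n : ℕ) (nb : ℕ → List ℕ) (u : ℕ) : List ℕ :=
  ((degreeOrder n nb).filter fun v => v ∈ nb u).reverse

lemma mem_sortedNb (h : IsInput n I nb) {u v : ℕ} : v ∈ sortedNb n nb u ↔ v ∈ nb u := by
  simp only [sortedNb, List.mem_reverse, List.mem_filter, mem_degreeOrder h, decide_eq_true_eq]
  exact ⟨fun h => h.2, fun hv => ⟨h.lt _ _ hv, hv⟩⟩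

lemma nodup_sortedNb (u : ℕ) : (sortedNb n nb u).Nodup :=
  List.nodup_reverse.mpr (nodup_degreeOrder.filter _)

lemma length_sortedNb (h : IsInput n I nb) (u : ℕ) :
    (sortedNb n nb u).length = (nb u).length :=
  ((List.perm_ext_iff_of_nodup (nodup_sortedNb u) (h.nodup u)).mpr fun _ =>
    mem_sortedNb h).length_eq

lemma entryCode_spec {s : ArrState} {L : ℕ → List ℕ} (hL : Lists aV1 aN1 aAH aAL rF1 s L) :
    (Lists aV1 aN1 aAH aAL rF1 (entryCode.eval s) (Function.update L (s.inp (s.reg rPt))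
        (s.reg rV :: L (s.inp (s.reg rPt)))) ∧
      (entryCode.eval s).reg rPt = s.reg rPt + 1) ∧ entryCode.cost s = 24 := by
  have hL' : Lists aV1 aN1 aAH aAL rF1 (s.setReg rU (s.inp (s.reg rPt))) L :=
    hL.congr rfl rfl rfl rfl (by simp [setReg_reg])
  have hp := hL'.push (q := rU) (a := rV) (by decide) (by decide)
  refine ⟨⟨?_, ?_⟩, ?_⟩
  · simp only [entryCode, eval_seq, eval_assign, val_inp, val_var]
    simp [setReg_reg] at hp
    exact hp.congr rfl rfl rfl rfl (by simp [setReg_reg])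
  · simp [entryCode, setReg_reg, push_reg]
  · simp [entryCode, push_cost]

/-- Each vertex, taken in the order of increasing degrees, is pushed in front of the lists of its
neighbours. All lists thereby become sorted in decreasing order, without any comparison. -/
lemma adjacencyCode_spec (h : IsInput n I nb) {s : ArrState} (hI : s.inp = I)
    (hoff : ∀ v < n, s.arr aOff v = n + 1 + ∑ u ∈ Finset.range v, (nb u).length)
    (hord : ∀ i < n, some (s.arr aOrd i) = (degreeOrder n nb)[i]?)
    (hL : Lists aV1 aN1 aAH aAL rF1 s fun _ => []) :
    (Lists aV1 aN1 aAH aAL rF1 (adjacencyCode.eval s) (sortedNb n nb) ∧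
      ∀ v < n, (adjacencyCode.eval s).arr aBelow v = (nb v).length) ∧
    adjacencyCode.cost s ≤ 3 + ∑ v ∈ Finset.range n, (16 + 25 * (nb v).length) := by
  set ord := degreeOrder n nb with hord'
  have hlen : ord.length = n := length_degreeOrder h
  have hN : (ArrExpr.inp (.lit 0)).val s = n := by simp [hI, h.zero]
  have hget : ∀ i < n, ord[i]? = some (ord.getD i 0) := fun i hi => by
    rw [List.getD_eq_getElem?_getD, List.getElem?_eq_getElem (by omega), Option.getD_some]
  have key := forr_spec (x := rK) (e := .inp (.lit 0)) (s := s)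
    (c := .seq (.assign rV (.arr aOrd (.var rK))) <| .seq (.assign rPt (.arr aOff (.var rV))) <|
      .seq (.store aBelow (.var rV) (.inp (.succ (.var rV)))) <|
      .forr rJ (.inp (.succ (.var rV))) entryCode)
    (fun k s' => Lists aV1 aN1 aAH aAL rF1 s'
        (fun u => ((ord.take k).filter fun v => v ∈ nb u).reverse) ∧
      ∀ v ∈ ord.take k, s'.arr aBelow v = (nb v).length)
    (fun k => 15 + 25 * (nb (ord.getD k 0)).length)
    ⟨by simpa using hL, by simp⟩ (by
      rintro k hk s' hF ⟨hLk, hb⟩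
      rw [hN] at hk
      set v := ord.getD k 0 with hv
      have hvk : ord[k]? = some v := hget k hk
      have htake : ord.take (k + 1) = ord.take k ++ [v] := by
        rw [List.take_add_one, hvk]; rfl
      have hvn : v < n := (mem_degreeOrder h).mp (List.mem_of_getElem? hvk)
      have hinp : s'.inp = I := hF.inp.trans hI
      have h1 : s'.arr aOrd k = v := by
        have := hord k hk
        rw [hvk] at this
        rw [hF.arr aOrd (by decide)]
        exact Option.some.inj this
      have h2 : s'.arr aOff v = n + 1 + ∑ u ∈ Finset.range v, (nb u).length := by
        rw [hF.arr aOff (by decide), hoff v hvn]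
      set p := n + 1 + ∑ u ∈ Finset.range v, (nb u).length
      set s₁ := (((s'.setReg rK k).setReg rV v).setReg rPt p).setArr aBelow v (nb v).length with hs₁
      have heval : (ArrCmd.seq (.assign rV (.arr aOrd (.var rK))) <|
          .seq (.assign rPt (.arr aOff (.var rV))) <|
          .seq (.store aBelow (.var rV) (.inp (.succ (.var rV)))) <|
          .forr rJ (.inp (.succ (.var rV))) entryCode).eval (s'.setReg rK k) =
          (forr rJ (.inp (.succ (.var rV))) entryCode).eval s₁ := by
        simp [hs₁, setReg_reg, h1, h2, hinp, h.deg v hvn]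
      have hdeg : (ArrExpr.inp (.succ (.var rV))).val s₁ = (nb v).length := by
        simp [hs₁, setReg_reg, hinp, h.deg v hvn]
      have hL₁ : Lists aV1 aN1 aAH aAL rF1 s₁
          (fun u => ((ord.take k).filter fun v => v ∈ nb u).reverse) :=
        hLk.congr (by simp [hs₁, setArr_arr]) (by simp [hs₁, setArr_arr])
          (by simp [hs₁, setArr_arr]) (by simp [hs₁, setArr_arr]) (by simp [hs₁, setReg_reg])
      have inner := forr_spec (x := rJ) (e := .inp (.succ (.var rV))) (c := entryCode) (s := s₁)
        (fun j s'' => Lists aV1 aN1 aAH aAL rF1 s'' (fun u => if u ∈ (nb v).take j then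
            v :: ((ord.take k).filter fun v => v ∈ nb u).reverse else
            ((ord.take k).filter fun v => v ∈ nb u).reverse) ∧ s''.reg rPt = p + j)
        (fun _ => 24) ⟨by simpa using hL₁, by simp [hs₁, setReg_reg]⟩ (by
          rintro j hj s'' hF'' ⟨hLj, hpt⟩
          rw [hdeg] at hj
          have hent := h.entry v hvn j hj
          have hu : (s''.setReg rJ j).inp ((s''.setReg rJ j).reg rPt) = (nb v)[j] := by
            rw [setReg_inp, hF''.inp, ← hent]
            simp [hs₁, hinp, setReg_reg, hpt, p]
          have hvr : (s''.setReg rJ j).reg rV = v := by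
            rw [setReg_reg, if_neg (by decide), hF''.reg rV (by decide)]
            simp [hs₁, setReg_reg]
          obtain ⟨⟨h1, h2⟩, h3⟩ := entryCode_spec (hLj.congr (s' := s''.setReg rJ j) rfl rfl rfl rfl
            (by simp [setReg_reg]))
          refine ⟨⟨?_, ?_⟩, h3.le⟩
          · convert h1 using 1
            funext u
            rw [hu, hvr, Function.update_apply]
            have hnt : (nb v)[j] ∉ (nb v).take j := fun hmem => by
              obtain ⟨i, hi, hij⟩ := List.mem_take_iff_getElem.mp hmem
              have := (h.nodup v).getElem_inj_iff.mp hij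
              omega
            rw [List.take_add_one, List.getElem?_eq_getElem hj]
            simp only [List.mem_append, Option.toList_some, List.mem_singleton]
            by_cases huj : u = (nb v)[j]
            · subst huj; simp [hnt]
            · simp [huj]
          · rw [h2, setReg_reg, if_neg (by decide), hpt]; omega)
      rw [hdeg, List.take_length] at inner
      have hFf := frame_eval (forr rJ (.inp (.succ (.var rV))) entryCode) s₁
      refine ⟨⟨?_, fun w hw => ?_⟩, ?_⟩
      · rw [heval]
        convert inner.1.1 using 1
        funext u
        rw [htake, List.filter_append, List.reverse_append]
        -- The lists that grow are those of the entries of `nb v`; by symmetry these are exactly the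
        -- vertices that have `v` as a neighbour.
        by_cases huv : u ∈ nb v
        · simp [huv, h.symm _ _ huv]
        · have : v ∉ nb u := fun h' => huv (h.symm _ _ h')
          simp [huv, this]
      · rw [heval, hFf.arr aBelow (by decide)]
        rw [htake, List.mem_append, List.mem_singleton] at hw
        simp only [hs₁, setArr_arr, if_true, setReg_arr, Function.update_apply]
        split_ifs with hwv
        · rw [hwv]
        · exact hb w (hw.resolve_right hwv)
      · have := inner.2
        simp only [cost_seq, cost_assign, cost_store, eval_assign, eval_store, val_arr, val_var,
          val_inp, val_succ, size_var, size_arr, size_inp, size_succ, Finset.sum_const,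
          Finset.card_range, smul_eq_mul] at this ⊢
        rw [show (((s'.setReg rK k).setReg rV ((s'.setReg rK k).arr aOrd ((s'.setReg rK k).reg rK))).setReg
          rPt _).setArr aBelow _ _ = s₁ by simp [hs₁, setReg_reg, h1, h2, hinp, h.deg v hvn]]
        omega)
  rw [hN] at key
  have htake : ord.take n = ord := by rw [← hlen, List.take_length]
  simp only [htake] at key
  obtain ⟨⟨h1, h2⟩, h3⟩ := key
  refine ⟨⟨h1, fun v hv => h2 v ((mem_degreeOrder h).mpr hv)⟩, h3.trans ?_⟩
  have hperm : (ord.map fun v => 16 + 25 * (nb v).length).sum =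
      ((List.range n).map fun v => 16 + 25 * (nb v).length).sum := by
    refine (List.Perm.map _ ?_).sum_eq
    exact (List.perm_ext_iff_of_nodup nodup_degreeOrder List.nodup_range).mpr fun v => by
      rw [mem_degreeOrder h, List.mem_range]
  have hsum : ∑ k ∈ Finset.range n, (1 + (15 + 25 * (nb (ord.getD k 0)).length)) =
      (ord.map fun v => 16 + 25 * (nb v).length).sum := by
    rw [Finset.sum_range, ← List.sum_ofFn]
    congr 1
    refine List.ext_getElem (by simp [hlen]) fun k hk hk' => ?_
    simp at hk hk'
    simp [hk']; omega
  have hr : ∑ v ∈ Finset.range n, (16 + 25 * (nb v).length) =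
      ((List.range n).map fun v => 16 + 25 * (nb v).length).sum := by
    rw [Finset.sum_range, ← List.sum_ofFn]
    congr 1
    exact List.ext_getElem (by simp) (by simp)
  rw [hsum, hperm, ← hr]
  simp

/-- Sort the vertices by their degrees, and build the sorted adjacency lists. -/
def prepareCode : ArrCmd := .seq bucketCode (.seq orderCode adjacencyCode)

lemma prepareCode_spec (h : IsInput n I nb) {s : ArrState} (hs : IsInitial I s) :
    (Lists aV1 aN1 aAH aAL rF1 (prepareCode.eval s) (sortedNb n nb) ∧
      (∀ v < n, (prepareCode.eval s).arr aBelow v = (nb v).length) ∧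
      ∀ i < n, some ((prepareCode.eval s).arr aOrd i) = (degreeOrder n nb)[i]?) ∧
    prepareCode.cost s ≤ 13 + 66 * n + 29 * ∑ v ∈ Finset.range n, (nb v).length := by
  obtain ⟨⟨hoff, hb⟩, hc⟩ := bucketCode_spec h hs
  have hF₁ := frame_eval bucketCode s
  set s₁ := bucketCode.eval s
  obtain ⟨hord, hc'⟩ := orderCode_spec h (hF₁.inp.trans hs.inp)
    ((hF₁.reg rR (by decide)).trans (hs.reg _)) hb
  have hF₂ := frame_eval orderCode s₁
  set s₂ := orderCode.eval s₁ with hs₂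
  obtain ⟨⟨hL, hbel⟩, hc''⟩ := adjacencyCode_spec h (hF₂.inp.trans (hF₁.inp.trans hs.inp))
    (fun v hv => by rw [hF₂.arr aOff (by decide)]; exact hoff v hv) hord
    ⟨fun c => by rw [hF₂.arr aN1 (by decide)]; exact hb.nx_le c,
      fun q => by rw [hF₂.arr aAH (by decide), hF₁.arr aAH (by decide), hs.arr]; exact Nat.zero_le _,
      fun q => by
        rw [hF₂.arr aAL (by decide), hF₁.arr aAL (by decide), hs.arr]; rfl⟩
  have hF₃ := frame_eval adjacencyCode s₂
  refine ⟨⟨hL, hbel, fun i hi => ?_⟩, ?_⟩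
  · show some ((adjacencyCode.eval s₂).arr aOrd i) = _
    rw [hF₃.arr aOrd (by decide)]
    exact hord i hi
  · show bucketCode.cost s + (orderCode.cost s₁ + adjacencyCode.cost s₂) ≤ _
    simp only [Finset.sum_add_distrib, ← Finset.mul_sum, Finset.sum_const, Finset.card_range,
      smul_eq_mul] at hc hc''
    omega

end Adjacency

/-! ### Dominators in a sorted graph -/

section Dominators

open ArrCmd ArrExpr ArrState

/-- A triangle-free `C₄`-dominated graph with vertices `< n`, with ranks that are compatible with the
degrees, and with adjacency lists in the order of decreasing ranks. -/
structure IsSorted (n : ℕ) (G : SimpleGraph ℕ) (nb : ℕ → List ℕ) (rk : ℕ → ℕ) : Prop where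
  lt : ∀ u v, G.Adj u v → u < n
  mem : ∀ u v, v ∈ nb u ↔ G.Adj u v
  sorted : ∀ u, (nb u).Pairwise fun a b => rk b < rk a
  inj : ∀ u < n, ∀ v < n, rk u = rk v → u = v
  deg : ∀ u < n, ∀ v < n, rk u < rk v → (nb u).length ≤ (nb v).length
  tri : G.CliqueFree 3
  c4 : C4Dominated G

variable {n : ℕ} {G : SimpleGraph ℕ} {nb : ℕ → List ℕ} {rk : ℕ → ℕ}

/-- The dominators of `x` whose rank is at least the rank of `x`. -/
def upDom (n : ℕ) (G : SimpleGraph ℕ) (rk : ℕ → ℕ) (x : ℕ) : Set ℕ :=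
  {v | v < n ∧ rk x ≤ rk v ∧ Dominates G v x}

/-- The vertex `x` has a neighbour of smaller rank, or two incomparable neighbours. -/
def NonChain (G : SimpleGraph ℕ) (rk : ℕ → ℕ) (x : ℕ) : Prop :=
  (∃ y, G.Adj x y ∧ rk y < rk x) ∨ ∃ a b, G.Adj x a ∧ G.Adj x b ∧ ¬ DomComparable G a b

/-- The biclique of `x` is also the biclique of a neighbour of greater rank. -/
def Crossed (n : ℕ) (G : SimpleGraph ℕ) (rk : ℕ → ℕ) (x : ℕ) : Prop :=
  ∃ w, G.Adj x w ∧ rk x < rk w ∧ upDom n G rk x = G.neighborSet w ∧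
    upDom n G rk w = G.neighborSet x

lemma mem_upDom_self {x : ℕ} (hx : x < n) : x ∈ upDom n G rk x :=
  ⟨hx, le_rfl, Dominates.refl G x⟩

lemma upDom_subset {x w : ℕ} (h : G.Adj x w) : upDom n G rk x ⊆ G.neighborSet w :=
  fun _ hu => (hu.2.2.adj h).symm

namespace IsSorted

variable (H : IsSorted n G nb rk)
include H

lemma nodup (u : ℕ) : (nb u).Nodup :=
  (H.sorted u).imp fun h => by rintro rfl; exact lt_irrefl _ h

lemma neighborSet_eq (v : ℕ) : G.neighborSet v = {x | x ∈ nb v} := by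
  ext x; exact (H.mem v x).symm

lemma finite (v : ℕ) : (G.neighborSet v).Finite := by
  rw [H.neighborSet_eq]; exact List.finite_toSet _

lemma ncard (v : ℕ) : (G.neighborSet v).ncard = (nb v).length := by
  classical
  rw [H.neighborSet_eq, ← List.toFinset_card_of_nodup (H.nodup v), ← Set.ncard_coe_finset]
  congr 1; ext x; simp

lemma neighborSet_eq_of_dominates {v w : ℕ} (h : Dominates G v w)
    (hc : (nb v).length ≤ (nb w).length) : G.neighborSet w = G.neighborSet v :=
  h.neighborSet_eq (by rwa [H.ncard, H.ncard]) (H.finite v)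

lemma length_eq {v w : ℕ} (h : G.neighborSet v = G.neighborSet w) :
    (nb v).length = (nb w).length := by rw [← H.ncard, h, H.ncard]

/-- Twins are allowed here: if the vertex of smaller rank dominates, the degrees force equal
neighbourhoods, and domination holds in both directions. -/
lemma dominates_of_comparable {v w : ℕ} (hv : v < n) (hw : w < n) (h : rk w < rk v)
    (hc : DomComparable G v w) : Dominates G v w := by
  rcases hc with hc | hc
  · exact hc
  · exact (H.neighborSet_eq_of_dominates hc (H.deg w hw v hv h)).ge

/-- Domination, when two incomparable neighbours of the smaller vertex are known. -/
lemma dominates_iff_of_pair {v w a b : ℕ} (hv : v < n) (hw : w < n) (h : rk w < rk v)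
    (ha : G.Adj w a) (hb : G.Adj w b) (hab : ¬ DomComparable G a b) :
    Dominates G v w ↔ G.Adj v a ∧ G.Adj v b :=
  ⟨fun hd => ⟨hd.adj ha, hd.adj hb⟩, fun ⟨ha', hb'⟩ =>
    H.dominates_of_comparable hv hw h (H.c4.comparable hab ha' hb' ha hb)⟩

/-- Domination, when the neighbours of high rank of the smaller vertex dominate the others. -/
lemma dominates_iff_of_chain {v w y : ℕ} (hy : G.Adj v y) (hy' : G.Adj w y) (hyv : rk y < rk v)
    (hv : v < n) (hch : ∀ a, G.Adj w a → rk v < rk a → Dominates G a y) :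
    Dominates G v w ↔ ∀ x, G.Adj w x → rk x < rk v → G.Adj v x := by
  refine ⟨fun hd x hx _ => hd.adj hx, fun hlow x hx => ?_⟩
  rcases lt_trichotomy (rk x) (rk v) with h | h | h
  · exact hlow x hx h
  · obtain rfl := H.inj x (H.lt _ _ hx.symm) v hv h
    exact absurd hx.symm (not_adj_of_cliqueFree H.tri hy.symm hy'.symm)
  · exact ((hch x hx h).adj hy.symm).symm

/-- Equality of the sizes is equality of the sets. -/
lemma upDom_eq_iff {x w : ℕ} {l : List ℕ} (hl : l.Pairwise fun a b => rk a < rk b)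
    (hmem : ∀ u, u ∈ l ↔ u ∈ upDom n G rk x) (hxw : G.Adj x w) :
    upDom n G rk x = G.neighborSet w ↔ l.length = (nb w).length := by
  classical
  have hnd : l.Nodup := hl.imp fun h => by rintro rfl; exact lt_irrefl _ h
  have hcard : (upDom n G rk x).ncard = l.length := by
    rw [← List.toFinset_card_of_nodup hnd, ← Set.ncard_coe_finset]
    congr 1; ext u; simp [hmem]
  refine ⟨fun heq => by rw [← hcard, heq, H.ncard], fun heq => ?_⟩
  exact Set.eq_of_subset_of_ncard_le (upDom_subset hxw)
    (by rw [H.ncard, hcard, heq]) (H.finite w)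

end IsSorted

/-- The invariant of the main loop: the vertices of rank at least `t` have been processed. -/
structure Inv (n : ℕ) (G : SimpleGraph ℕ) (nb : ℕ → List ℕ) (rk : ℕ → ℕ) (t : ℕ)
    (L D : ℕ → List ℕ) (s : ArrState) : Prop where
  done : ∀ x < n, s.arr aDone x = if t ≤ rk x then 1 else 0
  below : ∀ x < n, s.arr aBelow x = ((nb x).filter fun y => rk y < t).length
  pair : ∀ x < n, s.arr aPX x ≠ 0 → ∃ a b, s.arr aPX x = a + 1 ∧ s.arr aPY x = b + 1 ∧
    G.Adj x a ∧ G.Adj x b ∧ ¬ DomComparable G a b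
  -- This makes an empty entry informative: a processed neighbour `a` of `x` above `x` then
  -- dominates every neighbour of `x` of smaller rank than `a`.
  pair_of : ∀ x a b, G.Adj x a → G.Adj x b → t ≤ rk a → rk b < rk a → rk x < rk a →
    ¬ Dominates G a b → s.arr aPX x ≠ 0
  next_zero : ∀ x < n, s.arr aPX x = 0 → s.arr aNext x = 0
  -- By the last clause the dominators of `x` from `x` on are `x` followed by those of `y`, so the
  -- two lists can share their cells.
  next_pos : ∀ x < n, ∀ y, s.arr aNext x = y + 1 → y < n ∧ rk x < rk y ∧ Dominates G y x ∧
    s.arr aPX y ≠ 0 ∧ ∀ z, rk x < rk z → Dominates G z x → z = y ∨ rk y < rk z ∧ Dominates G z y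
  -- Without a next dominator, each greater dominator `z` meets the condition under which its round
  -- enters it in the list `L x`.
  next_last : ∀ x < n, s.arr aPX x ≠ 0 → s.arr aNext x = 0 → ∀ z, rk x < rk z →
    Dominates G z x → ∃ y, G.Adj x y ∧ rk y < rk z
  lists : Lists aV2 aN2 aLH aLL rF2 s L
  list_sorted : ∀ x < n, (L x).Pairwise fun a b => rk a < rk b
  -- The round of `v` meets `x` only through a common neighbour below `v`, and every neighbour of
  -- `x` is common when `v` dominates `x`.
  mem_list : ∀ x < n, ∀ v, v ∈ L x ↔ t ≤ rk v ∧ v < n ∧ rk x < rk v ∧ Dominates G v x ∧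
    ∃ y, G.Adj x y ∧ rk y < rk v
  dlists : Lists aV2 aN2 aDH aSz rF2 s D
  dlist_sorted : ∀ x < n, t ≤ rk x → NonChain G rk x → (D x).Pairwise fun a b => rk a < rk b
  mem_dlist : ∀ x < n, t ≤ rk x → NonChain G rk x → ∀ v, v ∈ D x ↔ v ∈ upDom n G rk x
  skip_zero : ∀ x < n, rk x < t → s.arr aSkip x = 0
  skip : ∀ x < n, t ≤ rk x → (s.arr aSkip x ≠ 0 ↔ ¬ NonChain G rk x ∨ Crossed n G rk x ∨
    ∃ w < n, t ≤ rk w ∧ rk w < rk x ∧ G.neighborSet w = G.neighborSet x)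
  -- Old marks are never erased; they name vertices processed before and cannot be taken for marks
  -- of a later round.
  mark : ∀ x < n, s.arr aMark x = 0 ∨ ∃ y < n, s.arr aMark x = y + 1 ∧ t ≤ rk y

/-- The dominators of the vertex `v` of greater rank, as they are known before `v` is processed. -/
def tailList (L D : ℕ → List ℕ) (s : ArrState) (v : ℕ) : List ℕ :=
  if s.arr aNext v = 0 then L v else D (s.arr aNext v - 1)

lemma Inv.nonChain_of_pair {t : ℕ} {L D : ℕ → List ℕ} {s : ArrState} (h : Inv n G nb rk t L D s) {x : ℕ} (hx : x < n)
    (hp : s.arr aPX x ≠ 0) : NonChain G rk x := by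
  obtain ⟨a, b, -, -, ha, hb, hab⟩ := h.pair x hx hp
  exact Or.inr ⟨a, b, ha, hb, hab⟩

section Round

variable {L D : ℕ → List ℕ} {s : ArrState} {v : ℕ} (H : IsSorted n G nb rk)
  (h : Inv n G nb rk (rk v + 1) L D s) (hv : v < n)
include H h hv

/-- If all neighbours of `v` were greater, the greater one of two incomparable neighbours would have
been processed already, and `pair_of` would have a pair recorded for `v`. -/
lemma Inv.exists_smaller (hc : NonChain G rk v) (hp : s.arr aPX v = 0) :
    ∃ y, G.Adj v y ∧ rk y < rk v := by
  rcases hc with hc | ⟨a, b, ha, hb, hab⟩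
  · exact hc
  by_contra hno
  push Not at hno
  have key : ∀ a b, G.Adj v a → G.Adj v b → ¬ DomComparable G a b → rk b < rk a → False := by
    intro a b ha hb hab hlt
    have hva : rk v < rk a := lt_of_le_of_ne (hno a ha) fun heq =>
      ha.ne (H.inj v hv a (H.lt _ _ ha.symm) heq)
    exact h.pair_of v a b ha hb hva hlt hva (fun hd => hab (Or.inl hd)) hp
  rcases lt_trichotomy (rk a) (rk b) with hlt | heq | hlt
  · exact key b a hb ha (fun hd => hab hd.symm) hlt
  · obtain rfl := H.inj a (H.lt _ _ ha.symm) b (H.lt _ _ hb.symm) heq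
    exact hab (Or.inl (Dominates.refl G a))
  · exact key a b ha hb hab hlt

/-- A test in constant time. The counter includes rank `rk v` itself, which is harmless since only
`v` has that rank and `v` is not its own neighbour. -/
lemma Inv.not_nonChain_iff :
    ¬ NonChain G rk v ↔ s.arr aPX v = 0 ∧ s.arr aBelow v = 0 := by
  have hb : s.arr aBelow v = 0 ↔ ∀ y, G.Adj v y → ¬ rk y < rk v := by
    rw [h.below v hv, List.length_eq_zero_iff, List.filter_eq_nil_iff]
    simp only [H.mem, decide_eq_true_eq, Nat.lt_succ_iff, not_le, not_lt]
    exact forall₂_congr fun y hy => ⟨fun hlt => hlt.le, fun hle => lt_of_le_of_ne hle fun heq =>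
      hy.ne (H.inj v hv y (H.lt _ _ hy.symm) heq)⟩
  rw [hb]
  constructor
  · intro hc
    exact ⟨by_contra fun hp => hc (h.nonChain_of_pair hv hp),
      fun y hy hlt => hc (Or.inl ⟨y, hy, hlt⟩)⟩
  · rintro ⟨hp, hno⟩ hc
    obtain ⟨y, hy, hlt⟩ := h.exists_smaller H hv hc hp
    exact hno y hy hlt

/-- Soundness holds for every `v`; completeness may fail if the neighbours of `v` are greater and
form a chain. -/
lemma Inv.mem_tailList {m : ℕ} (hm : m ∈ tailList L D s v) :
    m < n ∧ rk v < rk m ∧ Dominates G m v := by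
  unfold tailList at hm
  split_ifs at hm with hz
  · have := (h.mem_list v hv m).mp hm
    exact ⟨this.2.1, this.2.2.1, this.2.2.2.1⟩
  · obtain ⟨y, hy⟩ := Nat.exists_eq_succ_of_ne_zero hz
    obtain ⟨hyn, hvy, hd, hp, -⟩ := h.next_pos v hv y hy
    rw [hy, Nat.succ_sub_one] at hm
    obtain ⟨h1, h2, h3⟩ := (h.mem_dlist y hyn hvy (h.nonChain_of_pair hyn hp) m).mp hm
    exact ⟨h1, by omega, h3.trans hd⟩

lemma Inv.tailList_sorted : (tailList L D s v).Pairwise fun a b => rk a < rk b := by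
  unfold tailList
  split_ifs with hz
  · exact h.list_sorted v hv
  · obtain ⟨y, hy⟩ := Nat.exists_eq_succ_of_ne_zero hz
    obtain ⟨hyn, hvy, hd, hp, -⟩ := h.next_pos v hv y hy
    rw [hy, Nat.succ_sub_one]
    exact h.dlist_sorted y hyn hvy (h.nonChain_of_pair hyn hp)

/-- Without a next dominator, every greater dominator lies above some neighbour of `v`, so it is in
`L v`. With next dominator `y`, it is `y` or a greater dominator of `y`, and the list of `y` is
complete. -/
lemma Inv.mem_tailList_of_nonChain (hc : NonChain G rk v) {x : ℕ} (hx : x < n)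
    (hvx : rk v < rk x) (hd : Dominates G x v) : x ∈ tailList L D s v := by
  unfold tailList
  split_ifs with hz
  · refine (h.mem_list v hv x).mpr ⟨hvx, hx, hvx, hd, ?_⟩
    by_cases hp : s.arr aPX v = 0
    · obtain ⟨y, hy, hlt⟩ := h.exists_smaller H hv hc hp
      exact ⟨y, hy, hlt.trans hvx⟩
    · exact h.next_last v hv hp hz x hvx hd
  · obtain ⟨y, hy⟩ := Nat.exists_eq_succ_of_ne_zero hz
    obtain ⟨hyn, hvy, hdy, hp, hall⟩ := h.next_pos v hv y hy
    rw [hy, Nat.succ_sub_one]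
    refine (h.mem_dlist y hyn hvy (h.nonChain_of_pair hyn hp) x).mpr ⟨hx, ?_⟩
    rcases hall x hvx hd with rfl | ⟨h1, h2⟩
    · exact ⟨le_rfl, Dominates.refl G x⟩
    · exact ⟨h1.le, h2⟩

/-- Twins must be found even if the list of `v` is incomplete. In that case the twin `x` has no
incomparable neighbours either, so it has a neighbour below itself and was entered in `L v`. -/
lemma Inv.mem_tailList_of_twin {x : ℕ} (hx : x < n) (hvx : rk v < rk x) (hc : NonChain G rk x)
    (hN : G.neighborSet v = G.neighborSet x) : x ∈ tailList L D s v := by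
  by_cases hcv : NonChain G rk v
  · exact h.mem_tailList_of_nonChain H hv hcv hx hvx hN.le
  · have hp := ((h.not_nonChain_iff H hv).mp hcv).1
    rw [tailList, if_pos (h.next_zero v hv hp)]
    refine (h.mem_list v hv x).mpr ⟨hvx, hx, hvx, hN.le, ?_⟩
    rcases hc with ⟨y, hy, hlt⟩ | ⟨a, b, ha, hb, hab⟩
    · exact ⟨y, hN.ge hy, hlt⟩
    · exact absurd (Or.inr ⟨a, b, hN.ge ha, hN.ge hb, hab⟩) hcv

lemma Inv.mem_cons_tailList (hc : NonChain G rk v) (x : ℕ) :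
    x ∈ v :: tailList L D s v ↔ x ∈ upDom n G rk v := by
  rw [List.mem_cons]
  constructor
  · rintro (rfl | hx)
    · exact mem_upDom_self hv
    · obtain ⟨h1, h2, h3⟩ := h.mem_tailList H hv hx
      exact ⟨h1, h2.le, h3⟩
  · rintro ⟨h1, h2, h3⟩
    rcases h2.eq_or_lt with heq | hlt
    · exact Or.inl (H.inj v hv x h1 heq).symm
    · exact Or.inr (h.mem_tailList_of_nonChain H hv hc h1 hlt h3)

lemma Inv.cons_tailList_sorted : (v :: tailList L D s v).Pairwise fun a b => rk a < rk b :=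
  List.pairwise_cons.mpr ⟨fun _ hm => (h.mem_tailList H hv hm).2.1, h.tailList_sorted H hv⟩

/-- The invariant for the flags of the vertices that are not output is maintained. -/
lemma Inv.skip_step {skip' : ℕ → ℕ}
    (hs : ∀ x < n, skip' x ≠ 0 ↔ s.arr aSkip x ≠ 0 ∨
      ((tailList L D s v).head? = some x ∧ (nb x).length = (nb v).length) ∨
      (x = v ∧ s.arr aPX v = 0 ∧ s.arr aBelow v = 0) ∨
      (x = v ∧ ∃ w ∈ nb v, rk v < rk w ∧ (tailList L D s v).length + 1 = (nb w).length ∧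
        (D w).length = (nb v).length)) {x : ℕ} (hx : x < n) (hvx : rk v ≤ rk x) :
    skip' x ≠ 0 ↔ ¬ NonChain G rk x ∨ Crossed n G rk x ∨
      ∃ w < n, rk v ≤ rk w ∧ rk w < rk x ∧ G.neighborSet w = G.neighborSet x := by
  rw [hs x hx]
  by_cases hxv : x = v
  · subst hxv
    have h0 : s.arr aSkip x = 0 := h.skip_zero x hx (Nat.lt_succ_self _)
    have hhead : (tailList L D s x).head? ≠ some x := fun hh =>
      lt_irrefl _ (h.mem_tailList H hv (List.mem_of_head? hh)).2.1
    have h3 : ¬ ∃ w < n, rk x ≤ rk w ∧ rk w < rk x ∧ G.neighborSet w = G.neighborSet x := by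
      rintro ⟨w, -, h1, h2, -⟩; omega
    by_cases hc : NonChain G rk x
    · have hpb : ¬ (s.arr aPX x = 0 ∧ s.arr aBelow x = 0) := fun hpb =>
        (h.not_nonChain_iff H hv).mpr hpb hc
      have hcross : (∃ w ∈ nb x, rk x < rk w ∧
          (tailList L D s x).length + 1 = (nb w).length ∧ (D w).length = (nb x).length) ↔
          Crossed n G rk x := by
        refine exists_congr fun w => ?_
        rw [H.mem]
        refine and_congr_right fun hw => and_congr_right fun hlt => ?_
        have hwn := H.lt _ _ hw.symm
        -- The smaller neighbour `x` of `w` guarantees that the list of `w` is complete, so its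
        -- length is meaningful.
        have hcw : NonChain G rk w := Or.inl ⟨x, hw.symm, hlt⟩
        rw [H.upDom_eq_iff (h.cons_tailList_sorted H hv) (h.mem_cons_tailList H hv hc) hw,
          H.upDom_eq_iff (h.dlist_sorted w hwn hlt hcw) (h.mem_dlist w hwn hlt hcw) hw.symm]
        rfl
      simp only [h0, ne_eq, not_true, false_or, hhead, false_and, hpb, and_false, true_and, h3,
        or_false, hc, hcross]
    · have hpb := (h.not_nonChain_iff H hv).mp hc
      simp [hpb, hc]
  · have hlt : rk v < rk x := lt_of_le_of_ne hvx fun heq => hxv (H.inj v hv x hx heq).symm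
    rw [h.skip x hx hlt]
    simp only [hxv, false_and, or_false]
    by_cases hc : NonChain G rk x
    · simp only [hc, not_true, false_or, or_assoc]
      refine or_congr_right ⟨?_, ?_⟩
      · rintro (⟨w, h1, h2, h3⟩ | ⟨hh, hl⟩)
        · exact ⟨w, h1, by omega, h3⟩
        · exact ⟨v, hv, le_rfl, hlt, H.neighborSet_eq_of_dominates
            (h.mem_tailList H hv (List.mem_of_head? hh)).2.2 hl.le⟩
      · rintro ⟨w, h1, h2, h3, h4⟩
        rcases h2.eq_or_lt with heq | hlt'
        · obtain rfl := H.inj v hv w h1 heq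
          have hmem := h.mem_tailList_of_twin H hv hx hlt hc h4
          rcases hT : tailList L D s v with _ | ⟨m, T⟩
          · simp [hT] at hmem
          · obtain ⟨m1, m2, m3⟩ := h.mem_tailList H hv (m := m) (by simp [hT])
            -- Only the head of the list is examined. If the head `m` is not `x`, its degree lies
            -- between the equal degrees of `v` and `x`; then `m` is a twin of `x` and witnesses
            -- that `x` has been flagged before.
            by_cases hmx : m = x
            · exact Or.inr ⟨by simp [hmx], (H.length_eq h4).symm⟩
            · left
              have hsort := h.tailList_sorted H hv
              rw [hT] at hsort hmem
              have hmx' : rk m < rk x := (List.pairwise_cons.mp hsort).1 x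
                ((List.mem_cons.mp hmem).resolve_left (Ne.symm hmx))
              refine ⟨m, m1, m2, hmx', ?_⟩
              rw [← h4]
              exact (H.neighborSet_eq_of_dominates m3
                ((H.deg m m1 x hx hmx').trans (H.length_eq h4).ge)).symm
        · exact Or.inl ⟨w, h1, hlt', h3, h4⟩
    · simp [hc]

end Round

end Dominators

/-! ### The main loop -/

section MainLoop

open ArrCmd ArrExpr ArrState

variable {n : ℕ} {nb : ℕ → List ℕ} {L D : ℕ → List ℕ} {s : ArrState} {v : ℕ}

/-- The graph that the state contains. -/
structure HasGraph (n : ℕ) (nb : ℕ → List ℕ) (s : ArrState) : Prop where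
  adj : Lists aV1 aN1 aAH aAL rF1 s nb
  zero : s.inp 0 = n
  deg : ∀ x < n, s.inp (x + 1) = (nb x).length

lemma HasGraph.frame {s' : ArrState} {c : ArrCmd} (h : HasGraph n nb s) (hF : Frame c s s')
    (hc : (c.writesArr aV1 || c.writesArr aN1 || c.writesArr aAH || c.writesArr aAL ||
      c.writesReg rF1) = false) : HasGraph n nb s' := by
  simp only [Bool.or_eq_false_iff] at hc
  obtain ⟨⟨⟨⟨h1, h2⟩, h3⟩, h4⟩, h5⟩ := hc
  exact ⟨h.adj.congr (hF.arr _ h1) (hF.arr _ h2) (hF.arr _ h3) (hF.arr _ h4) (hF.reg _ h5),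
    by rw [hF.inp, h.zero], by rw [hF.inp]; exact h.deg⟩

lemma HasGraph.setReg {x k : ℕ} (h : HasGraph n nb s) (hx : x ≠ rF1) :
    HasGraph n nb (s.setReg x k) :=
  ⟨h.adj.congr rfl rfl rfl rfl (by rw [setReg_reg, if_neg hx.symm]), h.zero, h.deg⟩

/-- Form the list of the dominators of `rV` of greater or equal rank. -/
def tailCode : ArrCmd :=
  .seq (.store aDone (.var rV) (.lit 1)) <|
  .seq (.ifEq (.arr aNext (.var rV)) (.lit 0)
    (.seq (.assign rTl (.arr aLH (.var rV))) (.assign rLn (.arr aLL (.var rV))))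
    (.seq (.assign rTl (.arr aDH (.sub (.arr aNext (.var rV)) (.lit 1))))
      (.assign rLn (.arr aSz (.sub (.arr aNext (.var rV)) (.lit 1)))))) <|
  .seq (.store aDH (.var rV) (.var rTl)) <| .seq (.store aSz (.var rV) (.var rLn)) <|
    push aV2 aN2 aDH aSz rF2 rV rV

/-- The new list is one cell in front of an existing list, so its construction takes constant time
and space regardless of its length. -/
lemma tailCode_spec (hv : s.reg rV = v) (hL : Lists aV2 aN2 aLH aLL rF2 s L)
    (hD : Lists aV2 aN2 aDH aSz rF2 s D) :
    (Lists aV2 aN2 aLH aLL rF2 (tailCode.eval s) L ∧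
      Lists aV2 aN2 aDH aSz rF2 (tailCode.eval s) (Function.update D v (v :: tailList L D s v)) ∧
      (tailCode.eval s).arr aDone = Function.update (s.arr aDone) v 1 ∧
      (tailCode.eval s).reg rLn = (tailList L D s v).length ∧
      ∀ m T, tailList L D s v = m :: T →
        (tailCode.eval s).arr aV2 ((tailCode.eval s).reg rTl) = m) ∧
    tailCode.cost s ≤ 50 := by
  obtain ⟨tl, ln, htl, hT, hev⟩ : ∃ tl ln, tl ≤ s.reg rF2 ∧
      chain (s.arr aV2) (s.arr aN2) ln tl = tailList L D s v ∧
      tailCode.eval s = (push aV2 aN2 aDH aSz rF2 rV rV).eval (((((s.setArr aDone v 1).setReg rTl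
        tl).setReg rLn ln).setArr aDH v tl).setArr aSz v ln) := by
    by_cases hz : s.arr aNext v = 0
    · refine ⟨s.arr aLH v, s.arr aLL v, hL.hd_le v, ?_, ?_⟩
      · rw [tailList, if_pos hz]; exact hL.eq v
      · simp [tailCode, setReg_reg, setArr_arr, hv, hz]
    · refine ⟨s.arr aDH (s.arr aNext v - 1), s.arr aSz (s.arr aNext v - 1), hD.hd_le _, ?_, ?_⟩
      · rw [tailList, if_neg hz]; exact hD.eq _
      · simp [tailCode, setReg_reg, setArr_arr, hv, hz]
  set s₁ := ((((s.setArr aDone v 1).setReg rTl tl).setReg rLn ln).setArr aDH v tl).setArr aSz v ln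
    with hs₁
  have hlen : ln = (tailList L D s v).length := by rw [← hT, chain_length]
  have hd4 : [aV2, aN2, aDH, aSz].Nodup := by decide
  have hfc : rV ≠ rF2 ∧ rV ≠ rF2 := by decide
  have hV : s₁.arr aV2 = s.arr aV2 := by simp [hs₁, setArr_arr]
  have hN : s₁.arr aN2 = s.arr aN2 := by simp [hs₁, setArr_arr]
  have hF2 : s₁.reg rF2 = s.reg rF2 := by simp [hs₁, setReg_reg]
  have hrV : s₁.reg rV = v := by simp [hs₁, setReg_reg, hv]
  have hDH : s₁.arr aDH = Function.update (s.arr aDH) v tl := by simp [hs₁, setArr_arr]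
  have hSz : s₁.arr aSz = Function.update (s.arr aSz) v ln := by simp [hs₁, setArr_arr]
  have hL₁ : Lists aV2 aN2 aLH aLL rF2 s₁ L :=
    hL.congr hV hN (by simp [hs₁, setArr_arr]) (by simp [hs₁, setArr_arr]) hF2
  have hD₁ : Lists aV2 aN2 aDH aSz rF2 s₁ (Function.update D v (tailList L D s v)) := by
    refine ⟨by rw [hN]; exact hD.nx_le, fun q => ?_, fun q => ?_⟩
    · rw [hDH, hF2, Function.update_apply]
      split_ifs
      exacts [htl, hD.hd_le q]
    · rw [hDH, hSz, hV, hN]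
      simp only [Function.update_apply]
      split_ifs
      exacts [hT, hD.eq q]
  have hpush := hD₁.push (q := rV) (a := rV) hd4 hfc
  rw [hrV, Function.update_idem, Function.update_self] at hpush
  rw [hev]
  refine ⟨⟨hL₁.push_other hd4 hfc hD₁.hd_le (by decide), hpush, ?_, ?_, ?_⟩, ?_⟩
  · rw [push_arr hd4 hfc]
    simp [hs₁, setArr_arr]
  · rw [push_reg, if_neg (by decide)]
    simp [hs₁, setReg_reg, hlen]
  · intro m T hmT
    have hch := push_chain (q := rV) (a := rV) (c := tl) hd4 hfc hL₁.nx_le ln (by rw [hF2]; exact htl)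
    rw [hV, hN, hT, hmT, hlen, hmT, List.length_cons, chain] at hch
    have hrT : ((push aV2 aN2 aDH aSz rF2 rV rV).eval s₁).reg rTl = tl := by
      rw [push_reg, if_neg (by decide)]; simp [hs₁, setReg_reg]
    rw [hrT]
    exact (List.cons.inj hch).1
  · simp only [tailCode, cost_seq, cost_store, cost_ifEq, cost_assign, push_cost, size_var, size_lit,
      size_arr, size_sub]
    split_ifs <;> omega

/-- Do not output the next dominator of `rV` if it has the same neighbourhood. -/
def twinCode : ArrCmd :=
  .ifEq (.var rLn) (.lit 0) .skip <| .seq (.assign rM (.arr aV2 (.var rTl))) <|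
    .ifEq (.inp (.succ (.var rM))) (.inp (.succ (.var rV))) (.store aSkip (.var rM) (.lit 1)) .skip

lemma twinCode_spec {T : List ℕ} (hv : s.reg rV = v) (hln : s.reg rLn = T.length)
    (hT : ∀ m T', T = m :: T' → s.arr aV2 (s.reg rTl) = m) :
    (∀ x, (twinCode.eval s).arr aSkip x =
      if T.head? = some x ∧ s.inp (x + 1) = s.inp (v + 1) then 1 else s.arr aSkip x) ∧
    twinCode.cost s ≤ 20 := by
  constructor
  · intro x
    rcases T with _ | ⟨m, T⟩
    · simp [twinCode, hln]
    · have hm := hT m T rfl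
      have hne : s.reg rLn ≠ 0 := by rw [hln]; simp
      by_cases hd : s.inp (m + 1) = s.inp (v + 1)
      · simp only [twinCode, eval_ifEq, val_var, val_lit, hne, if_false, eval_seq, eval_assign,
          val_arr, hm, val_inp, val_succ, setReg_reg, if_true, setReg_inp,
          show rV ≠ rM by decide, hv, hd, eval_store, setArr_arr, setReg_arr, List.head?_cons,
          Option.some.injEq, Function.update_apply]
        by_cases hx : x = m
        · simp [hx, hd]
        · simp [hx, Ne.symm hx]
      · simp only [twinCode, eval_ifEq, val_var, val_lit, hne, if_false, eval_seq, eval_assign,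
          val_arr, hm, val_inp, val_succ, setReg_reg, if_true, setReg_inp,
          show rV ≠ rM by decide, hv, hd, eval_skip, setReg_arr, List.head?_cons,
          Option.some.injEq]
        rw [if_neg]
        rintro ⟨rfl, h⟩
        exact hd h
  · simp only [twinCode, cost_seq, cost_store, cost_ifEq, cost_assign, cost_skip, size_var, size_lit,
      size_arr, size_inp, size_succ]
    split_ifs <;> omega

/-- Do not output `rV` if its neighbours form a chain and have greater ranks. -/
def chainCode : ArrCmd :=
  .ifEq (.arr aPX (.var rV)) (.lit 0)
    (.ifEq (.arr aBelow (.var rV)) (.lit 0) (.store aSkip (.var rV) (.lit 1)) .skip) .skip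

lemma chainCode_spec (hv : s.reg rV = v) :
    (∀ x, (chainCode.eval s).arr aSkip x =
      if x = v ∧ s.arr aPX v = 0 ∧ s.arr aBelow v = 0 then 1 else s.arr aSkip x) ∧
    chainCode.cost s ≤ 20 := by
  constructor
  · intro x
    simp only [chainCode, eval_ifEq, val_arr, val_var, val_lit, hv]
    split_ifs <;> simp_all [setArr_arr]
  · simp only [chainCode, cost_store, cost_ifEq, cost_skip, size_var, size_lit, size_arr]
    split_ifs <;> omega

/-- Mark the neighbour `rW` of `rV`, and compare the bicliques of the two vertices. -/
def scanBody : ArrCmd :=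
  .seq (.store aMark (.var rW) (.succ (.var rV))) <|
  .seq (.store aBelow (.var rW) (.sub (.arr aBelow (.var rW)) (.lit 1))) <|
  .ifEq (.arr aDone (.var rW)) (.lit 1)
    (.ifEq (.arr aSz (.var rV)) (.inp (.succ (.var rW)))
      (.ifEq (.arr aSz (.var rW)) (.inp (.succ (.var rV)))
        (.store aSkip (.var rV) (.lit 1)) .skip) .skip) .skip

def scanCode : ArrCmd := each rW rC2 rI2 aV1 aN1 aAH aAL rV scanBody

lemma scanBody_spec {w : ℕ} (hv : s.reg rV = v) (hw : s.reg rW = w) :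
    ((scanBody.eval s).arr aMark = Function.update (s.arr aMark) w (v + 1) ∧
      (scanBody.eval s).arr aBelow = Function.update (s.arr aBelow) w (s.arr aBelow w - 1) ∧
      ∀ x, (scanBody.eval s).arr aSkip x = if x = v ∧ s.arr aDone w = 1 ∧
        s.arr aSz v = s.inp (w + 1) ∧ s.arr aSz w = s.inp (v + 1) then 1 else s.arr aSkip x) ∧
    scanBody.cost s ≤ 50 := by
  refine ⟨⟨?_, ?_, fun x => ?_⟩, ?_⟩
  · simp only [scanBody, eval_seq, eval_store, eval_ifEq, val_var, val_succ, val_sub, val_arr,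
      val_lit, val_inp, setArr_reg, setArr_inp, setArr_arr, hv, hw]
    split_ifs <;> simp_all [setArr_arr]
  · simp only [scanBody, eval_seq, eval_store, eval_ifEq, val_var, val_succ, val_sub, val_arr,
      val_lit, val_inp, setArr_reg, setArr_inp, setArr_arr, hv, hw]
    split_ifs <;> simp_all [setArr_arr]
  · simp only [scanBody, eval_seq, eval_store, eval_ifEq, val_var, val_succ, val_sub, val_arr,
      val_lit, val_inp, setArr_reg, setArr_inp, setArr_arr, hv, hw]
    split_ifs <;> simp_all [setArr_arr]
  · simp only [scanBody, cost_seq, cost_store, cost_ifEq, cost_skip, size_var, size_lit, size_arr,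
      size_inp, size_succ, size_sub]
    split_ifs <;> omega

lemma scanCode_spec (hg : HasGraph n nb s) (hnd : (nb v).Nodup) (hv : s.reg rV = v) :
    ((∀ x, (scanCode.eval s).arr aMark x = if x ∈ nb v then v + 1 else s.arr aMark x) ∧
      (∀ x, (scanCode.eval s).arr aBelow x =
        if x ∈ nb v then s.arr aBelow x - 1 else s.arr aBelow x) ∧
      ∀ x, ((scanCode.eval s).arr aSkip x ≠ 0 ↔ s.arr aSkip x ≠ 0 ∨ (x = v ∧ ∃ w ∈ nb v,
        s.arr aDone w = 1 ∧ s.arr aSz v = s.inp (w + 1) ∧ s.arr aSz w = s.inp (v + 1)))) ∧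
    scanCode.cost s ≤ 6 + 57 * (nb v).length := by
  have key := each_spec (x := rW) (cur := rC2) (i := rI2) (val := aV1) (nx := aN1) (hd := aAH)
    (len := aAL) (q := rV) (body := scanBody) (s := s) (l := nb v) (by rw [hv]; exact hg.adj.eq v)
    (by decide)
    (fun pre s' => (∀ x, s'.arr aMark x = if x ∈ pre then v + 1 else s.arr aMark x) ∧
      (∀ x, s'.arr aBelow x = if x ∈ pre then s.arr aBelow x - 1 else s.arr aBelow x) ∧
      ∀ x, (s'.arr aSkip x ≠ 0 ↔ s.arr aSkip x ≠ 0 ∨ (x = v ∧ ∃ w ∈ pre,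
        s.arr aDone w = 1 ∧ s.arr aSz v = s.inp (w + 1) ∧ s.arr aSz w = s.inp (v + 1))))
    (fun _ => 50) (fun _ _ _ _ _ h => h) (by simp) (by
      rintro pre a suf s' hl hF ⟨h1, h2, h3⟩ ha
      have hrv : s'.reg rV = v := by rw [hF.reg rV (by decide), hv]
      obtain ⟨⟨b1, b2, b3⟩, b4⟩ := scanBody_spec hrv ha
      -- No neighbour is visited twice, so its counter decreases exactly by one.
      have hna : a ∉ pre := by
        rw [hl] at hnd
        exact fun hmem => (List.nodup_append.mp hnd).2.2 a hmem a (by simp) rfl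
      refine ⟨⟨fun x => ?_, fun x => ?_, fun x => ?_⟩, b4⟩
      · rw [b1, Function.update_apply, h1]
        by_cases hx : x = a <;> simp [hx]
      · rw [b2, Function.update_apply, h2, h2]
        by_cases hx : x = a
        · simp [hx, hna]
        · simp [hx]
      · rw [b3, hF.arr aDone (by decide), hF.arr aSz (by decide), hF.inp]
        simp only [List.mem_append, List.mem_singleton, or_and_right, exists_or, exists_eq_left]
        split_ifs with hc
        · simp [hc]
        · rw [h3]
          by_cases hx : x = v
          · have : ¬ (s.arr aDone a = 1 ∧ s.arr aSz v = s.inp (a + 1) ∧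
              s.arr aSz a = s.inp (v + 1)) := fun h => hc ⟨hx, h⟩
            simp [hx, this]
          · simp [hx])
  refine ⟨key.1, key.2.trans ?_⟩
  simp
  omega

end MainLoop

/-! ### The squares of a round -/

section Squares

open ArrCmd ArrExpr ArrState

/-- Run `body` for the neighbours `rU` of `rV` that are not done and for all neighbours `rW` of
`rU`. -/
def squares (body : ArrCmd) : ArrCmd :=
  each rU rC1 rI1 aV1 aN1 aAH aAL rV (.ifEq (.arr aDone (.var rU)) (.lit 0)
    (each rW rC2 rI2 aV1 aN1 aAH aAL rU body) .skip)

variable {n : ℕ} {G : SimpleGraph ℕ} {nb : ℕ → List ℕ} {rk : ℕ → ℕ} {s : ArrState} {v : ℕ}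

/-- The number of the squares that are looked at for the neighbour `u` of `v`. -/
def lowLength (nb : ℕ → List ℕ) (rk : ℕ → ℕ) (v u : ℕ) : ℕ :=
  if rk u < rk v then (nb u).length else 0

/-- The pairs for which `squares` runs its body. -/
def IsLowPath (G : SimpleGraph ℕ) (rk : ℕ → ℕ) (v u w : ℕ) : Prop :=
  G.Adj v u ∧ rk u < rk v ∧ G.Adj u w

/-- The relation `R` contains the pairs handled so far. Adjacency lists decrease in rank, so when
`u` is reached all pairs with a greater first member are in `R`; the links depend on this. A vertex
`u` below `v` costs its degree, and the others are passed over in constant time, which leads to the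
sum bounded by `sum_low_degree_le`. -/
lemma squares_spec {body : ArrCmd} (H : IsSorted n G nb rk) (hg : HasGraph n nb s)
    (hv : s.reg rV = v) (hdone : ∀ x < n, s.arr aDone x = if rk v ≤ rk x then 1 else 0)
    (hbody : (body.writesArr aV1 || body.writesArr aN1 || body.writesArr aAH ||
      body.writesArr aAL || body.writesReg rF1 || body.writesReg rU || body.writesReg rV ||
      body.writesReg rC1 || body.writesReg rC2 || body.writesArr aDone) = false)
    (P : (ℕ → ℕ → Prop) → ArrState → Prop) (K : ℕ)
    (hP : ∀ R s r k, r ∈ [rU, rW, rC1, rC2, rI1, rI2] → P R s → P R (s.setReg r k))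
    (h0 : P (fun _ _ => False) s)
    (hstep : ∀ R u w s', Frame (squares body) s s' → s'.reg rU = u → s'.reg rW = w →
      IsLowPath G rk v u w → ¬ R u w →
      (∀ u' w', R u' w' → IsLowPath G rk v u' w' ∧ rk u ≤ rk u') →
      (∀ u' w', IsLowPath G rk v u' w' → rk u < rk u' → R u' w') → P R s' →
      P (fun a b => R a b ∨ a = u ∧ b = w) (body.eval s') ∧ body.cost s' ≤ K) :
    P (IsLowPath G rk v) ((squares body).eval s) ∧
      (squares body).cost s ≤ 6 + ((nb v).map fun u => 18 + (7 + K) * lowLength nb rk v u).sum := by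
  simp only [Bool.or_eq_false_iff] at hbody
  obtain ⟨⟨⟨⟨⟨⟨⟨⟨⟨b1, b2⟩, b3⟩, b4⟩, b5⟩, b6⟩, b7⟩, b8⟩, b9⟩, b10⟩ := hbody
  have key := each_spec (x := rU) (cur := rC1) (i := rI1) (val := aV1) (nx := aN1) (hd := aAH)
    (len := aAL) (q := rV) (body := .ifEq (.arr aDone (.var rU)) (.lit 0)
      (each rW rC2 rI2 aV1 aN1 aAH aAL rU body) .skip) (s := s) (l := nb v)
    (by rw [hv]; exact hg.adj.eq v)
    (by simp [each, writesReg, writesArr, b1, b2, b8])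
    (fun pre s' => P (fun a b => a ∈ pre ∧ IsLowPath G rk v a b) s')
    (fun u => 11 + (7 + K) * lowLength nb rk v u)
    (fun pre s r k hr h => hP _ _ _ _ (by
      rcases hr with rfl | rfl | rfl <;> simp) h) (by simpa using h0) (by
      rintro pre u suf s' hl hF hPs hu
      have hsorted := H.sorted v
      rw [hl] at hsorted
      have hvu : G.Adj v u := (H.mem v u).mp (by simp [hl])
      have hdu : s'.arr aDone u = if rk v ≤ rk u then 1 else 0 := by
        rw [hF.arr aDone (by simp [each, writesArr, b10]), hdone u (H.lt _ _ hvu.symm)]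
      simp only [eval_ifEq, val_arr, val_var, val_lit, hu, hdu, cost_ifEq, size_arr, size_var,
        size_lit]
      by_cases hlt : rk v ≤ rk u
      · simp only [hlt, if_true, one_ne_zero, if_false, eval_skip, cost_skip]
        refine ⟨?_, by omega⟩
        convert hPs using 3 with a b
        simp only [List.mem_append, List.mem_singleton]
        refine ⟨?_, fun h => ⟨Or.inl h.1, h.2⟩⟩
        rintro ⟨h | rfl, h'⟩
        · exact ⟨h, h'⟩
        · exact absurd h'.2.1 (by omega)
      · simp only [hlt, if_false, if_true]
        have hpre : ∀ a ∈ pre, rk u < rk a := fun a ha =>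
          (List.pairwise_append.mp hsorted).2.2 a ha u (by simp)
        have hsuf : ∀ a ∈ suf, rk a < rk u := fun a ha =>
          (List.pairwise_cons.mp (List.pairwise_append.mp hsorted).2.1).1 a ha
        have hchain : chain (s'.arr aV1) (s'.arr aN1) (s'.arr aAL (s'.reg rU))
            (s'.arr aAH (s'.reg rU)) = nb u := by
          rw [hF.arr aV1 (by simp [each, writesArr, b1]), hF.arr aN1 (by simp [each, writesArr, b2]),
            hF.arr aAL (by simp [each, writesArr, b4]), hF.arr aAH (by simp [each, writesArr, b3]),
            hu]
          exact hg.adj.eq u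
        have inner := each_spec (x := rW) (cur := rC2) (i := rI2) (val := aV1) (nx := aN1)
          (hd := aAH) (len := aAL) (q := rU) (body := body) (s := s') (l := nb u) hchain
          (by simp [b1, b2, b9])
          (fun pre' s'' => P (fun a b => (a ∈ pre ∧ IsLowPath G rk v a b) ∨ a = u ∧ b ∈ pre') s'')
          (fun _ => K) (fun _ s r k hr h => hP _ _ _ _ (by
            rcases hr with rfl | rfl | rfl <;> simp) h) (by simpa using hPs) (by
            rintro pre' w suf' s'' hl' hF' hPs' hw
            have hFF : Frame (squares body) s s'' := hF.trans (hF'.weaken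
              (by simp +contextual [each, writesReg])
              (by simp +contextual [each, writesArr])
              (by simp +contextual [each, emits]))
            have huw : G.Adj u w := (H.mem u w).mp (by simp [hl'])
            have hup : u ∉ pre := fun hm => lt_irrefl _ (hpre u hm)
            have hnd := H.nodup u
            rw [hl'] at hnd
            have hwp : w ∉ pre' := fun hm => (List.nodup_append.mp hnd).2.2 w hm w (by simp) rfl
            have := hstep _ u w s'' hFF
              (by rw [hF'.reg rU (by simp [each, writesReg, b6]), hu]) hw
              ⟨hvu, by omega, huw⟩ (by simp [hup, hwp]) (by
                rintro u' w' (⟨h1, h2⟩ | ⟨rfl, h1⟩)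
                · exact ⟨h2, (hpre _ h1).le⟩
                · exact ⟨⟨hvu, by omega, (H.mem _ w').mp (by simp [hl', h1])⟩, le_rfl⟩) (by
                intro u' w' h1 h2
                refine Or.inl ⟨?_, h1⟩
                have hm : u' ∈ nb v := (H.mem v u').mpr h1.1
                rw [hl, List.mem_append, List.mem_cons] at hm
                rcases hm with hm | rfl | hm
                · exact hm
                · exact absurd h2 (lt_irrefl _)
                · exact absurd (hsuf _ hm) (by omega)) hPs'
            refine ⟨?_, this.2⟩
            convert this.1 using 3 with a b
            simp only [List.mem_append, List.mem_singleton]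
            tauto)
        refine ⟨?_, ?_⟩
        · convert inner.1 using 3 with a b
          simp only [List.mem_append, List.mem_singleton, H.mem]
          constructor
          · rintro ⟨h | rfl, h'⟩
            · exact Or.inl ⟨h, h'⟩
            · exact Or.inr ⟨rfl, h'.2.2⟩
          · rintro (⟨h, h'⟩ | ⟨rfl, h⟩)
            · exact ⟨Or.inl h, h'⟩
            · exact ⟨Or.inr rfl, hvu, by omega, h⟩
        · refine (Nat.add_le_add_left inner.2 _).trans ?_
          rw [lowLength, if_pos (by omega)]
          simp [mul_comm]
          omega)
  refine ⟨?_, ?_⟩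
  · have heq : (fun a b => a ∈ nb v ∧ IsLowPath G rk v a b) = IsLowPath G rk v := by
      funext a b
      rw [H.mem]
      exact propext ⟨fun h => h.2, fun h => ⟨h.1, h⟩⟩
    rw [← heq]
    exact key.1
  · refine key.2.trans (le_of_eq ?_)
    congr 3
    funext u
    omega

def clearCode : ArrCmd := squares <| .seq (.store aCnt (.var rW) (.lit 0)) <|
  .seq (.store aLast (.var rW) (.lit 0)) <| .store aAdded (.var rW) (.lit 0)

/-- Only entries that the round will read are reset. Resetting whole arrays would take `n` steps per
round. -/
lemma clearCode_spec (H : IsSorted n G nb rk) (hg : HasGraph n nb s)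
    (hv : s.reg rV = v) (hdone : ∀ x < n, s.arr aDone x = if rk v ≤ rk x then 1 else 0) :
    (∀ u w, IsLowPath G rk v u w → (clearCode.eval s).arr aCnt w = 0 ∧
      (clearCode.eval s).arr aLast w = 0 ∧ (clearCode.eval s).arr aAdded w = 0) ∧
    clearCode.cost s ≤ 6 + ((nb v).map fun u => 18 + 16 * lowLength nb rk v u).sum := by
  refine squares_spec H hg hv hdone (by decide)
    (fun R s => ∀ u w, R u w → s.arr aCnt w = 0 ∧ s.arr aLast w = 0 ∧ s.arr aAdded w = 0) 9
    (fun _ _ _ _ _ h => h) (fun _ _ h => h.elim) ?_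
  intro R u w s' hF hu hw _ _ _ _ hP
  refine ⟨fun a b hab => ?_, by simp⟩
  simp only [eval_seq, eval_store, val_var, val_lit, setArr_reg, setArr_arr, hw]
  by_cases hb : b = w
  · simp [hb]
  · obtain h := hP a b (hab.resolve_right fun h => hb h.2)
    simpa [hb] using h

def countCode : ArrCmd := squares <| .store aCnt (.var rW) (.succ (.arr aCnt (.var rW)))

lemma countP_or_eq {l : List ℕ} (hl : l.Nodup) {p q : ℕ → Bool} {a : ℕ} (ha : a ∈ l)
    (hp : p a = false) (hq : ∀ x, q x = (p x || x == a)) : l.countP q = l.countP p + 1 := by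
  induction l with
  | nil => simp at ha
  | cons y l ih =>
    rw [List.nodup_cons] at hl
    rw [List.countP_cons, List.countP_cons, hq y]
    rcases List.mem_cons.mp ha with rfl | h
    · have : l.countP q = l.countP p := List.countP_congr fun x hx => by
        rw [hq x]
        have : x ≠ a := fun h => hl.1 (h ▸ hx)
        simp [this]
      simp [this, hp]
    · have : y ≠ a := fun h' => hl.1 (h' ▸ h)
      rw [ih hl.2 h]
      simp [this]
      omega

open Classical in
lemma countCode_spec (H : IsSorted n G nb rk) (hg : HasGraph n nb s)
    (hv : s.reg rV = v) (hdone : ∀ x < n, s.arr aDone x = if rk v ≤ rk x then 1 else 0) :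
    (∀ w, (countCode.eval s).arr aCnt w = s.arr aCnt w +
      (nb v).countP fun u => decide (IsLowPath G rk v u w)) ∧
    countCode.cost s ≤ 6 + ((nb v).map fun u => 18 + 12 * lowLength nb rk v u).sum := by
  refine squares_spec H hg hv hdone (by decide)
    (fun R s' => ∀ w, s'.arr aCnt w = s.arr aCnt w + (nb v).countP fun u => decide (R u w)) 5
    (fun _ _ _ _ _ h => h) (by simp) ?_
  intro R u w s' hF hu hw hlow hR _ _ hP
  refine ⟨fun x => ?_, by simp⟩
  simp only [eval_store, val_var, val_succ, val_arr, setArr_arr, hw, if_true]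
  by_cases hx : x = w
  · subst hx
    have hc := countP_or_eq (p := fun u => decide (R u x))
      (q := fun y => decide (R y x ∨ y = u ∧ x = x)) (a := u) (H.nodup v)
      ((H.mem v u).mpr hlow.1) (by simpa using hR) (by intro y; by_cases h : y = u <;> simp [h])
    rw [Function.update_self, hP, add_assoc, ← hc]
    exact congrArg _ (List.countP_congr fun y _ => by simp)
  · rw [Function.update_of_ne hx, hP]
    simp [hx]

/-- The common neighbours of `v` and `w` below `v` are among the neighbours of `w` below `v`, so
comparing two counters decides inclusion. -/
lemma countP_eq_iff (H : IsSorted n G nb rk) {w k : ℕ}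
    [DecidablePred fun u => IsLowPath G rk v u w]
    (hk : k = ((nb w).filter fun y => rk y < rk v).length) :
    ((nb v).countP fun u => decide (IsLowPath G rk v u w)) = k ↔
      ∀ x, G.Adj w x → rk x < rk v → G.Adj v x := by
  have h1 : ((nb v).countP fun u => decide (IsLowPath G rk v u w)) =
      ((nb v).toFinset.filter fun u => IsLowPath G rk v u w).card := by
    rw [List.countP_eq_length_filter, ← List.toFinset_card_of_nodup ((H.nodup v).filter _),
      List.toFinset_filter]
    simp
  have h2 : k = ((nb w).toFinset.filter fun u => rk u < rk v).card := by
    rw [hk, ← List.toFinset_card_of_nodup ((H.nodup w).filter _), List.toFinset_filter]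
    simp
  have hsub : ((nb v).toFinset.filter fun u => IsLowPath G rk v u w) ⊆
      ((nb w).toFinset.filter fun u => rk u < rk v) := by
    intro x
    simp only [Finset.mem_filter, List.mem_toFinset, H.mem]
    exact fun h => ⟨h.2.2.2.symm, h.2.2.1⟩
  rw [h1, h2]
  constructor
  · intro heq x hx hlt
    have := Finset.eq_of_subset_of_card_le hsub heq.ge
    have hm : x ∈ ((nb w).toFinset.filter fun u => rk u < rk v) := by simp [H.mem, hx, hlt]
    rw [← this] at hm
    simp only [Finset.mem_filter, List.mem_toFinset, H.mem] at hm
    exact hm.1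
  · intro hall
    congr 1
    refine hsub.antisymm fun x => ?_
    simp only [Finset.mem_filter, List.mem_toFinset, H.mem]
    exact fun h => ⟨hall x h.1 h.2, hall x h.1 h.2, h.2, h.1.symm⟩

end Squares

/-! ### The unsafe and the safe pairs of a round -/

section Pairs

open ArrCmd ArrExpr ArrState

variable {n : ℕ} {G : SimpleGraph ℕ} {nb : ℕ → List ℕ} {rk : ℕ → ℕ} {v : ℕ}

/-- `px` and `py` are pairs of incomparable neighbours, and `nx` contains next dominators. -/
structure Links (n : ℕ) (G : SimpleGraph ℕ) (rk px py nx : ℕ → ℕ) : Prop where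
  pair : ∀ x < n, px x ≠ 0 → ∃ a b, px x = a + 1 ∧ py x = b + 1 ∧
    G.Adj x a ∧ G.Adj x b ∧ ¬ DomComparable G a b
  next_zero : ∀ x < n, px x = 0 → nx x = 0
  next_pos : ∀ x < n, ∀ y, nx x = y + 1 → y < n ∧ rk x < rk y ∧ Dominates G y x ∧
    px y ≠ 0 ∧ ∀ z, rk x < rk z → Dominates G z x → z = y ∨ rk y < rk z ∧ Dominates G z y
  next_last : ∀ x < n, px x ≠ 0 → nx x = 0 → ∀ z, rk x < rk z →
    Dominates G z x → ∃ y, G.Adj x y ∧ rk y < rk z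

/-- The invariant for the arrays of the links, where `R` contains the pairs that have been
processed. -/
structure LinkInv (n : ℕ) (G : SimpleGraph ℕ) (rk : ℕ → ℕ) (v : ℕ) (px₀ py₀ : ℕ → ℕ)
    (R : ℕ → ℕ → Prop) (px py nx last : ℕ → ℕ) : Prop where
  links : Links n G rk px py nx
  last : ∀ x, rk x < rk v → ¬ Dominates G v x → (∃ u, IsLowPath G rk v u x) →
    (last x = 0 ∧ ∀ u, ¬ R u x) ∨ ∃ u, last x = u + 1 ∧ R u x ∧ ∀ u', R u' x → rk u ≤ rk u'
  set : ∀ u w, R u w → rk w < rk v → ¬ Dominates G v w → px u ≠ 0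
  mono : ∀ x, px₀ x ≠ 0 → px x ≠ 0
  fix : ∀ x, ¬ G.Adj v x → px x = px₀ x ∧ py x = py₀ x

variable {px₀ py₀ px py nx last : ℕ → ℕ} {R : ℕ → ℕ → Prop}

lemma LinkInv.of_iff {R' : ℕ → ℕ → Prop} (h : LinkInv n G rk v px₀ py₀ R px py nx last)
    (hR : ∀ u w, rk w < rk v → ¬ Dominates G v w → (R' u w ↔ R u w)) :
    LinkInv n G rk v px₀ py₀ R' px py nx last := by
  refine ⟨h.links, fun x h1 h2 h3 => ?_, fun u w hr h1 h2 => h.set u w ((hR u w h1 h2).mp hr) h1 h2,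
    h.mono, h.fix⟩
  simpa only [hR _ x h1 h2] using h.last x h1 h2 h3

/-- As `v` and `w` are incomparable, their common neighbours are pairwise comparable, and those
below `v` are met in decreasing rank. So the one met last before `u` is the next one above `u`. A
greater dominator of `u` is itself a common neighbour of `v` and `w`, hence it is this vertex or
lies above it in the same chain. -/
lemma LinkInv.step {u w : ℕ} (H : IsSorted n G nb rk)
    (h : LinkInv n G rk v px₀ py₀ R px py nx last) (hlow : IsLowPath G rk v u w) (hR : ¬ R u w)
    (hle : ∀ u' w', R u' w' → IsLowPath G rk v u' w' ∧ rk u ≤ rk u')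
    (hall : ∀ u' w', IsLowPath G rk v u' w' → rk u < rk u' → R u' w')
    (hwv : rk w < rk v) (hd : ¬ Dominates G v w) :
    LinkInv n G rk v px₀ py₀ (fun a b => R a b ∨ a = u ∧ b = w) (Function.update px u (v + 1))
      (Function.update py u (w + 1)) (Function.update nx u (last w))
      (Function.update last w (u + 1)) := by
  obtain ⟨hvu, huv, huw⟩ := hlow
  have hvn : v < n := H.lt _ _ hvu
  have hun : u < n := H.lt _ _ hvu.symm
  have hwn : w < n := H.lt _ _ huw.symm
  have hnc : ¬ DomComparable G v w := fun hc => hd (H.dominates_of_comparable hvn hwn hwv hc)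
  have hpx : ∀ x, px x ≠ 0 → Function.update px u (v + 1) x ≠ 0 := by
    intro x hx
    rw [Function.update_apply]
    split_ifs
    · exact Nat.succ_ne_zero _
    · exact hx
  -- A dominator `z` of `u` is adjacent to `v` and `w`; it either lies below `v`, and then has been
  -- met, or above `v`.
  have hup : ∀ z, rk u < rk z → Dominates G z u → (IsLowPath G rk v z w ∧ R z w) ∨ rk v < rk z := by
    intro z hz hdz
    have hzv := hdz.adj hvu.symm
    have hzw := hdz.adj huw
    rcases lt_trichotomy (rk z) (rk v) with h1 | h1 | h1
    · exact Or.inl ⟨⟨hzv.symm, h1, hzw⟩, hall z w ⟨hzv.symm, h1, hzw⟩ hz⟩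
    · exact absurd (H.inj z (H.lt _ _ hzv) v hvn h1) hzv.ne
    · exact Or.inr h1
  refine ⟨⟨?_, ?_, ?_, ?_⟩, ?_, ?_, fun x hx => hpx x (h.mono x hx), ?_⟩
  · intro x hx hp
    by_cases hxu : x = u
    · subst hxu
      simp only [Function.update_self]
      exact ⟨v, w, rfl, rfl, hvu.symm, huw, hnc⟩
    · rw [Function.update_of_ne hxu] at hp ⊢
      rw [Function.update_of_ne hxu]
      exact h.links.pair x hx hp
  · intro x hx hp
    by_cases hxu : x = u
    · subst hxu
      simp at hp
    · rw [Function.update_of_ne hxu] at hp ⊢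
      exact h.links.next_zero x hx hp
  · intro x hx y hy
    by_cases hxu : x = u
    · subst hxu
      rw [Function.update_self] at hy
      rcases h.last w hwv hd ⟨x, hvu, huv, huw⟩ with ⟨h0, -⟩ | ⟨u', h1, h2, h3⟩
      · omega
      obtain rfl : u' = y := by omega
      obtain ⟨⟨l1, l2, l3⟩, l4⟩ := hle u' w h2
      have hu'n := H.lt _ _ l1.symm
      have hlt : rk x < rk u' := lt_of_le_of_ne l4 fun heq => hR (by
        rw [H.inj x hx u' hu'n heq]; exact h2)
      refine ⟨hu'n, hlt, H.dominates_of_comparable hu'n hx hlt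
        (H.c4.comparable hnc l1.symm l3 hvu.symm huw), hpx _ (h.set u' w h2 hwv hd), ?_⟩
      intro z hz hdz
      have hzn := H.lt _ _ (hdz.adj huw)
      have hcomp : rk u' < rk z → Dominates G z u' := fun hlt =>
        H.dominates_of_comparable hzn hu'n hlt
          (H.c4.comparable hnc (hdz.adj hvu.symm) (hdz.adj huw) l1.symm l3)
      rcases hup z hz hdz with ⟨-, hr⟩ | hr
      · rcases (h3 z hr).eq_or_lt with heq | hlt'
        · exact Or.inl (H.inj u' hu'n z hzn heq).symm
        · exact Or.inr ⟨hlt', hcomp hlt'⟩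
      · exact Or.inr ⟨by omega, hcomp (by omega)⟩
    · rw [Function.update_of_ne hxu] at hy
      obtain ⟨h1, h2, h3, h4, h5⟩ := h.links.next_pos x hx y hy
      exact ⟨h1, h2, h3, hpx y h4, h5⟩
  · intro x hx hp hz z hxz hdz
    by_cases hxu : x = u
    · subst hxu
      rw [Function.update_self] at hz
      rcases h.last w hwv hd ⟨x, hvu, huv, huw⟩ with ⟨-, h0⟩ | ⟨u', h1, -⟩
      · rcases hup z hxz hdz with ⟨-, hr⟩ | hr
        · exact absurd hr (h0 z)
        -- No greater common neighbour lies below `v`, so `z` is above `v` and hence above the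
        -- neighbour `w` of the linked vertex.
        · exact ⟨w, huw, by omega⟩
      · omega
    · rw [Function.update_of_ne hxu] at hp hz
      exact h.links.next_last x hx hp hz z hxz hdz
  · intro x h1 h2 h3
    by_cases hxw : x = w
    · subst hxw
      refine Or.inr ⟨u, by rw [Function.update_self], Or.inr ⟨rfl, rfl⟩, ?_⟩
      rintro u' (hu' | ⟨rfl, -⟩)
      · exact (hle u' _ hu').2
      · exact le_rfl
    · simpa [hxw] using h.last x h1 h2 h3
  · rintro a b (hab | ⟨rfl, rfl⟩) h1 h2
    · exact hpx a (h.set a b hab h1 h2)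
    · simp
  · intro x hx
    have hxu : x ≠ u := fun heq => hx (heq ▸ hvu)
    rw [Function.update_of_ne hxu, Function.update_of_ne hxu]
    exact h.fix x hx

/-- The vertex `x` has been processed, and `v` dominates it. -/
def IsSafe (G : SimpleGraph ℕ) (rk : ℕ → ℕ) (v : ℕ) (R : ℕ → ℕ → Prop) (x : ℕ) : Prop :=
  rk x < rk v ∧ Dominates G v x ∧ ∃ u, R u x

open Classical in
/-- The invariant for the lists, where `R` contains the pairs that have been processed. -/
structure ListInv (G : SimpleGraph ℕ) (rk : ℕ → ℕ) (v : ℕ) (L D : ℕ → List ℕ)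
    (R : ℕ → ℕ → Prop) (s : ArrState) : Prop where
  lists : Lists aV2 aN2 aLH aLL rF2 s fun x => if IsSafe G rk v R x then v :: L x else L x
  dlists : Lists aV2 aN2 aDH aSz rF2 s D
  added : ∀ u x, IsLowPath G rk v u x → (s.arr aAdded x = 0 ↔ ¬ IsSafe G rk v R x)

variable {L D : ℕ → List ℕ} {s s' : ArrState}

lemma ListInv.congr {R' : ℕ → ℕ → Prop} (h : ListInv G rk v L D R s)
    (hR : ∀ x, IsSafe G rk v R' x ↔ IsSafe G rk v R x)
    (harr : ∀ f ∈ [aV2, aN2, aLH, aLL, aDH, aSz, aAdded], s'.arr f = s.arr f)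
    (hreg : s'.reg rF2 = s.reg rF2) : ListInv G rk v L D R' s' := by
  refine ⟨?_, h.dlists.congr (harr _ (by simp)) (harr _ (by simp)) (harr _ (by simp))
    (harr _ (by simp)) hreg, ?_⟩
  · have hS : IsSafe G rk v R' = IsSafe G rk v R := funext fun x => propext (hR x)
    rw [hS]
    exact h.lists.congr (harr _ (by simp)) (harr _ (by simp)) (harr _ (by simp))
      (harr _ (by simp)) hreg
  · intro u x hx
    rw [hR, harr aAdded (by simp)]
    exact h.added u x hx

/-- The same `w` may be met through several vertices `u`; the flag lets `v` enter its list only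
once. -/
lemma ListInv.step {u w : ℕ} (h : ListInv G rk v L D R s) (hv : s.reg rV = v) (hw : s.reg rW = w)
    (hlow : IsLowPath G rk v u w) (hwv : rk w < rk v) (hd : Dominates G v w)
    (ha : s.arr aAdded w = 0) :
    ListInv G rk v L D (fun a b => R a b ∨ a = u ∧ b = w)
      ((push aV2 aN2 aLH aLL rF2 rW rV).eval (s.setArr aAdded w 1)) := by
  classical
  have hd4 : [aV2, aN2, aLH, aLL].Nodup := by decide
  have hfc : rV ≠ rF2 ∧ rW ≠ rF2 := by decide
  have hn := (h.added u w hlow).mp ha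
  have hsafe : ∀ x, IsSafe G rk v (fun a b => R a b ∨ a = u ∧ b = w) x ↔
      IsSafe G rk v R x ∨ x = w := by
    intro x
    by_cases hx : x = w
    · subst hx
      simp only [or_true, iff_true]
      exact ⟨hwv, hd, u, Or.inr ⟨rfl, rfl⟩⟩
    · simp [IsSafe, hx]
  have h1 : Lists aV2 aN2 aLH aLL rF2 (s.setArr aAdded w 1)
      fun x => if IsSafe G rk v R x then v :: L x else L x :=
    h.lists.congr (by simp [setArr_arr]) (by simp [setArr_arr]) (by simp [setArr_arr])
      (by simp [setArr_arr]) rfl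
  have h2 : Lists aV2 aN2 aDH aSz rF2 (s.setArr aAdded w 1) D :=
    h.dlists.congr (by simp [setArr_arr]) (by simp [setArr_arr]) (by simp [setArr_arr])
      (by simp [setArr_arr]) rfl
  refine ⟨?_, h2.push_other hd4 hfc h1.hd_le (by decide), ?_⟩
  · have := h1.push (q := rW) (a := rV) hd4 hfc
    convert this using 1
    funext x
    rw [setArr_reg, hv, hw, Function.update_apply, if_neg hn]
    simp only [hsafe]
    by_cases hx : x = w
    · subst hx; simp
    · simp [hx]
  · intro u' x hx
    rw [push_arr hd4 hfc, hsafe]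
    simp only [show aAdded ≠ aV2 by decide, show aAdded ≠ aN2 by decide,
      show aAdded ≠ aLH by decide, show aAdded ≠ aLL by decide, if_false, setArr_arr, if_true]
    by_cases hxw : x = w
    · simp [hxw]
    · simp [hxw, h.added u' x hx]

end Pairs

/-! ### The domination test and the treatment of one pair -/

section PairPass

open ArrCmd ArrExpr ArrState

variable {n : ℕ} {G : SimpleGraph ℕ} {nb : ℕ → List ℕ} {rk : ℕ → ℕ} {v : ℕ}
  {L D : ℕ → List ℕ} {s s' : ArrState} {R : ℕ → ℕ → Prop}

/-- Test whether `rV` dominates `rW`. -/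
def testCode : ArrCmd :=
  .seq (.assign rOk (.lit 0)) <|
  .ifEq (.arr aPX (.var rW)) (.lit 0)
    (.ifEq (.arr aCnt (.var rW)) (.arr aBelow (.var rW)) (.assign rOk (.lit 1)) .skip)
    (.ifEq (.arr aMark (.sub (.arr aPX (.var rW)) (.lit 1))) (.succ (.var rV))
      (.ifEq (.arr aMark (.sub (.arr aPY (.var rW)) (.lit 1))) (.succ (.var rV))
        (.assign rOk (.lit 1)) .skip) .skip)

/-- Link `rU`, where `rV` does not dominate `rW`. -/
def linkCode : ArrCmd :=
  .seq (.store aPX (.var rU) (.succ (.var rV))) <|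
  .seq (.store aPY (.var rU) (.succ (.var rW))) <|
  .seq (.store aNext (.var rU) (.arr aLast (.var rW))) <|
    .store aLast (.var rW) (.succ (.var rU))

def addCode : ArrCmd :=
  .ifEq (.arr aAdded (.var rW)) (.lit 0)
    (.seq (.store aAdded (.var rW) (.lit 1)) (push aV2 aN2 aLH aLL rF2 rW rV)) .skip

def pairBody : ArrCmd :=
  .ifEq (.arr aDone (.var rW)) (.lit 0)
    (.seq testCode (.ifEq (.var rOk) (.lit 1) addCode linkCode)) .skip

def pairCode : ArrCmd := squares pairBody

/-- The state before the pairs of `v` are processed. -/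
structure Ready (n : ℕ) (G : SimpleGraph ℕ) (nb : ℕ → List ℕ) (rk : ℕ → ℕ) (v : ℕ)
    (L D : ℕ → List ℕ) (s : ArrState) : Prop where
  graph : HasGraph n nb s
  reg : s.reg rV = v
  done : ∀ x < n, s.arr aDone x = if rk v ≤ rk x then 1 else 0
  mark : ∀ x < n, s.arr aMark x = v + 1 ↔ G.Adj v x
  links : Links n G rk (s.arr aPX) (s.arr aPY) (s.arr aNext)
  pair_of : ∀ x a b, G.Adj x a → G.Adj x b → rk v < rk a → rk b < rk a → rk x < rk a →
    ¬ Dominates G a b → s.arr aPX x ≠ 0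
  count : ∀ u w, IsLowPath G rk v u w →
    (s.arr aCnt w = s.arr aBelow w ↔ ∀ x, G.Adj w x → rk x < rk v → G.Adj v x)
  last : ∀ u w, IsLowPath G rk v u w → s.arr aLast w = 0
  added : ∀ u w, IsLowPath G rk v u w → s.arr aAdded w = 0
  lists : Lists aV2 aN2 aLH aLL rF2 s L
  dlists : Lists aV2 aN2 aDH aSz rF2 s D

/-- With recorded incomparable neighbours `a`, `b` of `w`, two marks decide by
`dominates_iff_of_pair`. Without them the neighbours of `w` above `v` all dominate `u`, and
`dominates_iff_of_chain` reduces the question to the counters. Either way the test takes constant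
time. -/
lemma testCode_spec {u w : ℕ} (H : IsSorted n G nb rk) (h : Ready n G nb rk v L D s)
    (hF : Frame pairCode s s') (hw : s'.reg rW = w) (hlow : IsLowPath G rk v u w)
    (hwv : rk w < rk v) (hpx : s'.arr aPX w = s.arr aPX w ∧ s'.arr aPY w = s.arr aPY w) :
    ((testCode.eval s').reg rOk = 1 ↔ Dominates G v w) ∧ testCode.cost s' ≤ 30 := by
  obtain ⟨hvu, huv, huw⟩ := hlow
  have hvn : v < n := H.lt _ _ hvu
  have hwn : w < n := H.lt _ _ huw.symm
  have hmark := hF.arr aMark (by decide)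
  have hcnt := hF.arr aCnt (by decide)
  have hbelow := hF.arr aBelow (by decide)
  have hrv : s'.reg rV = v := by rw [hF.reg rV (by decide), h.reg]
  constructor
  · by_cases hp : s.arr aPX w = 0
    · have hch : ∀ a, G.Adj w a → rk v < rk a → Dominates G a u := by
        intro a ha hlt
        by_contra hd
        exact h.pair_of w a u ha huw.symm hlt (huv.trans hlt) (hwv.trans hlt) hd hp
      rw [H.dominates_iff_of_chain hvu huw.symm huv hvn hch, ← h.count u w ⟨hvu, huv, huw⟩]
      simp only [testCode, eval_seq, eval_assign, eval_ifEq, val_arr, val_var, val_lit, setReg_arr,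
        setReg_reg, show rW ≠ rOk by decide, if_false, hw, hpx.1, hp, if_true, hcnt, hbelow]
      split_ifs with hc <;> simp [setReg_reg, hc]
    · obtain ⟨a, b, ha, hb, hwa, hwb, hab⟩ := h.links.pair w hwn hp
      rw [H.dominates_iff_of_pair hvn hwn hwv hwa hwb hab, ← h.mark a (H.lt _ _ hwa.symm),
        ← h.mark b (H.lt _ _ hwb.symm)]
      simp only [testCode, eval_seq, eval_assign, eval_ifEq, val_arr, val_var, val_lit, setReg_arr,
        setReg_reg, show rW ≠ rOk by decide, show rV ≠ rOk by decide, if_false, hw, hpx.1,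
        val_sub, val_succ, hmark, hrv, ha, hpx.2, hb, Nat.add_sub_cancel, Nat.succ_ne_zero]
      split_ifs with h1 h2 <;> simp [setReg_reg, *]
  · simp only [testCode, cost_seq, cost_assign, cost_ifEq, cost_skip, size_var, size_lit, size_arr,
      size_sub, size_succ]
    split_ifs <;> omega

/-- The invariant while the pairs of `v` are processed. -/
def PairInv (n : ℕ) (G : SimpleGraph ℕ) (rk : ℕ → ℕ) (v : ℕ) (L D : ℕ → List ℕ) (s : ArrState)
    (R : ℕ → ℕ → Prop) (s' : ArrState) : Prop :=
  ListInv G rk v L D R s' ∧ LinkInv n G rk v (s.arr aPX) (s.arr aPY) R (s'.arr aPX) (s'.arr aPY)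
    (s'.arr aNext) (s'.arr aLast)

lemma pairBody_spec {u w : ℕ} (H : IsSorted n G nb rk) (h : Ready n G nb rk v L D s)
    (hF : Frame pairCode s s') (hu : s'.reg rU = u) (hw : s'.reg rW = w)
    (hlow : IsLowPath G rk v u w) (hR : ¬ R u w)
    (hle : ∀ u' w', R u' w' → IsLowPath G rk v u' w' ∧ rk u ≤ rk u')
    (hall : ∀ u' w', IsLowPath G rk v u' w' → rk u < rk u' → R u' w')
    (hP : PairInv n G rk v L D s R s') :
    PairInv n G rk v L D s (fun a b => R a b ∨ a = u ∧ b = w) (pairBody.eval s') ∧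
      pairBody.cost s' ≤ 80 := by
  have hwn : w < n := H.lt _ _ hlow.2.2.symm
  have hrv : s'.reg rV = v := by rw [hF.reg rV (by decide), h.reg]
  have hdw : s'.arr aDone w = if rk v ≤ rk w then 1 else 0 := by
    rw [hF.arr aDone (by decide), h.done w hwn]
  by_cases hwv : rk v ≤ rk w
  · have hev : pairBody.eval s' = s' := by simp [pairBody, hw, hdw, hwv]
    refine ⟨?_, by simp [pairBody, hw, hdw, hwv]⟩
    rw [hev]
    refine ⟨hP.1.congr (fun x => ?_) (fun _ _ => rfl) rfl, hP.2.of_iff fun a b h1 h2 => ?_⟩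
    · by_cases hx : x = w
      · subst hx; simp [IsSafe, hwv]
      · simp [IsSafe, hx]
    · have : b ≠ w := by rintro rfl; omega
      simp [this]
  -- The links of this round change only entries of neighbours of `v`. By triangle-freeness `w` is
  -- not one of them, so its recorded pair is still that of the start of the pass.
  have hnw : ¬ G.Adj v w := not_adj_of_cliqueFree H.tri hlow.1.symm hlow.2.2 
  obtain ⟨ht, htc⟩ := testCode_spec H h hF hw hlow (by omega) (hP.2.fix w hnw)
  have hT := frame_eval testCode s'
  have harr : ∀ f, (testCode.eval s').arr f = s'.arr f := fun f => hT.arr f rfl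
  have hreg : ∀ x, x ≠ rOk → (testCode.eval s').reg x = s'.reg x := fun x hx => hT.reg x (by
    simp [testCode, writesReg, Ne.symm hx])
  set s₂ := testCode.eval s' with hs₂
  have hrv₂ : s₂.reg rV = v := by rw [hreg _ (by decide), hrv]
  have hrw₂ : s₂.reg rW = w := by rw [hreg _ (by decide), hw]
  have hru₂ : s₂.reg rU = u := by rw [hreg _ (by decide), hu]
  have hL₂ : ListInv G rk v L D R s₂ :=
    hP.1.congr (fun _ => Iff.rfl) (fun f _ => harr f) (hreg _ (by decide))
  have hcost : pairBody.cost s' ≤ 80 := by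
    simp only [pairBody, cost_ifEq, cost_seq, addCode, linkCode, cost_store, push_cost, cost_skip,
      size_var, size_lit, size_arr, size_succ]
    split_ifs <;> omega
  refine ⟨?_, hcost⟩
  by_cases hd : Dominates G v w
  · have hsafe : ∀ a b, rk b < rk v → ¬ Dominates G v b →
        (R a b ∨ a = u ∧ b = w ↔ R a b) := by
      intro a b _ hb
      have : b ≠ w := by rintro rfl; exact hb hd
      simp [this]
    by_cases ha : s'.arr aAdded w = 0
    · have hev : pairBody.eval s' =
          (push aV2 aN2 aLH aLL rF2 rW rV).eval (s₂.setArr aAdded w 1) := by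
        simp [pairBody, hw, hdw, hwv, ← hs₂, ht.mpr hd, addCode, hrw₂, harr, ha]
      rw [hev]
      refine ⟨hL₂.step hrv₂ hrw₂ hlow (by omega) hd (by rw [harr, ha]), ?_⟩
      have hkeep : ∀ f, f ∉ [aV2, aN2, aLH, aLL, aAdded] →
          ((push aV2 aN2 aLH aLL rF2 rW rV).eval (s₂.setArr aAdded w 1)).arr f = s'.arr f := by
        intro f hf
        simp only [List.mem_cons, List.not_mem_nil, or_false, not_or] at hf
        obtain ⟨f1, f2, f3, f4, f5⟩ := hf
        rw [push_arr (by decide) (by decide), if_neg f1, if_neg f2, if_neg f3, if_neg f4,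
          setArr_arr, if_neg f5, harr]
      rw [hkeep aPX (by decide), hkeep aPY (by decide), hkeep aNext (by decide),
        hkeep aLast (by decide)]
      exact hP.2.of_iff hsafe
    · have hev : pairBody.eval s' = s₂ := by
        simp [pairBody, hw, hdw, hwv, ← hs₂, ht.mpr hd, addCode, hrw₂, harr, ha]
      rw [hev]
      refine ⟨hL₂.congr (fun x => ?_) (fun _ _ => rfl) rfl, ?_⟩
      · by_cases hx : x = w
        · subst hx
          have := not_not.mp (mt (hP.1.added u x hlow).mpr ha)
          simp only [this, iff_true]
          exact ⟨this.1, hd, u, Or.inr ⟨rfl, rfl⟩⟩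
        · simp [IsSafe, hx]
      · rw [harr, harr, harr, harr]
        exact hP.2.of_iff hsafe
  · have hok : s₂.reg rOk ≠ 1 := fun hok => hd (ht.mp hok)
    have hev : pairBody.eval s' = linkCode.eval s₂ := by
      simp [pairBody, hw, hdw, hwv, ← hs₂, hok]
    rw [hev]
    have hlF := frame_eval linkCode s₂
    refine ⟨hL₂.congr (fun x => ?_) (fun f hf => hlF.arr f ?_) (hlF.reg _ (by decide)), ?_⟩
    · by_cases hx : x = w
      · subst hx; simp [IsSafe, hd]
      · simp [IsSafe, hx]
    · fin_cases hf <;> decide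
    · have := hP.2.step H hlow hR hle hall (by omega) hd
      convert this using 1 <;>
        simp [linkCode, setArr_arr, hrv₂, hrw₂, hru₂, harr]

lemma pairCode_spec (H : IsSorted n G nb rk) (h : Ready n G nb rk v L D s) :
    PairInv n G rk v L D s (IsLowPath G rk v) (pairCode.eval s) ∧
      pairCode.cost s ≤ 6 + ((nb v).map fun u => 18 + 87 * lowLength nb rk v u).sum := by
  refine squares_spec H h.graph h.reg h.done (by decide) (PairInv n G rk v L D s) 80 ?_ ?_ ?_
  · intro R s' r k hr hP
    refine ⟨hP.1.congr (fun _ => Iff.rfl) (fun _ _ => rfl) ?_, hP.2⟩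
    rw [setReg_reg, if_neg]
    rintro rfl
    revert hr
    decide
  · have hno : ∀ x, ¬ IsSafe G rk v (fun _ _ => False) x := fun x hx => hx.2.2.elim fun _ h => h
    refine ⟨⟨?_, h.dlists, fun u x hx => ?_⟩, ⟨h.links, fun x _ _ ⟨u, hx⟩ => ?_,
      fun _ _ hf => hf.elim, fun _ hx => hx, fun _ _ => ⟨rfl, rfl⟩⟩⟩
    · simp only [hno, if_false]
      exact h.lists
    · simp [hno, h.added u x hx]
    · exact Or.inl ⟨h.last u x hx, fun _ hf => hf⟩
  · intro R u w s' hF hu hw hlow hR hle hall hP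
    exact pairBody_spec H h hF hu hw hlow hR hle hall hP

end PairPass

/-! ### Twins, crossed vertices and counters within a round -/

section Round

open ArrCmd ArrExpr ArrState

variable {n : ℕ} {G : SimpleGraph ℕ} {nb : ℕ → List ℕ} {rk : ℕ → ℕ} {v : ℕ}
  {L D : ℕ → List ℕ} {s : ArrState}

/-- The part of a round between the computation of the dominators of `rV` and the pairs. -/
def scoutCode : ArrCmd :=
  .seq twinCode <| .seq chainCode <| .seq scanCode <| .seq clearCode countCode

/-- A round of the main loop, for the vertex `rV`. -/
def roundCode : ArrCmd := .seq tailCode <| .seq scoutCode pairCode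

/-- Only `v` has rank `rk v`, so lowering the threshold to `rk v` removes one entry exactly from the
lists of the neighbours of `v`. -/
lemma filter_lt_succ (H : IsSorted n G nb rk) (hv : v < n) (x : ℕ) :
    ((nb x).filter fun y => rk y < rk v).length = if x ∈ nb v
      then ((nb x).filter fun y => rk y < rk v + 1).length - 1
      else ((nb x).filter fun y => rk y < rk v + 1).length := by
  have hq : ∀ y ∈ nb x, y ≠ v → (rk y < rk v + 1 ↔ rk y < rk v) := fun y hy hne => by
    have : rk y ≠ rk v := fun heq => hne (H.inj y (H.lt _ _ ((H.mem x y).mp hy).symm) v hv heq)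
    omega
  simp only [← List.countP_eq_length_filter]
  split_ifs with hx
  · have hvx : v ∈ nb x := (H.mem x v).mpr ((H.mem v x).mp hx).symm
    rw [countP_or_eq (l := nb x) (p := fun y => decide (rk y < rk v))
      (q := fun y => decide (rk y < rk v) || y == v) (H.nodup x) hvx (by simp) (fun _ => rfl)
      |>.symm.trans (List.countP_congr fun y hy => ?_) |> fun h => (Nat.sub_eq_of_eq_add h.symm).symm]
    by_cases hyv : y = v
    · simp [hyv]
    · simp [hyv, hq y hy hyv]
  · refine List.countP_congr fun y hy => ?_
    have hyv : y ≠ v := by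
      rintro rfl
      exact hx ((H.mem y x).mpr ((H.mem x y).mp hy).symm)
    simp [hq y hy hyv]

lemma le_iff_of_lt (H : IsSorted n G nb rk) (hv : v < n) {x : ℕ} (hx : x < n) :
    rk v ≤ rk x ↔ x = v ∨ rk v < rk x := by
  constructor
  · intro h
    rcases h.eq_or_lt with h | h
    · exact Or.inl (H.inj x hx v hv h.symm)
    · exact Or.inr h
  · rintro (rfl | h)
    · exact le_rfl
    · exact h.le

open Classical in
/-- The state after the first two parts of a round. -/
lemma scout_spec (H : IsSorted n G nb rk) (hg : HasGraph n nb s) (hv : s.reg rV = v) (hvn : v < n)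
    (h : Inv n G nb rk (rk v + 1) L D s) :
    (Ready n G nb rk v L (Function.update D v (v :: tailList L D s v))
        (scoutCode.eval (tailCode.eval s)) ∧
      (∀ x < n, (scoutCode.eval (tailCode.eval s)).arr aBelow x =
        ((nb x).filter fun y => rk y < rk v).length) ∧
      (∀ x < n, (scoutCode.eval (tailCode.eval s)).arr aMark x =
        if x ∈ nb v then v + 1 else s.arr aMark x) ∧
      ∀ x < n, ((scoutCode.eval (tailCode.eval s)).arr aSkip x ≠ 0 ↔ s.arr aSkip x ≠ 0 ∨
        ((tailList L D s v).head? = some x ∧ (nb x).length = (nb v).length) ∨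
        (x = v ∧ s.arr aPX v = 0 ∧ s.arr aBelow v = 0) ∨
        (x = v ∧ ∃ w ∈ nb v, rk v < rk w ∧ (tailList L D s v).length + 1 = (nb w).length ∧
          (D w).length = (nb v).length))) ∧
    tailCode.cost s + scoutCode.cost (tailCode.eval s) ≤
      110 + ((nb v).map fun u => 93 + 28 * lowLength nb rk v u).sum := by
  obtain ⟨⟨t1, t2, t3, t4, t5⟩, tc⟩ := tailCode_spec hv h.lists h.dlists
  have F1 := frame_eval tailCode s
  set s1 := tailCode.eval s
  have hv1 : s1.reg rV = v := by rw [F1.reg rV (by decide), hv]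
  obtain ⟨w1, wc⟩ := twinCode_spec hv1 t4 t5
  have F2 := frame_eval twinCode s1
  set s2 := twinCode.eval s1 with hs2
  have hv2 : s2.reg rV = v := by rw [F2.reg rV (by decide), hv1]
  obtain ⟨c1, cc⟩ := chainCode_spec (s := s2) hv2
  have F3 := frame_eval chainCode s2
  set s3 := chainCode.eval s2 with hs3
  have hv3 : s3.reg rV = v := by rw [F3.reg rV (by decide), hv2]
  have hg1 := hg.frame F1 (by decide)
  have hg3 := (hg1.frame F2 (by decide)).frame F3 (by decide)
  obtain ⟨⟨n1, n2, n3⟩, nc⟩ := scanCode_spec hg3 (H.nodup v) hv3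
  have F4 := frame_eval scanCode s3
  set s4 := scanCode.eval s3 with hs4
  have hg4 := hg3.frame F4 (by decide)
  have hv4 : s4.reg rV = v := by rw [F4.reg rV (by decide), hv3]
  have hdone1 : ∀ x < n, s1.arr aDone x = if rk v ≤ rk x then 1 else 0 := by
    intro x hx
    rw [t3, Function.update_apply, h.done x hx]
    simp only [le_iff_of_lt H hvn hx, Nat.succ_le_iff]
    by_cases hxv : x = v <;> simp [hxv]
  have hdone4 : ∀ x < n, s4.arr aDone x = if rk v ≤ rk x then 1 else 0 := by
    rw [F4.arr aDone (by decide), F3.arr aDone (by decide), F2.arr aDone (by decide)]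
    exact hdone1
  obtain ⟨k1, kc⟩ := clearCode_spec H hg4 hv4 hdone4
  have F5 := frame_eval clearCode s4
  set s5 := clearCode.eval s4 with hs5
  have hg5 := hg4.frame F5 (by decide)
  have hv5 : s5.reg rV = v := by rw [F5.reg rV (by decide), hv4]
  have hdone5 : ∀ x < n, s5.arr aDone x = if rk v ≤ rk x then 1 else 0 := by
    rw [F5.arr aDone (by decide)]
    exact hdone4
  obtain ⟨m1, mc⟩ := countCode_spec H hg5 hv5 hdone5
  have F6 := frame_eval countCode s5
  have hs6 : scoutCode.eval s1 = countCode.eval s5 := rfl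
  have F16 : Frame scoutCode s1 (countCode.eval s5) := frame_eval scoutCode s1
  rw [hs6]
  have hcost : scoutCode.cost s1 = twinCode.cost s1 + (chainCode.cost s2 + (scanCode.cost s3 +
      (clearCode.cost s4 + countCode.cost s5))) := rfl
  set s6 := countCode.eval s5
  have hbelow : ∀ x < n, s6.arr aBelow x = ((nb x).filter fun y => rk y < rk v).length := by
    intro x hx
    rw [F6.arr aBelow (by decide), F5.arr aBelow (by decide), n2, F3.arr aBelow (by decide),
      F2.arr aBelow (by decide), F1.arr aBelow (by decide), h.below x hx, filter_lt_succ H hvn]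
  have hmark : ∀ x < n, s6.arr aMark x = if x ∈ nb v then v + 1 else s.arr aMark x := by
    intro x _
    rw [F6.arr aMark (by decide), F5.arr aMark (by decide), n1, F3.arr aMark (by decide),
      F2.arr aMark (by decide), F1.arr aMark (by decide)]
  have hPX : s6.arr aPX = s.arr aPX := by rw [F16.arr aPX (by decide), F1.arr aPX (by decide)]
  have hPY : s6.arr aPY = s.arr aPY := by rw [F16.arr aPY (by decide), F1.arr aPY (by decide)]
  have hNx : s6.arr aNext = s.arr aNext := by
    rw [F16.arr aNext (by decide), F1.arr aNext (by decide)]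
  refine ⟨⟨⟨?_, ?_, ?_, ?_, ?_, ?_, ?_, ?_, ?_, ?_, ?_⟩, hbelow, hmark, ?_⟩, ?_⟩
  · exact hg5.frame F6 (by decide)
  · rw [F6.reg rV (by decide), hv5]
  · rw [F16.arr aDone (by decide)]
    exact hdone1
  · intro x hx
    rw [hmark x hx, ← H.mem]
    split_ifs with hm
    · simp [hm]
    · simp only [hm, iff_false]
      -- A stale mark names a vertex of rank above `v`, so it differs from `v + 1` and needs no
      -- erasing.
      rcases h.mark x hx with h0 | ⟨y, -, hy, hle⟩
      · omega
      · intro heq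
        obtain rfl : y = v := by omega
        omega
  · rw [hPX, hPY, hNx]
    exact ⟨h.pair, h.next_zero, h.next_pos, h.next_last⟩
  · intro x a b ha hb hva hba hxa hd
    rw [hPX]
    exact h.pair_of x a b ha hb hva hba hxa hd
  · intro u w hlow
    have hw := H.lt _ _ hlow.2.2.symm
    rw [m1, (k1 u w hlow).1, zero_add]
    exact countP_eq_iff H (hbelow w hw)
  · intro u w hlow
    rw [F6.arr aLast (by decide)]
    exact (k1 u w hlow).2.1
  · intro u w hlow
    rw [F6.arr aAdded (by decide)]
    exact (k1 u w hlow).2.2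
  · exact t1.congr (F16.arr _ (by decide)) (F16.arr _ (by decide)) (F16.arr _ (by decide))
      (F16.arr _ (by decide)) (F16.reg _ (by decide))
  · exact t2.congr (F16.arr _ (by decide)) (F16.arr _ (by decide)) (F16.arr _ (by decide))
      (F16.arr _ (by decide)) (F16.reg _ (by decide))
  · intro x hx
    have hinp3 : s3.inp = s.inp := by rw [F3.inp, F2.inp, F1.inp]
    have hsz : ∀ y, s3.arr aSz y = (Function.update D v (v :: tailList L D s v) y).length :=
      fun y => by rw [F3.arr aSz (by decide), F2.arr aSz (by decide), t2.length]
    have hD3 : s3.arr aDone = s1.arr aDone := by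
      rw [F3.arr aDone (by decide), F2.arr aDone (by decide)]
    have hcross : (∃ w ∈ nb v, s3.arr aDone w = 1 ∧ s3.arr aSz v = s3.inp (w + 1) ∧
        s3.arr aSz w = s3.inp (v + 1)) ↔ ∃ w ∈ nb v, rk v < rk w ∧
        (tailList L D s v).length + 1 = (nb w).length ∧ (D w).length = (nb v).length := by
      refine exists_congr fun w => and_congr_right fun hw => ?_
      have hadj := (H.mem v w).mp hw
      have hwn := H.lt _ _ hadj.symm
      rw [hsz, hsz, Function.update_self, Function.update_of_ne hadj.ne', hinp3, hg.deg w hwn,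
        hg.deg v hvn, hD3, hdone1 w hwn, List.length_cons]
      simp only [le_iff_of_lt H hvn hwn, hadj.ne', false_or]
      refine and_congr_left fun _ => ?_
      split_ifs <;> simp [*]
    rw [F6.arr aSkip (by decide), F5.arr aSkip (by decide), n3, hcross, c1, w1,
      F2.arr aPX (by decide), F2.arr aBelow (by decide), F1.arr aPX (by decide),
      F1.arr aBelow (by decide), F1.arr aSkip (by decide), F1.inp, hg.deg x hx, hg.deg v hvn]
    split_ifs with h1 h2
    · simp [h1]
    · simp [h2]
    · simp only [h1, h2, false_or]
  · rw [hcost]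
    have hsum : ((nb v).map fun u => 93 + 28 * lowLength nb rk v u).sum =
        ((nb v).map fun u => 18 + 16 * lowLength nb rk v u).sum +
        ((nb v).map fun u => 18 + 12 * lowLength nb rk v u).sum + 57 * (nb v).length := by
      rw [← List.sum_map_add]
      clear_value s1
      induction nb v with
      | nil => rfl
      | cons a l ih => simp only [List.map_cons, List.sum_cons, List.length_cons, ih]; ring
    omega

end Round

/-! ### Complete rounds, the main loop and the output -/

section RoundSpec

open ArrCmd ArrExpr ArrState

variable {n : ℕ} {G : SimpleGraph ℕ} {nb : ℕ → List ℕ} {rk : ℕ → ℕ} {v : ℕ}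
  {L D : ℕ → List ℕ} {s : ArrState}

lemma sum_map_lowLength (nb : ℕ → List ℕ) (rk : ℕ → ℕ) (v : ℕ) :
    ((nb v).map fun u => 111 + 115 * lowLength nb rk v u).sum =
      ((nb v).map fun u => 93 + 28 * lowLength nb rk v u).sum +
      ((nb v).map fun u => 18 + 87 * lowLength nb rk v u).sum := by
  rw [← List.sum_map_add]
  exact congrArg List.sum (List.map_congr_left fun u _ => by ring)

lemma roundCode_spec (H : IsSorted n G nb rk) (hg : HasGraph n nb s) (hv : s.reg rV = v)
    (hvn : v < n) (h : Inv n G nb rk (rk v + 1) L D s) :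
    (HasGraph n nb (roundCode.eval s) ∧
      ∃ L' D' : ℕ → List ℕ, Inv n G nb rk (rk v) L' D' (roundCode.eval s)) ∧
    roundCode.cost s ≤ 116 + ((nb v).map fun u => 111 + 115 * lowLength nb rk v u).sum := by
  classical
  obtain ⟨⟨hR, hbelow, hmark, hskip⟩, hc⟩ := scout_spec H hg hv hvn h
  have hev : roundCode.eval s = pairCode.eval (scoutCode.eval (tailCode.eval s)) := rfl
  have hcost : roundCode.cost s = tailCode.cost s + (scoutCode.cost (tailCode.eval s) +
    pairCode.cost (scoutCode.eval (tailCode.eval s))) := rfl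
  rw [hev, hcost]
  set s6 := scoutCode.eval (tailCode.eval s)
  obtain ⟨⟨hL, hK⟩, hpc⟩ := pairCode_spec H hR
  have F7 := frame_eval pairCode s6
  have hPX6 : s6.arr aPX = s.arr aPX := by
    rw [(frame_eval scoutCode _).arr aPX (by decide), (frame_eval tailCode _).arr aPX (by decide)]
  have hskip' := hskip
  rw [← F7.arr aSkip (by decide)] at hskip'
  set s7 := pairCode.eval s6
  refine ⟨⟨hR.graph.frame F7 (by decide), _, _, ?_, ?_, hK.links.pair, ?_, hK.links.next_zero,
    hK.links.next_pos, hK.links.next_last, hL.lists, ?_, ?_, hL.dlists, ?_, ?_, ?_,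
    fun x hx hvx => h.skip_step H hvn hskip' hx hvx, ?_⟩, ?_⟩
  · rw [F7.arr aDone (by decide)]
    exact hR.done
  · rw [F7.arr aBelow (by decide)]
    exact hbelow
  · intro x a b ha hb hva hba hxa hd
    have han := H.lt _ _ ha.symm
    -- For the new vertex `a = v`, the pair of `x` and `b` was an unsafe pair of this very round,
    -- which recorded incomparable neighbours for `x`. Older vertices `a` use that recorded pairs
    -- are never removed.
    rcases (le_iff_of_lt H hvn han).mp hva with rfl | hlt
    · exact hK.set x b ⟨ha.symm, hxa, hb⟩ hba hd
    · exact hK.mono x (hR.pair_of x a b ha hb hlt hba hxa hd)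
  · intro x hx
    have := h.list_sorted x hx
    split_ifs
    · exact List.pairwise_cons.mpr ⟨fun a ha => ((h.mem_list x hx a).mp ha).1, this⟩
    · exact this
  · intro x hx a
    -- As `v` dominates `x`, every neighbour of `x` below `v` gives a path through which the round
    -- meets `x`.
    have hsafe : IsSafe G rk v (IsLowPath G rk v) x ↔
        rk x < rk v ∧ Dominates G v x ∧ ∃ y, G.Adj x y ∧ rk y < rk v :=
      and_congr_right fun _ => and_congr_right fun hd => exists_congr fun y =>
        ⟨fun hy => ⟨hy.2.2.symm, hy.2.1⟩, fun hy => ⟨hd.adj hy.1, hy.2, hy.1.symm⟩⟩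
    have hl := h.mem_list x hx a
    have hmem : a ∈ (if IsSafe G rk v (IsLowPath G rk v) x then v :: L x else L x) ↔
        (a = v ∧ IsSafe G rk v (IsLowPath G rk v) x) ∨ a ∈ L x := by
      split_ifs with hs <;> simp [hs]
    rw [hmem, hl, hsafe]
    by_cases hav : a = v
    · subst hav
      simp [hvn]
    · constructor
      · rintro (⟨h1, -⟩ | ⟨h1, h2⟩)
        · exact absurd h1 hav
        · exact ⟨by omega, h2⟩
      · rintro ⟨h1, h2⟩
        exact Or.inr ⟨((le_iff_of_lt H hvn h2.1).mp h1).resolve_left hav, h2⟩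
  · intro x hx hvx hnc
    rcases (le_iff_of_lt H hvn hx).mp hvx with rfl | hlt
    · rw [Function.update_self]
      exact h.cons_tailList_sorted H hx
    · rw [Function.update_of_ne (by rintro rfl; omega)]
      exact h.dlist_sorted x hx hlt hnc
  · intro x hx hvx hnc a
    rcases (le_iff_of_lt H hvn hx).mp hvx with rfl | hlt
    · rw [Function.update_self]
      exact h.mem_cons_tailList H hx hnc a
    · rw [Function.update_of_ne (by rintro rfl; omega)]
      exact h.mem_dlist x hx hlt hnc a
  · intro x hx hxv
    by_contra hne
    have hxv' : x ≠ v := by rintro rfl; omega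
    rcases (hskip' x hx).mp hne with h1 | ⟨h1, -⟩ | ⟨h1, -⟩ | ⟨h1, -⟩
    · exact h1 (h.skip_zero x hx (by omega))
    · have := (h.mem_tailList H hvn (List.mem_of_head? h1)).2.1
      omega
    · exact hxv' h1
    · exact hxv' h1
  · intro x hx
    rw [F7.arr aMark (by decide), hmark x hx]
    split_ifs
    · exact Or.inr ⟨v, hvn, rfl, le_rfl⟩
    · rcases h.mark x hx with h0 | ⟨y, h1, h2, h3⟩
      · exact Or.inl h0
      · exact Or.inr ⟨y, h1, h2, by omega⟩
  · have hsum := sum_map_lowLength nb rk v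
    omega

/-- Process the vertices in the reversed order of their degrees. -/
def mainCode : ArrCmd :=
  .forr rK (.inp (.lit 0)) <|
    .seq (.assign rV (.arr aOrd (.sub (.sub (.inp (.lit 0)) (.lit 1)) (.var rK)))) roundCode

lemma mainCode_spec {ord : ℕ → ℕ} (H : IsSorted n G nb rk) (hg : HasGraph n nb s)
    (hord : ∀ i < n, s.arr aOrd i = ord i ∧ ord i < n ∧ rk (ord i) = i)
    (h : Inv n G nb rk n L D s) :
    (HasGraph n nb (mainCode.eval s) ∧
      ∃ L' D' : ℕ → List ℕ, Inv n G nb rk 0 L' D' (mainCode.eval s)) ∧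
    mainCode.cost s ≤ 3 + ∑ k ∈ Finset.range n, (125 +
      ((nb (ord (n - 1 - k))).map fun u => 111 + 115 * lowLength nb rk (ord (n - 1 - k)) u).sum) := by
  have hN : (ArrExpr.inp (.lit 0)).val s = n := hg.zero
  have key := forr_spec (x := rK) (e := .inp (.lit 0))
    (c := .seq (.assign rV (.arr aOrd (.sub (.sub (.inp (.lit 0)) (.lit 1)) (.var rK)))) roundCode)
    (s := s) (fun k s' => HasGraph n nb s' ∧ ∃ L' D' : ℕ → List ℕ, Inv n G nb rk (n - k) L' D' s')
    (fun k => 124 + ((nb (ord (n - 1 - k))).map fun u =>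
      111 + 115 * lowLength nb rk (ord (n - 1 - k)) u).sum)
    ⟨hg, L, D, h⟩ (by
      rintro k hk s' hF ⟨hg', L', D', h'⟩
      rw [hN] at hk
      obtain ⟨o1, o2, o3⟩ := hord (n - 1 - k) (by omega)
      have hs : (ArrCmd.assign rV (.arr aOrd (.sub (.sub (.inp (.lit 0)) (.lit 1))
          (.var rK)))).eval (s'.setReg rK k) = (s'.setReg rK k).setReg rV (ord (n - 1 - k)) := by
        simp [setReg_reg, hF.inp, hg.zero, hF.arr aOrd (by decide), o1]
      have hnk : n - k = rk (ord (n - 1 - k)) + 1 := by omega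
      rw [hnk] at h'
      set v := ord (n - 1 - k)
      have hI : Inv n G nb rk (rk v + 1) L' D' ((s'.setReg rK k).setReg rV v) :=
        ⟨h'.done, h'.below, h'.pair, h'.pair_of, h'.next_zero, h'.next_pos, h'.next_last,
          h'.lists.congr rfl rfl rfl rfl rfl, h'.list_sorted, h'.mem_list,
          h'.dlists.congr rfl rfl rfl rfl rfl, h'.dlist_sorted, h'.mem_dlist, h'.skip_zero,
          h'.skip, h'.mark⟩
      have hr := roundCode_spec H ((hg'.setReg (k := k) (x := rK) (by decide)).setReg (k := v)
        (x := rV) (by decide)) (by simp [setReg_reg]) o2 hI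
      simp only [eval_seq, cost_seq, hs]
      refine ⟨?_, ?_⟩
      · rw [show n - (k + 1) = rk v by omega]
        exact hr.1
      · refine (Nat.add_le_add_left hr.2 _).trans ?_
        simp only [cost_assign, size_arr, size_sub, size_inp, size_lit, size_var]
        omega)
  rw [hN] at key
  refine ⟨?_, key.2.trans ?_⟩
  · have := key.1
    rwa [Nat.sub_self] at this
  · simp only [size_inp, size_lit]
    refine Nat.add_le_add le_rfl (Finset.sum_le_sum fun k _ => by omega)

/-- Output the bicliques of the vertices that are not skipped. -/
def outputCode : ArrCmd :=
  .forr rV (.inp (.lit 0)) <| .ifEq (.arr aSkip (.var rV)) (.lit 0)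
    (.seq (each rU rC1 rI1 aV1 aN1 aAH aAL rV (.emitVertex (.var rU))) <| .seq .emitBar <|
      .seq (each rU rC1 rI1 aV2 aN2 aDH aSz rV (.emitVertex (.var rU))) .emitClose) .skip

def symbols (l l' : List ℕ) : List Sym :=
  l.map Sym.vertex ++ [Sym.bar] ++ l'.map Sym.vertex ++ [Sym.close]

lemma eachEmit_spec {val nx hd len : ℕ} {l : List ℕ} (hv : s.reg rV = v)
    (hl : chain (s.arr val) (s.arr nx) (s.arr len v) (s.arr hd v) = l) :
    ((each rU rC1 rI1 val nx hd len rV (.emitVertex (.var rU))).eval s).out =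
      s.out ++ l.map Sym.vertex ∧
    (each rU rC1 rI1 val nx hd len rV (.emitVertex (.var rU))).cost s ≤ 6 + 9 * l.length := by
  have := each_spec (x := rU) (cur := rC1) (i := rI1) (val := val) (nx := nx) (hd := hd)
    (len := len) (q := rV) (body := .emitVertex (.var rU)) (s := s) (l := l) (by rw [hv]; exact hl)
    (by simp [writesReg, writesArr]) (fun pre s' => s'.out = s.out ++ pre.map Sym.vertex)
    (fun _ => 2) (fun _ _ _ _ _ h => h) (by simp) (by
      intro pre a suf s' _ _ hP ha
      simp [eval, cost, ha, hP])
  refine ⟨this.1, this.2.trans ?_⟩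
  simp
  omega

lemma outputCode_spec (hg : HasGraph n nb s) (hD : Lists aV2 aN2 aDH aSz rF2 s D) :
    (outputCode.eval s).out = s.out ++ ((List.range n).filter fun x => s.arr aSkip x = 0).flatMap
      (fun x => symbols (nb x) (D x)) ∧
    outputCode.cost s ≤ 3 + 7 * n + ∑ x ∈ Finset.range n with s.arr aSkip x = 0,
      (14 + 9 * ((nb x).length + (D x).length)) := by
  have hN : (ArrExpr.inp (.lit 0)).val s = n := hg.zero
  have key := forr_spec (x := rV) (e := .inp (.lit 0))
    (c := .ifEq (.arr aSkip (.var rV)) (.lit 0)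
    (.seq (each rU rC1 rI1 aV1 aN1 aAH aAL rV (.emitVertex (.var rU))) <| .seq .emitBar <|
      .seq (each rU rC1 rI1 aV2 aN2 aDH aSz rV (.emitVertex (.var rU))) .emitClose) .skip)
    (s := s) (fun k s' => s'.out = s.out ++ ((List.range k).filter fun x =>
      s.arr aSkip x = 0).flatMap (fun x => symbols (nb x) (D x)))
    (fun k => 6 + if s.arr aSkip k = 0 then 14 + 9 * ((nb k).length + (D k).length) else 0)
    (by simp) (by
      intro k hk s' hF hP
      have harr : ∀ f, s'.arr f = s.arr f := fun f => hF.arr f (by simp [each, writesArr])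
      by_cases hk0 : s.arr aSkip k = 0
      · obtain ⟨e1, c1⟩ := eachEmit_spec (s := s'.setReg rV k) (v := k) (l := nb k) (val := aV1)
          (nx := aN1) (hd := aAH) (len := aAL) (by simp [setReg_reg])
          (by simp only [setReg_arr, harr]; exact hg.adj.eq k)
        have F1 := frame_eval (each rU rC1 rI1 aV1 aN1 aAH aAL rV (.emitVertex (.var rU)))
          (s'.setReg rV k)
        obtain ⟨e2, c2⟩ := eachEmit_spec (s := ArrCmd.emitBar.eval
          ((each rU rC1 rI1 aV1 aN1 aAH aAL rV (.emitVertex (.var rU))).eval (s'.setReg rV k)))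
          (v := k) (l := D k) (val := aV2) (nx := aN2) (hd := aDH) (len := aSz)
          ((F1.reg rV (by decide)).trans (by simp [setReg_reg])) (by
            show chain (((each rU rC1 rI1 aV1 aN1 aAH aAL rV (.emitVertex (.var rU))).eval
              (s'.setReg rV k)).arr aV2) (((each rU rC1 rI1 aV1 aN1 aAH aAL rV
              (.emitVertex (.var rU))).eval (s'.setReg rV k)).arr aN2)
              (((each rU rC1 rI1 aV1 aN1 aAH aAL rV (.emitVertex (.var rU))).eval
              (s'.setReg rV k)).arr aSz k) (((each rU rC1 rI1 aV1 aN1 aAH aAL rV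
              (.emitVertex (.var rU))).eval (s'.setReg rV k)).arr aDH k) = D k
            rw [F1.arr aV2 (by decide), F1.arr aN2 (by decide), F1.arr aSz (by decide),
              F1.arr aDH (by decide)]
            simp only [setReg_arr, harr]
            exact hD.eq k)
        have hb : (ArrCmd.emitBar.eval ((each rU rC1 rI1 aV1 aN1 aAH aAL rV
            (.emitVertex (.var rU))).eval (s'.setReg rV k))).out = s.out ++ ((List.range k).filter
            fun x => s.arr aSkip x = 0).flatMap (fun x => symbols (nb x) (D x)) ++
            (nb k).map Sym.vertex ++ [Sym.bar] := by
          simp only [ArrCmd.eval, ArrState.emit]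
          rw [e1]
          simp [hP]
        rw [hb] at e2
        have hskip : (ArrExpr.arr aSkip (.var rV)).val (s'.setReg rV k) = 0 := by
          simp [setReg_reg, harr, hk0]
        constructor
        · rw [eval_ifEq, hskip, val_lit, if_pos rfl, List.range_succ, List.filter_append]
          simp only [eval_seq]
          have hcl : ∀ s₀ : ArrState, (ArrCmd.emitClose.eval s₀).out = s₀.out ++ [Sym.close] :=
            fun _ => rfl
          rw [hcl, e2]
          simp [symbols, hk0]
        · rw [cost_ifEq, hskip, val_lit, if_pos rfl, if_pos hk0]
          simp only [cost_seq, size_arr, size_var, size_lit]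
          have hc1 : ∀ s₀ : ArrState, ArrCmd.emitBar.cost s₀ = 1 := fun _ => rfl
          have hc2 : ∀ s₀ : ArrState, ArrCmd.emitClose.cost s₀ = 1 := fun _ => rfl
          rw [hc1, hc2]
          omega
      · have hskip : (ArrExpr.arr aSkip (.var rV)).val (s'.setReg rV k) ≠ 0 := by
          simp [setReg_reg, harr, hk0]
        constructor
        · rw [eval_ifEq, val_lit, if_neg hskip, List.range_succ, List.filter_append]
          simpa [hk0] using hP
        · rw [cost_ifEq, val_lit, if_neg hskip, if_neg hk0]
          simp)
  rw [hN] at key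
  refine ⟨key.1, key.2.trans (le_of_eq ?_)⟩
  simp only [size_inp, size_lit]
  rw [Finset.sum_filter, show ∀ a : ℕ → ℕ, ∑ k ∈ Finset.range n, (1 + (6 + a k)) =
    7 * n + ∑ k ∈ Finset.range n, a k from fun a => by
      simp only [← add_assoc, Finset.sum_add_distrib]; simp; ring]
  ring

end RoundSpec

/-! ### The vertices whose bicliques are output -/

section Selection

variable {n : ℕ} {G : SimpleGraph ℕ} {nb : ℕ → List ℕ} {rk : ℕ → ℕ}

/-- No vertex of smaller rank has the same neighbourhood as `x`. -/
def IsFirst (n : ℕ) (G : SimpleGraph ℕ) (rk : ℕ → ℕ) (x : ℕ) : Prop :=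
  ¬ ∃ w < n, rk w < rk x ∧ G.neighborSet w = G.neighborSet x

def Selected (n : ℕ) (G : SimpleGraph ℕ) (rk : ℕ → ℕ) (x : ℕ) : Prop :=
  x < n ∧ NonChain G rk x ∧ ¬ Crossed n G rk x ∧ IsFirst n G rk x

lemma NonChain.nonempty {x : ℕ} (h : NonChain G rk x) : (G.neighborSet x).Nonempty := by
  rcases h with ⟨y, hy, -⟩ | ⟨a, -, ha, -⟩
  exacts [⟨y, hy⟩, ⟨a, ha⟩]

lemma exists_first {v : ℕ} (hv : v < n) :
    ∃ w < n, G.neighborSet w = G.neighborSet v ∧ IsFirst n G rk w := by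
  obtain ⟨w, hw, hmin⟩ := Set.exists_min_image {w | w < n ∧ G.neighborSet w = G.neighborSet v} rk
    ((Set.finite_lt_nat n).subset fun _ h => h.1) ⟨v, hv, rfl⟩
  refine ⟨w, hw.1, hw.2, ?_⟩
  rintro ⟨u, hu, hlt, heq⟩
  exact absurd hlt (not_lt.mpr (hmin u ⟨hu, heq.trans hw.2⟩))

namespace IsSorted

variable (H : IsSorted n G nb rk)
include H

lemma lt_of_nonempty {x : ℕ} (h : (G.neighborSet x).Nonempty) : x < n :=
  h.elim fun y hy => H.lt x y hy

/-- A dominator of smaller rank has at most the degree of `x`, hence it would be an earlier twin. -/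
lemma upDom_eq_Dom {x : ℕ} (hx : (G.neighborSet x).Nonempty) (hf : IsFirst n G rk x) :
    upDom n G rk x = Dom G x := by
  refine Set.Subset.antisymm (fun v hv => hv.2.2) fun v hv => ?_
  have hvn := H.lt_of_nonempty (hx.mono hv)
  refine ⟨hvn, ?_, hv⟩
  by_contra hlt
  rw [not_le] at hlt
  exact hf ⟨v, hvn, hlt, (H.neighborSet_eq_of_dominates hv
    (H.deg v hvn x (H.lt_of_nonempty hx) hlt)).symm⟩

/-- Two vertices with the same biclique are twins, and then the greater one is not first, or the
sides are exchanged, and then the smaller one is crossed. -/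
lemma selected_injective {x y : ℕ} (hx : Selected n G rk x) (hy : Selected n G rk y)
    (h : bicliqueOf G x = bicliqueOf G y) : x = y := by
  have key : ∀ x y, Selected n G rk x → Selected n G rk y → bicliqueOf G x = bicliqueOf G y →
      ¬ rk x < rk y := by
    intro x y hx hy h hlt
    rcases bicliqueOf_eq_iff.mp h with h | ⟨h1, h2⟩
    · exact hy.2.2.2 ⟨x, hx.1, hlt, h⟩
    · have hadj : G.Adj y x := h2.le (Dominates.refl G x)
      refine hx.2.2.1 ⟨y, hadj.symm, hlt, ?_, ?_⟩
      · rw [H.upDom_eq_Dom hx.2.1.nonempty hx.2.2.2, h2]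
      · rw [H.upDom_eq_Dom hy.2.1.nonempty hy.2.2.2, h1]
  rcases lt_trichotomy (rk x) (rk y) with hlt | heq | hlt
  · exact absurd hlt (key x y hx hy h)
  · exact H.inj x hx.1 y hy.1 heq
  · exact absurd hlt (key y x hy hx h.symm)

/-- Among the vertices with this biclique that precede all their twins, the one of greatest rank is
selected: each reason for skipping it would yield such a vertex of greater rank. -/
lemma exists_selected {v : ℕ} (hv : (G.neighborSet v).Nonempty) :
    ∃ x, Selected n G rk x ∧ bicliqueOf G x = bicliqueOf G v := by
  obtain ⟨w, hwn, hwv, hw⟩ := exists_first (rk := rk) (H.lt_of_nonempty hv)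
  obtain ⟨x, ⟨hxn, hxB, hxf⟩, hmax⟩ := Set.exists_max_image
    {u | u < n ∧ bicliqueOf G u = bicliqueOf G v ∧ IsFirst n G rk u} rk
    ((Set.finite_lt_nat n).subset fun _ h => h.1) ⟨w, hwn, bicliqueOf_eq_iff.mpr (Or.inl hwv), hw⟩
  have hx : (G.neighborSet x).Nonempty := by
    rcases bicliqueOf_eq_iff.mp hxB with h | h
    · rwa [h]
    · rw [h.1]
      exact ⟨v, Dominates.refl G v⟩
  have hmax' : ∀ u, bicliqueOf G u = bicliqueOf G x → (G.neighborSet u).Nonempty →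
      IsFirst n G rk u → rk u ≤ rk x := fun u h1 h2 h3 =>
    hmax u ⟨H.lt_of_nonempty h2, h1.trans hxB, h3⟩
  refine ⟨x, ⟨hxn, ?_, ?_, hxf⟩, hxB⟩
  · by_contra hc
    simp only [NonChain, not_or, not_exists, not_and, not_lt, not_not] at hc
    obtain ⟨hc1, hc2⟩ := hc
    obtain ⟨z, hz, hmin⟩ := Set.exists_min_image (G.neighborSet x) rk (H.finite x) hx
    replace hz : G.Adj x z := hz
    have hzn := H.lt _ _ (hz.symm)
    have hdz : ∀ a, G.Adj x a → Dominates G a z := by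
      intro a ha
      rcases (hmin a ha).eq_or_lt with heq | hlt
      · obtain rfl := H.inj z hzn a (H.lt _ _ ha.symm) heq
        exact Dominates.refl G z
      · exact H.dominates_of_comparable (H.lt _ _ ha.symm) hzn hlt (hc2 a z ha hz)
    -- All neighbours of `x` dominate the least one `z`, so `x` and `z` have the same biclique with
    -- exchanged sides.
    have hB : bicliqueOf G z = bicliqueOf G x := by
      refine bicliqueOf_eq_iff.mpr (Or.inr ⟨?_, ?_⟩)
      · refine Set.Subset.antisymm (fun y hy a ha => ?_) (Dom_subset hz)
        exact ((hdz a ha).adj hy).symm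
      · exact Set.Subset.antisymm (Dom_subset (hz.symm)) hdz
    -- A twin of `z` of smaller rank would be a neighbour of `x` below its least neighbour.
    have hle := hmax' z hB ⟨x, hz.symm⟩ (by
      rintro ⟨u, -, hlt, heq⟩
      have hux : G.Adj u x := heq.ge (hz.symm)
      exact absurd hlt (not_lt.mpr (hmin u hux.symm)))
    have := H.inj x hxn z hzn (le_antisymm (hc1 z hz) hle)
    exact G.loopless.irrefl x (by rwa [← this] at hz)
  · rintro ⟨w, hw, hlt, h1, h2⟩
    have hDw : Dom G w = upDom n G rk w :=
      Set.Subset.antisymm (by rw [h2]; exact Dom_subset hw.symm) fun _ h => h.2.2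
    have hB : bicliqueOf G w = bicliqueOf G x := by
      refine bicliqueOf_eq_iff.mpr (Or.inr ⟨?_, hDw.trans h2⟩)
      rw [← h1, H.upDom_eq_Dom hx hxf]
    refine absurd (hmax' w hB ⟨x, hw.symm⟩ ?_) (not_le.mpr hlt)
    -- A twin `u` of `w` dominates it. Since all dominators of `w` have at least its rank, `u`
    -- cannot come earlier.
    rintro ⟨u, -, hlt', heq⟩
    have hu : u ∈ upDom n G rk w := by
      rw [← hDw]
      exact heq.ge
    exact absurd hu.2.1 (not_le.mpr hlt')

end IsSorted

end Selection

/-! ### The whole algorithm -/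

section Algorithm

open ArrCmd ArrExpr ArrState

variable {n : ℕ} {I : ℕ → ℕ} {G : SimpleGraph ℕ} {nb : ℕ → List ℕ} {s : ArrState}

/-- The position of a vertex in the order of the degrees. -/
def degreeRank (n : ℕ) (nb : ℕ → List ℕ) (v : ℕ) : ℕ := (degreeOrder n nb).idxOf v

lemma degreeRank_lt (h : IsInput n I nb) {v : ℕ} (hv : v < n) : degreeRank n nb v < n := by
  rw [degreeRank, ← length_degreeOrder h (nb := nb)]
  simpa [length_degreeOrder h] using
    List.idxOf_lt_length_of_mem ((mem_degreeOrder h (nb := nb)).mpr hv)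

lemma degreeRank_spec (h : IsInput n I nb) {i v : ℕ} (hv : some v = (degreeOrder n nb)[i]?) :
    v < n ∧ degreeRank n nb v = i := by
  obtain ⟨hi, rfl⟩ := List.getElem?_eq_some_iff.mp hv.symm
  exact ⟨(mem_degreeOrder h).mp (List.getElem_mem hi), nodup_degreeOrder.idxOf_getElem i hi⟩

lemma degreeRank_inj (h : IsInput n I nb) {u v : ℕ} (hu : u < n)
    (huv : degreeRank n nb u = degreeRank n nb v) : u = v :=
  (List.idxOf_inj ((mem_degreeOrder h).mpr hu)).mp huv

lemma length_le_of_degreeRank_lt (h : IsInput n I nb) {u v : ℕ} (hu : u < n) (hv : v < n)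
    (huv : degreeRank n nb u < degreeRank n nb v) : (nb u).length ≤ (nb v).length := by
  have hu' := List.idxOf_lt_length_of_mem ((mem_degreeOrder h).mpr hu)
  have hv' := List.idxOf_lt_length_of_mem ((mem_degreeOrder h).mpr hv)
  have := List.pairwise_iff_getElem.mp (pairwise_degreeOrder (n := n) (nb := nb)) _ _ hu' hv' huv
  rwa [List.getElem_idxOf hu', List.getElem_idxOf hv'] at this

lemma isSorted_sortedNb (h : IsInput n I nb) (hmem : ∀ u v, v ∈ nb u ↔ G.Adj u v)
    (h3 : G.CliqueFree 3) (h4 : C4Dominated G) :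
    IsSorted n G (sortedNb n nb) (degreeRank n nb) where
  lt u v huv := h.lt u v ((hmem v u).mpr huv.symm)
  mem u v := (mem_sortedNb h).trans (hmem u v)
  sorted u := by
    rw [sortedNb, List.pairwise_reverse]
    refine List.Pairwise.filter _ (List.pairwise_iff_getElem.mpr fun i j hi hj hij => ?_)
    rw [degreeRank, degreeRank, nodup_degreeOrder.idxOf_getElem, nodup_degreeOrder.idxOf_getElem]
    exact hij
  inj u hu v _ huv := degreeRank_inj h hu huv
  deg u hu v hv huv := by
    rw [length_sortedNb h, length_sortedNb h]
    exact length_le_of_degreeRank_lt h hu hv huv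
  tri := h3
  c4 := h4

/-- With threshold `n` no vertex has been processed, and the untouched arrays contain `0`, so most
clauses are vacuous. -/
lemma inv_prepareCode (h : IsInput n I nb) (hs : IsInitial I s)
    (H : IsSorted n G (sortedNb n nb) (degreeRank n nb)) :
    HasGraph n (sortedNb n nb) (prepareCode.eval s) ∧
      Inv n G (sortedNb n nb) (degreeRank n nb) n (fun _ => []) (fun _ => [])
        (prepareCode.eval s) := by
  obtain ⟨⟨h1, h2, -⟩, -⟩ := prepareCode_spec h hs
  have F := frame_eval prepareCode s
  have hz : ∀ f, prepareCode.writesArr f = false → ∀ x, (prepareCode.eval s).arr f x = 0 :=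
    fun f hf x => by rw [F.arr f hf, hs.arr]
  have hrk := fun x (hx : x < n) => degreeRank_lt h (v := x) hx
  have hlists : ∀ {hd len}, prepareCode.writesArr hd = false → prepareCode.writesArr len = false →
      Lists aV2 aN2 hd len rF2 (prepareCode.eval s) fun _ => [] := fun h1 h2 =>
    ⟨fun c => by rw [hz aN2 (by decide)]; exact Nat.zero_le _,
      fun q => by rw [hz _ h1]; exact Nat.zero_le _, fun q => by rw [hz _ h2]; rfl⟩
  refine ⟨⟨h1, by rw [F.inp, hs.inp, h.zero], fun x hx => by
    rw [F.inp, hs.inp, h.deg x hx, length_sortedNb h]⟩, ?_⟩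
  constructor
  · intro x hx
    rw [hz aDone (by decide), if_neg (not_le.mpr (hrk x hx))]
  · intro x hx
    rw [h2 x hx, ← length_sortedNb h, List.filter_eq_self.mpr]
    intro y hy
    simpa using hrk y (H.lt _ _ ((H.mem _ _).mp hy).symm)
  · exact fun x _ hp => absurd (hz aPX (by decide) x) hp
  · exact fun x a _ ha _ hle _ _ _ => absurd (hrk a (H.lt _ _ ha.symm)) (not_lt.mpr hle)
  · exact fun x _ _ => hz aNext (by decide) x
  · intro x _ y hy
    rw [hz aNext (by decide)] at hy
    omega
  · exact fun x _ hp => absurd (hz aPX (by decide) x) hp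
  · exact hlists (by decide) (by decide)
  · simp
  · intro x _ v
    simp only [List.not_mem_nil, false_iff, not_and]
    exact fun hle hv => absurd (hrk v hv) (not_lt.mpr hle)
  · exact hlists (by decide) (by decide)
  · simp
  · exact fun x hx hle => absurd (hrk x hx) (not_lt.mpr hle)
  · exact fun x _ _ => hz aSkip (by decide) x
  · exact fun x hx hle => absurd (hrk x hx) (not_lt.mpr hle)
  · exact fun x _ => Or.inl (hz aMark (by decide) x)

lemma sum_cost_eq [DecidableRel G.Adj] (h : IsInput n I nb) (H : IsSorted n G (sortedNb n nb) (degreeRank n nb))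
    {ord : ℕ → ℕ} (hord : ∀ i < n, ord i < n ∧ degreeRank n nb (ord i) = i) :
    ∑ k ∈ Finset.range n, (125 + ((sortedNb n nb (ord (n - 1 - k))).map fun u => 111 + 115 *
        lowLength (sortedNb n nb) (degreeRank n nb) (ord (n - 1 - k)) u).sum) =
      125 * n + (111 * ∑ v ∈ Finset.range n, (nb v).length +
      115 * ∑ v ∈ Finset.range n, ∑ u ∈ Finset.range n,
        if G.Adj v u ∧ degreeRank n nb u < degreeRank n nb v then (nb u).length else 0) := by
  set F : ℕ → ℕ := fun v => ((sortedNb n nb v).map fun u =>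
    111 + 115 * lowLength (sortedNb n nb) (degreeRank n nb) v u).sum with hF
  have hsum : ∑ k ∈ Finset.range n, (125 + F (ord (n - 1 - k))) =
      125 * n + ∑ v ∈ Finset.range n, F v := by
    rw [Finset.sum_range_reflect (fun k => 125 + F (ord k)) n, Finset.sum_add_distrib,
      Finset.sum_const, Finset.card_range, smul_eq_mul, mul_comm]
    congr 1
    refine Finset.sum_nbij (ord) (fun i hi => ?_) (fun i hi j hj hij => ?_)
      (fun v hv => ?_) fun _ _ => rfl
    · exact Finset.mem_range.mpr (hord i (Finset.mem_range.mp hi)).1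
    · simp only [Finset.coe_range, Set.mem_Iio] at hi hj
      rw [← (hord i hi).2, hij, (hord j hj).2]
    · simp only [Finset.coe_range, Set.mem_Iio] at hv
      have hlt := degreeRank_lt h hv
      exact ⟨_, by simpa using hlt, degreeRank_inj h (hord _ hlt).1 (hord _ hlt).2⟩
  have hFv : ∀ v, F v = 111 * (nb v).length + 115 * ∑ u ∈ Finset.range n,
      if G.Adj v u ∧ degreeRank n nb u < degreeRank n nb v then (nb u).length else 0 := by
    intro v
    have hset : ∀ f : ℕ → ℕ, ∑ u ∈ Finset.range n, (if G.Adj v u ∧ degreeRank n nb u <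
        degreeRank n nb v then f u else 0) = ∑ u ∈ (sortedNb n nb v).toFinset,
        if degreeRank n nb u < degreeRank n nb v then f u else 0 := by
      intro f
      rw [show (sortedNb n nb v).toFinset = (Finset.range n).filter fun u => G.Adj v u by
        ext u
        simp only [List.mem_toFinset, H.mem, Finset.mem_filter, Finset.mem_range]
        exact ⟨fun hu => ⟨H.lt _ _ hu.symm, hu⟩, fun hu => hu.2⟩, Finset.sum_filter]
      exact Finset.sum_congr rfl fun u _ => by rw [ite_and]
    rw [hset, hF, List.sum_toFinset _ (H.nodup v)]
    simp only [lowLength, length_sortedNb h]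
    rw [← length_sortedNb h v]
    generalize sortedNb n nb v = l
    induction l with
    | nil => rfl
    | cons a l ih => simp only [List.map_cons, List.sum_cons, List.length_cons, ih]; ring
  rw [hsum]
  simp only [hFv, Finset.sum_add_distrib, ← Finset.mul_sum]

def searchCode : ArrCmd := .seq prepareCode mainCode

lemma searchCode_spec [DecidableRel G.Adj] (h : IsInput n I nb) (hs : IsInitial I s)
    (hmem : ∀ u v, v ∈ nb u ↔ G.Adj u v) (h3 : G.CliqueFree 3) (h4 : C4Dominated G) :
    (HasGraph n (sortedNb n nb) (searchCode.eval s) ∧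
      ∃ D : ℕ → List ℕ, Lists aV2 aN2 aDH aSz rF2 (searchCode.eval s) D ∧
        (∀ x < n, (searchCode.eval s).arr aSkip x = 0 ↔ Selected n G (degreeRank n nb) x) ∧
        ∀ x, Selected n G (degreeRank n nb) x → (D x).Nodup ∧ ∀ v, v ∈ D x ↔ v ∈ Dom G x) ∧
    searchCode.cost s ≤ 16 + 191 * n + 140 * ∑ v ∈ Finset.range n, (nb v).length +
      115 * ∑ v ∈ Finset.range n, ∑ u ∈ Finset.range n,
        if G.Adj v u ∧ degreeRank n nb u < degreeRank n nb v then (nb u).length else 0 := by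
  have H := isSorted_sortedNb h hmem h3 h4
  obtain ⟨⟨-, -, hord⟩, hpc⟩ := prepareCode_spec h hs
  obtain ⟨hg, hinv⟩ := inv_prepareCode h hs H
  have hord' := fun i hi => degreeRank_spec h (hord i hi)
  obtain ⟨⟨hg', L, D, hI⟩, hmc⟩ := mainCode_spec (ord := (prepareCode.eval s).arr aOrd) H hg
    (fun i hi => ⟨rfl, hord' i hi⟩) hinv
  rw [sum_cost_eq h H hord'] at hmc
  rw [searchCode, eval_seq, cost_seq]
  refine ⟨⟨hg', D, hI.dlists, fun x hx => ?_, fun x hx => ⟨?_, fun v => ?_⟩⟩, ?_⟩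
  · have hsk := hI.skip x hx (Nat.zero_le _)
    rw [← not_iff_not, ← ne_eq, hsk]
    simp only [Selected, IsFirst, Nat.zero_le, true_and, hx, not_and_or, not_not]
  · exact (hI.dlist_sorted x hx.1 (Nat.zero_le _) hx.2.1).imp fun hab => by
      rintro rfl; exact lt_irrefl _ hab
  · rw [← H.upDom_eq_Dom hx.2.1.nonempty hx.2.2.2]
    exact hI.mem_dlist x hx.1 (Nat.zero_le _) hx.2.1 v
  · generalize prepareCode.cost s = p at *
    generalize mainCode.cost (prepareCode.eval s) = q at *
    clear hI hg' hg hinv hord hord'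
    linarith

end Algorithm

/-! ### From graphs on `Fin n` to graphs on `ℕ` -/

section Transfer

open ArrCmd

variable {n : ℕ} {G : SimpleGraph (Fin n)} {adj : Fin n → List (Fin n)}

/-- The graph `G` as a graph on `ℕ`. -/
abbrev natGraph (G : SimpleGraph (Fin n)) : SimpleGraph ℕ := G.map Fin.valEmbedding

/-- The adjacency lists as lists of numbers. -/
def natNb (adj : Fin n → List (Fin n)) (x : ℕ) : List ℕ :=
  if h : x < n then (adj ⟨x, h⟩).map Fin.val else []

lemma natGraph_adj {a b : Fin n} : (natGraph G).Adj a b ↔ G.Adj a b :=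
  SimpleGraph.map_adj_apply (f := Fin.valEmbedding)

lemma exists_of_natGraph_adj {x y : ℕ} (h : (natGraph G).Adj x y) :
    ∃ a b : Fin n, G.Adj a b ∧ a.val = x ∧ b.val = y := by
  obtain ⟨a, b, hab, rfl, rfl⟩ := (SimpleGraph.map_adj _ _ _ _).mp h
  exact ⟨a, b, hab, rfl, rfl⟩

lemma mem_natNb (hadj : IsAdjacencyLists G adj) (u v : ℕ) :
    v ∈ natNb adj u ↔ (natGraph G).Adj u v := by
  constructor
  · intro h
    rw [natNb] at h
    split_ifs at h with hu
    · obtain ⟨b, hb, rfl⟩ := List.mem_map.mp h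
      exact (natGraph_adj (a := ⟨u, hu⟩)).mpr (((hadj _).2 b).mp hb)
    · simp at h
  · intro h
    obtain ⟨a, b, hab, rfl, rfl⟩ := exists_of_natGraph_adj h
    rw [natNb, dif_pos a.isLt]
    exact List.mem_map.mpr ⟨b, ((hadj a).2 b).mpr hab, rfl⟩

lemma length_natNb (a : Fin n) : (natNb adj a).length = (adj a).length := by
  rw [natNb, dif_pos a.isLt, List.length_map]

lemma isInput_natNb (hadj : IsAdjacencyLists G adj) :
    IsInput n (initialState adj).inp (natNb adj) where
  zero := inputWords_zero adj
  deg v hv := by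
    rw [length_natNb ⟨v, hv⟩]
    exact inputWords_length_entry adj ⟨v, hv⟩
  entry v hv j hj := by
    have hj' : j < (adj ⟨v, hv⟩).length := by rwa [← length_natNb]
    have := inputWords_neighbour adj ⟨v, hv⟩ j hj'
    have hsum : ∑ u ∈ Finset.range v, (natNb adj u).length =
        ∑ u : Fin n with u < ⟨v, hv⟩, (adj u).length := by
      symm
      refine Finset.sum_nbij Fin.val (fun u hu => ?_) (fun _ _ _ _ h => Fin.ext h) (fun u hu => ?_)
        fun u _ => (length_natNb u).symm
      · simpa using Fin.lt_def.mp (Finset.mem_filter.mp hu).2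
      · have hu : u < v := by simpa using hu
        exact ⟨⟨u, hu.trans hv⟩, by simpa [Fin.lt_def] using hu, rfl⟩
    rw [hsum]
    refine this.trans ?_
    simp [natNb, hv]
  nodup v := by
    rw [natNb]
    split_ifs
    · exact (hadj _).1.map Fin.val_injective
    · exact List.nodup_nil
  symm u v h := (mem_natNb hadj _ _).mpr ((mem_natNb hadj _ _).mp h).symm
  lt u v h := by
    obtain ⟨a, b, -, -, rfl⟩ := exists_of_natGraph_adj ((mem_natNb hadj _ _).mp h)
    exact b.isLt
  irrefl v h := (natGraph G).loopless.irrefl v ((mem_natNb hadj _ _).mp h)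

lemma neighborSet_natGraph (a : Fin n) :
    (natGraph G).neighborSet a = Fin.val '' G.neighborSet a := by
  ext y
  constructor
  · intro h
    obtain ⟨a', b, hab, ha, rfl⟩ := exists_of_natGraph_adj h
    obtain rfl := Fin.ext ha
    exact ⟨b, hab, rfl⟩
  · rintro ⟨b, hb, rfl⟩
    exact natGraph_adj.mpr hb

lemma dominates_natGraph {a b : Fin n} : Dominates (natGraph G) a b ↔ Dominates G a b := by
  rw [Dominates, neighborSet_natGraph, neighborSet_natGraph,
    Set.image_subset_image_iff Fin.val_injective]
  rfl

/-- A neighbour is needed: an isolated vertex is dominated by every number, also by those outside of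
`Fin n`, whereas a dominator of a vertex with a neighbour has an edge and so comes from `Fin n`. -/
lemma Dom_natGraph {a : Fin n} (ha : (G.neighborSet a).Nonempty) :
    Dom (natGraph G) a = Fin.val '' Dom G a := by
  ext y
  constructor
  · intro h
    obtain ⟨b, hb⟩ := ha
    obtain ⟨c, -, -, rfl, -⟩ := exists_of_natGraph_adj (Dominates.adj h (natGraph_adj.mpr hb))
    exact ⟨c, dominates_natGraph.mp h, rfl⟩
  · rintro ⟨c, hc, rfl⟩
    exact dominates_natGraph.mpr hc

lemma bicliqueOf_natGraph {a : Fin n} (ha : (G.neighborSet a).Nonempty) :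
    bicliqueOf (natGraph G) a = (bicliqueOf G a).map (Set.image Fin.val) := by
  rw [bicliqueOf_eq, bicliqueOf_eq, neighborSet_natGraph, Dom_natGraph ha, Sym2.map_mk]

lemma bicliqueOf_natGraph_inj {a b : Fin n} (ha : (G.neighborSet a).Nonempty)
    (hb : (G.neighborSet b).Nonempty) :
    bicliqueOf (natGraph G) a = bicliqueOf (natGraph G) b ↔ bicliqueOf G a = bicliqueOf G b := by
  rw [bicliqueOf_natGraph ha, bicliqueOf_natGraph hb]
  exact (Sym2.map.injective (Set.image_injective.mpr Fin.val_injective)).eq_iff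

lemma cliqueFree_natGraph (h : G.CliqueFree 3) : (natGraph G).CliqueFree 3 := by
  intro t ht
  obtain ⟨x, y, z, hxy, hxz, hyz, -⟩ := SimpleGraph.is3Clique_iff.mp ht
  obtain ⟨a, b, hab, rfl, rfl⟩ := exists_of_natGraph_adj hxy
  obtain ⟨_, c, -, -, rfl⟩ := exists_of_natGraph_adj hxz
  exact not_adj_of_cliqueFree h hab (natGraph_adj.mp hxz) (natGraph_adj.mp hyz)

lemma c4Dominated_natGraph (h : C4Dominated G) : C4Dominated (natGraph G) := by
  intro x y z w hxz hyw h1 h2 h3 h4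
  obtain ⟨a, b, -, rfl, rfl⟩ := exists_of_natGraph_adj h1
  obtain ⟨c, d, -, rfl, rfl⟩ := exists_of_natGraph_adj h3
  have := h a b c d (fun h => hxz (congrArg _ h)) (fun h => hyw (congrArg _ h))
    (natGraph_adj.mp h1) (natGraph_adj.mp h2) (natGraph_adj.mp h3) (natGraph_adj.mp h4)
  simpa only [DomComparable, dominates_natGraph] using this

/-- The members of a list that are less than `n`, as members of `Fin n`. -/
def toFin (n : ℕ) (l : List ℕ) : List (Fin n) :=
  l.filterMap fun x => if h : x < n then some ⟨x, h⟩ else none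

lemma mem_toFin {l : List ℕ} {a : Fin n} : a ∈ toFin n l ↔ a.val ∈ l := by
  simp only [toFin, List.mem_filterMap]
  constructor
  · rintro ⟨x, hx, h⟩
    split_ifs at h
    rw [← Option.some.inj h]
    exact hx
  · exact fun h => ⟨a, h, by simp⟩

lemma map_val_toFin {l : List ℕ} (h : ∀ x ∈ l, x < n) : (toFin n l).map Fin.val = l := by
  induction l with
  | nil => rfl
  | cons x l ih =>
    rw [toFin, List.filterMap_cons_some (b := ⟨x, h x (by simp)⟩) (by simp [h x]), List.map_cons]
    exact congrArg _ (ih fun y hy => h y (by simp [hy]))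

lemma nodup_toFin {l : List ℕ} (h : ∀ x ∈ l, x < n) (hl : l.Nodup) : (toFin n l).Nodup := by
  rw [← map_val_toFin h] at hl
  exact hl.of_map

lemma length_toFin {l : List ℕ} (h : ∀ x ∈ l, x < n) : (toFin n l).length = l.length := by
  rw [← List.length_map, map_val_toFin h]

lemma writeBiclique_toFin {l l' : List ℕ} (h : ∀ x ∈ l, x < n) (h' : ∀ x ∈ l', x < n) :
    writeBiclique (toFin n l, toFin n l') = symbols l l' := by
  conv_rhs => rw [← map_val_toFin h, ← map_val_toFin h']
  have hmap : ∀ l : List (Fin n), (l.flatMap fun a => [a.val]) = l.map Fin.val := fun l => by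
    induction l <;> simp [*]
  simp [writeBiclique, symbols, hmap]

lemma isInitial_initialState : IsInitial (initialState adj).inp (initialState adj) :=
  ⟨rfl, fun _ => rfl, fun _ _ => rfl⟩

/-- At most `n` vertices are selected and each side has at most `n` members. The resulting bound `2
n ^ 2` on the output size turns the output-sensitive time bound into the one with `n ^ 2`. -/
lemma exists_listing (h3 : G.CliqueFree 3) (h4 : C4Dominated G) (hadj : IsAdjacencyLists G adj) :
    ∃ bs : List (List (Fin n) × List (Fin n)),
      (outputCode.eval (searchCode.eval (initialState adj))).out = bs.flatMap writeBiclique ∧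
      ListsMaximalBicliques G bs ∧ listingSize bs ≤ 2 * n ^ 2 ∧
      outputCode.cost (searchCode.eval (initialState adj)) ≤ 3 + 7 * n + 23 * listingSize bs := by
  classical
  have hI := isInput_natNb hadj
  have H := isSorted_sortedNb hI (mem_natNb hadj) (cliqueFree_natGraph h3) (c4Dominated_natGraph h4)
  obtain ⟨⟨hg, D, hD, hsel, hDsel⟩, -⟩ := searchCode_spec hI isInitial_initialState
    (mem_natNb hadj) (cliqueFree_natGraph h3) (c4Dominated_natGraph h4)
  have F := frame_eval searchCode (initialState adj)
  obtain ⟨hout, hcost⟩ := outputCode_spec hg hD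
  rw [F.out (by decide), show (initialState adj).out = [] from rfl, List.nil_append] at hout
  set s := searchCode.eval (initialState adj)
  set nb := sortedNb n (natNb adj)
  set rk := degreeRank n (natNb adj)
  set sel := (List.range n).filter fun x => s.arr aSkip x = 0 with hseldef
  have hmem : ∀ x, x ∈ sel ↔ Selected n (natGraph G) rk x := by
    intro x
    simp only [hseldef, List.mem_filter, List.mem_range, decide_eq_true_eq]
    exact ⟨fun h => (hsel x h.1).mp h.2, fun h => ⟨h.1, (hsel x h.1).mpr h⟩⟩
  have hnd : sel.Nodup := List.nodup_range.filter _
  have hnb : ∀ x, ∀ y ∈ nb x, y < n := fun x y hy => H.lt _ _ ((H.mem _ _).mp hy).symm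
  have hDn : ∀ x ∈ sel, ∀ y ∈ D x, y < n := fun x hx y hy =>
    H.lt_of_nonempty (((hmem x).mp hx).2.1.nonempty.mono
      (((hDsel x ((hmem x).mp hx)).2 y).mp hy))
  have hne : ∀ a : Fin n, a.val ∈ sel → (G.neighborSet a).Nonempty := by
    intro a ha
    have := ((hmem a).mp ha).2.1.nonempty
    rwa [neighborSet_natGraph, Set.image_nonempty] at this
  have hsides : ∀ a : Fin n, a.val ∈ sel →
      sidesOf (toFin n (nb a), toFin n (D a)) = bicliqueOf G a := by
    intro a ha
    rw [bicliqueOf_eq, sidesOf]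
    congr 2
    · ext b
      refine mem_toFin.trans ?_
      rw [H.mem, natGraph_adj]
    · ext b
      refine mem_toFin.trans ?_
      rw [(hDsel a ((hmem a).mp ha)).2]
      exact dominates_natGraph
  have hsides' : (sel.map fun x => (toFin n (nb x), toFin n (D x))).map sidesOf =
      sel.map fun x => sidesOf (toFin n (nb x), toFin n (D x)) := by rw [List.map_map]; rfl
  have hsize : listingSize (sel.map fun x => (toFin n (nb x), toFin n (D x))) =
      (sel.map fun x => (nb x).length + (D x).length).sum := by
    rw [listingSize, List.map_map]
    refine congrArg _ (List.map_congr_left fun x hx => ?_)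
    simp only [Function.comp_apply]
    rw [length_toFin (hnb x), length_toFin (hDn x hx)]
  refine ⟨sel.map fun x => (toFin n (nb x), toFin n (D x)), ?_, ⟨?_, ?_, fun B => ?_⟩, ?_, ?_⟩
  · rw [hout, List.flatMap_map]
    exact List.flatMap_congr fun x hx => (writeBiclique_toFin (hnb x) (hDn x hx)).symm
  · intro b hb
    obtain ⟨x, hx, rfl⟩ := List.mem_map.mp hb
    exact ⟨nodup_toFin (hnb x) (H.nodup x),
      nodup_toFin (hDn x hx) (hDsel x ((hmem x).mp hx)).1⟩
  · rw [hsides']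
    refine hnd.map_on fun x hx y hy hxy => ?_
    have hx' := (hmem x).mp hx
    have hy' := (hmem y).mp hy
    have h1 := hsides ⟨x, hx'.1⟩ hx
    have h2 := hsides ⟨y, hy'.1⟩ hy
    refine H.selected_injective hx' hy' ((bicliqueOf_natGraph_inj (hne ⟨x, hx'.1⟩ hx)
      (hne ⟨y, hy'.1⟩ hy)).mpr ?_)
    rw [← h1, ← h2]
    exact hxy
  · rw [hsides', List.mem_map, mem_maximalBicliques_iff h3 h4]
    constructor
    · rintro ⟨x, hx, rfl⟩
      exact ⟨⟨x, ((hmem x).mp hx).1⟩, hne ⟨x, ((hmem x).mp hx).1⟩ hx,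
        (hsides ⟨x, ((hmem x).mp hx).1⟩ hx).symm⟩
    · rintro ⟨v, hv, rfl⟩
      obtain ⟨x, hx, hB⟩ := H.exists_selected (v := v) (by
        rw [neighborSet_natGraph]; exact hv.image _)
      have hxs := (hmem x).mpr hx
      exact ⟨x, hxs, (hsides ⟨x, hx.1⟩ hxs).trans ((bicliqueOf_natGraph_inj (a := ⟨x, hx.1⟩)
        (hne ⟨x, hx.1⟩ hxs) hv).mp hB)⟩
  · rw [hsize]
    have hle : ∀ k ∈ sel.map fun x => (nb x).length + (D x).length, k ≤ 2 * n := by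
      intro k hk
      obtain ⟨x, hx, rfl⟩ := List.mem_map.mp hk
      have h1 := (nodup_toFin (hnb x) (H.nodup x)).length_le_card
      have h2 := (nodup_toFin (hDn x hx) (hDsel x ((hmem x).mp hx)).1).length_le_card
      rw [length_toFin (hnb x), Fintype.card_fin] at h1
      rw [length_toFin (hDn x hx), Fintype.card_fin] at h2
      omega
    have hlen : sel.length ≤ n := by
      simpa using List.length_filter_le (fun x => decide (s.arr aSkip x = 0)) (List.range n)
    refine (List.sum_le_card_nsmul _ _ hle).trans ?_
    rw [List.length_map, smul_eq_mul]
    nlinarith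
  · rw [hsize]
    refine hcost.trans (Nat.add_le_add_left ?_ _)
    have hset : (Finset.range n).filter (fun x => s.arr aSkip x = 0) = sel.toFinset := by
      ext x; simp [hseldef]
    rw [hset, ← List.sum_toFinset _ hnd, Finset.mul_sum]
    refine Finset.sum_le_sum fun x hx => ?_
    -- Selected vertices have a neighbour, so the constant `14` per biclique is absorbed: `14 + 9 k
    -- ≤ 23 k` for `k ≥ 1`.
    have hpos : (nb x).length ≠ 0 := by
      intro h0
      obtain ⟨y, hy⟩ := ((hmem x).mp (List.mem_toFinset.mp hx)).2.1.nonempty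
      have := (H.mem x y).mpr hy
      rw [List.length_eq_zero_iff.mp h0] at this
      simp at this
    omega

end Transfer

/-! ### Time and space in terms of `n`, `m` and the arboricity -/

section Bounds

open ArrCmd

variable {n : ℕ} {G : SimpleGraph (Fin n)} {adj : Fin n → List (Fin n)}

lemma fits_searchCode : searchCode.Fits 1 := by
  simp +decide [searchCode, prepareCode, bucketCode, orderCode, adjacencyCode, entryCode, mainCode,
    roundCode, tailCode, scoutCode, twinCode, chainCode, scanCode, scanBody, clearCode, countCode,
    pairCode, pairBody, testCode, addCode, linkCode, squares, each, push, ArrCmd.Fits]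

lemma fits_outputCode : outputCode.Fits 1 := by
  simp +decide [outputCode, each, ArrCmd.Fits]

lemma noSucc_outputCode : outputCode.NoSucc := by
  simp [outputCode, each, ArrCmd.NoSucc, ArrExpr.succs]

lemma length_adj (hadj : IsAdjacencyLists G adj) (v : Fin n) :
    (adj v).length = (G.neighborSet v).ncard := by
  rw [← List.toFinset_card_of_nodup (hadj v).1, ← Set.ncard_coe_finset]
  congr 1
  ext w
  simp [(hadj v).2]

lemma sum_length_adj (hadj : IsAdjacencyLists G adj) :
    ∑ v, (adj v).length = 2 * G.edgeSet.ncard := by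
  simp only [length_adj hadj]
  exact sum_degree_eq G

/-- The first bound gives the stated complexity. The second one is crude and serves only to bound
the words by a power of `n + 2`, for which no estimate of the arboricity is needed. -/
lemma searchCode_cost_le (h3 : G.CliqueFree 3) (h4 : C4Dominated G)
    (hadj : IsAdjacencyLists G adj) :
    searchCode.cost (initialState adj) ≤ 16 + 191 * n + 280 * G.edgeSet.ncard +
      230 * (arboricity G * G.edgeSet.ncard) ∧
    searchCode.cost (initialState adj) ≤ 16 + 191 * n + 140 * n ^ 2 + 115 * n ^ 3 := by
  classical
  have hI := isInput_natNb hadj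
  obtain ⟨-, hc⟩ := searchCode_spec hI isInitial_initialState
    (mem_natNb hadj) (cliqueFree_natGraph h3) (c4Dominated_natGraph h4)
  generalize searchCode.cost (initialState adj) = c at *
  constructor
  · have h1 : ∑ v ∈ Finset.range n, (natNb adj v).length = 2 * G.edgeSet.ncard := by
      rw [Finset.sum_range, ← sum_length_adj hadj]
      exact Finset.sum_congr rfl fun v _ => length_natNb v
    have h2 := sum_low_degree_le G (fun v => degreeRank n (natNb adj) v) fun v w hvw => by
      have := length_le_of_degreeRank_lt hI v.isLt w.isLt hvw
      rwa [length_natNb, length_natNb, length_adj hadj, length_adj hadj] at this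
    have h3 : ∑ v ∈ Finset.range n, ∑ u ∈ Finset.range n, (if (natGraph G).Adj v u ∧
        degreeRank n (natNb adj) u < degreeRank n (natNb adj) v then (natNb adj u).length else 0) =
        ∑ v : Fin n, ∑ u : Fin n with G.Adj v u ∧
          degreeRank n (natNb adj) u < degreeRank n (natNb adj) v, (G.neighborSet u).ncard := by
      rw [Finset.sum_range]
      refine Finset.sum_congr rfl fun v _ => ?_
      rw [Finset.sum_range, Finset.sum_filter]
      refine Finset.sum_congr rfl fun u _ => ?_
      simp only [natGraph_adj, length_natNb, length_adj hadj]
    rw [h1, h3] at hc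
    omega
  · have hlen : ∀ v < n, (natNb adj v).length ≤ n := fun v hv => (hI.length_lt hv).le
    have h1 : ∑ v ∈ Finset.range n, (natNb adj v).length ≤ n * n := by
      simpa using Finset.sum_le_card_nsmul (Finset.range n) _ n
        fun v hv => hlen v (Finset.mem_range.mp hv)
    have h2 : ∑ v ∈ Finset.range n, ∑ u ∈ Finset.range n, (if (natGraph G).Adj v u ∧
        degreeRank n (natNb adj) u < degreeRank n (natNb adj) v then (natNb adj u).length else 0) ≤
        n * (n * n) := by
      refine (Finset.sum_le_card_nsmul _ _ (n * n) fun v _ => ?_).trans_eq (by simp)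
      refine (Finset.sum_le_card_nsmul _ _ n fun u hu => ?_).trans_eq (by simp)
      split_ifs
      · exact hlen u (Finset.mem_range.mp hu)
      · exact Nat.zero_le _
    nlinarith

/-- The program that lists the maximal bicliques. -/
def enumerationProgram : Program :=
  .seq baseCode (.seq (searchCode.compile 0) (outputCode.compile 0))

lemma le_two_mul_of_noIsolated (h : NoIsolated G) : n ≤ 2 * G.edgeSet.ncard := by
  rw [← sum_degree_eq G]
  have : ∀ v ∈ (Finset.univ : Finset (Fin n)), 1 ≤ (G.neighborSet v).ncard := fun v _ =>
    (Set.ncard_pos (Set.toFinite _)).mpr (h v)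
  simpa using Finset.card_nsmul_le_sum _ _ 1 this

theorem enumeration (h3 : G.CliqueFree 3) (h4 : C4Dominated G) (hadj : IsAdjacencyLists G adj) :
    ∃ (space time : ℕ) (τ : State) (bs : List (List (Fin n) × List (Fin n))),
      Run space ((n + 2) ^ 17) enumerationProgram (startState adj) time τ ∧
      τ.out = bs.flatMap writeBiclique ∧ ListsMaximalBicliques G bs ∧
      time ≤ 30000 * (n ^ 2 + arboricity G * G.edgeSet.ncard + 1) ∧
      time ≤ 30000 * (n + arboricity G * G.edgeSet.ncard + listingSize bs + 1) ∧
      space ≤ 30000 * (n + arboricity G * G.edgeSet.ncard + 1) ∧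
      (NoIsolated G →
        time ≤ 30000 * (arboricity G * G.edgeSet.ncard + listingSize bs + 1) ∧
        space ≤ 30000 * (arboricity G * G.edgeSet.ncard + 1)) := by
  obtain ⟨bs, hout, hbs, hsize, hcost'⟩ := exists_listing h3 h4 hadj
  obtain ⟨hcost, hpoly⟩ := searchCode_cost_le h3 h4 hadj
  have hm := ncard_edgeSet_le G
  have hlen : (inputWords adj).length = n + 1 + 2 * G.edgeSet.ncard := by
    rw [inputWords_length, sum_length_adj hadj]
  have hlen' : (inputWords adj).length ≤ n + 1 + n * n := by
    rw [inputWords_length]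
    refine Nat.add_le_add_left ?_ _
    have : ∀ v ∈ (Finset.univ : Finset (Fin n)), (adj v).length ≤ n := fun v _ => by
      simpa using (hadj v).1.length_le_card
    simpa using Finset.sum_le_card_nsmul _ _ n this
  -- Memory and values are at most `2 ^ 14 * (n + 2) ^ 3`; as `n + 2 ≥ 2`, the constant is absorbed
  -- by `14` further factors, whence the exponent `17`.
  have hS : (inputWords adj).length + 32 * (1 + n + searchCode.cost (initialState adj)) + 32 ≤
      (n + 2) ^ 17 := by
    have h14 : 2 ^ 14 ≤ (n + 2) ^ 14 := Nat.pow_le_pow_left (by omega) 14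
    calc _ ≤ 2 ^ 14 * (n + 2) ^ 3 := by nlinarith
      _ ≤ (n + 2) ^ 14 * (n + 2) ^ 3 := Nat.mul_le_mul_right _ h14
      _ = (n + 2) ^ 17 := by ring
  obtain ⟨t, τ, hrun, hτ, ht⟩ := run_commands adj (fun v => (hadj v).1) fits_searchCode
    fits_outputCode noSucc_outputCode rfl hS
  refine ⟨_, t, τ, bs, hrun, hτ.trans hout, hbs, ?_⟩
  generalize searchCode.cost (initialState adj) = c at *
  generalize outputCode.cost (searchCode.eval (initialState adj)) = c' at *
  have hn2 : n ≤ n ^ 2 := Nat.le_self_pow (by norm_num) n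
  have hiso := fun h : NoIsolated G => le_two_mul_of_noIsolated h
  generalize listingSize bs = o at *
  generalize arboricity G * G.edgeSet.ncard = A at *
  rw [hlen]
  clear hS hpoly hlen' hlen hrun hτ hout hbs
  -- The constant `30000` is dictated by the space bound without isolated vertices, where `n ≤ 2 m`
  -- and `m ≤ α m` give the coefficient `28612` of `α m`.
  refine ⟨by omega, by omega, by omega, fun h => ?_⟩
  have := hiso h
  omega

end Bounds

end BicliqueEnum
theorem mainTheorem8 :
    (∃ (P : BicliqueEnum.Program) (C K : ℕ),
      ∀ (n : ℕ) (G : SimpleGraph (Fin n)) (adj : Fin n → List (Fin n)),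
        G.CliqueFree 3 → BicliqueEnum.C4Dominated G → BicliqueEnum.IsAdjacencyLists G adj →
        ∃ (space time : ℕ) (τ : BicliqueEnum.State) (bs : List (List (Fin n) × List (Fin n))),
          BicliqueEnum.Run space ((n + 2) ^ K) P (BicliqueEnum.startState adj) time τ ∧
          τ.out = bs.flatMap BicliqueEnum.writeBiclique ∧
          BicliqueEnum.ListsMaximalBicliques G bs ∧
          time ≤ C * (n ^ 2 + BicliqueEnum.arboricity G * G.edgeSet.ncard + 1) ∧
          time ≤ C * (n + BicliqueEnum.arboricity G * G.edgeSet.ncard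
            + BicliqueEnum.listingSize bs + 1) ∧
          space ≤ C * (n + BicliqueEnum.arboricity G * G.edgeSet.ncard + 1) ∧
          (BicliqueEnum.NoIsolated G →
            time ≤ C * (BicliqueEnum.arboricity G * G.edgeSet.ncard
              + BicliqueEnum.listingSize bs + 1) ∧
            space ≤ C * (BicliqueEnum.arboricity G * G.edgeSet.ncard + 1))) ∧
    (∀ (V : Type*) [Finite V] [LinearOrder V] (G : SimpleGraph V),
      G.CliqueFree 3 → BicliqueEnum.C4Dominated G → BicliqueEnum.TwinFree G →
      BicliqueEnum.DegreeOrdered G →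
        (∀ v : V, (∃ w : V, v < w ∧ BicliqueEnum.bicliqueOf G v = BicliqueEnum.bicliqueOf G w) ↔
          BicliqueEnum.Repeated G v) ∧
        (BicliqueEnum.NoIsolated G →
          Set.BijOn (BicliqueEnum.bicliqueOf G) {v | ¬ BicliqueEnum.Repeated G v}
            (BicliqueEnum.maximalBicliques G) ∧
          (∀ v w : V, BicliqueEnum.Dominates G v w ↔
            Relation.ReflTransGen (BicliqueEnum.dominationDigraph G) w v) ∧
          BicliqueEnum.edgeCount (BicliqueEnum.dominationDigraph G) ≤
            BicliqueEnum.edgeCount (BicliqueEnum.squaresDigraph G) + 2 * G.edgeSet.ncard)) := by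
  refine ⟨⟨BicliqueEnum.enumerationProgram, 30000, 17, fun n G adj h3 h4 hadj =>
    BicliqueEnum.enumeration h3 h4 hadj⟩, fun V _ _ G h3 h4 ht ho =>
    ⟨fun v => BicliqueEnum.repeated_iff ht v, fun hi =>
      ⟨BicliqueEnum.bijOn_bicliqueOf h3 h4 ht hi, BicliqueEnum.dominates_iff_path h4 ht ho hi,
        BicliqueEnum.edgeCount_dominationDigraph_le h4 ht ho⟩⟩⟩
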